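/- Let $N\ge 3$, $2^*=\frac{2N}{N-2}$, and let $\mathcal D^{1,2}(\mathbb R^N)$ be the completion of $C_0^\infty(\mathbb R^N)$ (real-valued functions) in the norm $\|u\|=\left(\int_{\mathbb R^N}|\nabla u|^2dx\right)^{1/2}$, realized as a space of functions in $L^{2^*}(\mathbb R^N)$. Let $f:\mathbb R\to\mathbb R$ be continuous, put $F(s)=\int_0^s f(\sigma)\,d\sigma$, and assume that $\sup_{\mathbb R} F>0$ and that, for some constant $C$, $$|f(s)|\le C|s|^{2^*-1}\qquad (s\in\mathbb R).$$ For $u\in\mathcal D^{1,2}(\mathbb R^N)$ define $$\psi(u)=\int_{\mathbb R^N}F(u)\,dx,\qquad G(u)=\tfrac12\|u\|^2-\psi(u),$$ and for $t>0$ let $\kappa(t)=\sup\{\psi(u):u\in\mathcal D^{1,2}(\mathbb R^N),\ \|u\|^2=t\}$. A critical point of $G$ is a $u\in\mathcal D^{1,2}(\mathbb R^N)$ at which $G$ is Fréchet differentiable with $G'(u)=0$. Let $c(G)=\inf_{\varphi\in\Phi_G}\sup_{t\ge0}G(\varphi_t)$ (equal to $+\infty$ if $\Phi_G=\emptyset$),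 where $\Phi_G$ is the set of continuous paths $\varphi:[0,\infty)\to H^1(\mathbb R^N)$ with $\varphi_0=0$ and $\lim_{t\to\infty}G(\varphi_t)=-\infty$. Let $$t_0=(2^*\kappa(1))^{-\frac{N-2}{2}}.$$ Then every maximizer $w$ for $\kappa(t_0)$ (that is, $w\in\mathcal D^{1,2}(\mathbb R^N)$, $\|w\|^2=t_0$ and $\psi(u)\le\psi(w)$ whenever $\|u\|^2=t_0$) is a critical point of $G$. Moreover: (i) for every such $w$, $0<G(w)=c(G)=\max_{t\ge0}G(w(\cdot/t))$, where $w(\cdot/t)$ is understood as $0$ for $t=0$; (ii) if $v$ is a critical point of $G$ with $\psi(v)>0$, then $G(v)\ge c(G)$. Both (i) and (ii) also hold when $\Phi_G$ is replaced, in the definition of $c(G)$, by the set of paths with the same two properties that are continuous as maps $[0,\infty)\to\mathcal D^{1,2}(\mathbb R^N)$. -/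

import Mathlib

open MeasureTheory Filter Topology
open scoped ENNReal NNReal ContDiff

noncomputable section

namespace CriticalProblem

/-- The Euclidean space `ℝ^N`. -/
abbrev RN (N : ℕ) : Type := EuclideanSpace ℝ (Fin N)

/-- The critical Sobolev exponent `2* = 2N/(N-2)`, used for `N > 2`. -/
def critExp (N : ℕ) : ℝ := 2 * (N : ℝ) / ((N : ℝ) - 2)

/-- The critical Sobolev exponent as an exponent of `L^p`-spaces. -/
def critExpE (N : ℕ) : ℝ≥0∞ := ENNReal.ofReal (critExp N)

theorem one_le_critExp (N : ℕ) [hN : Fact (2 < N)] : 1 ≤ critExp N := by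
  have h : (2 : ℝ) < N := by exact_mod_cast hN.out
  rw [critExp, le_div_iff₀ (by linarith)]
  linarith

instance instFactCritExpE (N : ℕ) [Fact (2 < N)] : Fact (1 ≤ critExpE N) :=
  ⟨by rw [critExpE, ← ENNReal.ofReal_one]; exact ENNReal.ofReal_le_ofReal (one_le_critExp N)⟩

/-- `L^{2*}(ℝ^N)`. -/
abbrev LCrit (N : ℕ) : Type := Lp ℝ (critExpE N) (volume : Measure (RN N))

/-- `L²(ℝ^N; ℝ^N)`. -/
abbrev LTwoVec (N : ℕ) : Type := Lp (RN N) 2 (volume : Measure (RN N))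

/-- `φ ∈ C_0^∞(ℝ^N)`. -/
def IsTest {N : ℕ} (φ : RN N → ℝ) : Prop := ContDiff ℝ ∞ φ ∧ HasCompactSupport φ

theorem gradient_add' {N : ℕ} {φ χ : RN N → ℝ} (hφ : Differentiable ℝ φ)
    (hχ : Differentiable ℝ χ) : gradient (φ + χ) = gradient φ + gradient χ := by
  funext x
  simp [gradient, fderiv_add (hφ x) (hχ x)]

theorem gradient_const_smul' {N : ℕ} {φ : RN N → ℝ} (a : ℝ) (hφ : Differentiable ℝ φ) :
    gradient (a • φ) = a • gradient φ := by
  funext x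
  simp [gradient, fderiv_const_smul (hφ x) a]

/-- The pairs `(φ, ∇φ)` with `φ ∈ C_0^∞(ℝ^N)`, as a subspace of `L^{2*} × L²`. -/
def testPairs (N : ℕ) [Fact (2 < N)] : Submodule ℝ (LCrit N × LTwoVec N) where
  carrier := {p | ∃ φ : RN N → ℝ, IsTest φ ∧ p.1 =ᵐ[volume] φ ∧ p.2 =ᵐ[volume] gradient φ}
  zero_mem' := by
    refine ⟨0, ⟨contDiff_const, HasCompactSupport.zero⟩, Lp.coeFn_zero _ _ _, ?_⟩
    have : gradient (0 : RN N → ℝ) = 0 := by funext x; simp [gradient]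
    rw [this]
    exact Lp.coeFn_zero _ _ _
  add_mem' := by
    rintro p q ⟨φ, hφ, h1, h2⟩ ⟨χ, hχ, h3, h4⟩
    refine ⟨φ + χ, ⟨hφ.1.add hχ.1, hφ.2.add hχ.2⟩, (Lp.coeFn_add _ _).trans (h1.add h3), ?_⟩
    rw [gradient_add' (hφ.1.differentiable (by simp)) (hχ.1.differentiable (by simp))]
    exact (Lp.coeFn_add _ _).trans (h2.add h4)
  smul_mem' := by
    rintro a p ⟨φ, hφ, h1, h2⟩
    refine ⟨a • φ, ⟨contDiff_const.smul hφ.1, hφ.2.smul_left (f := fun _ => a)⟩,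
      (Lp.coeFn_smul _ _).trans (h1.const_smul a), ?_⟩
    rw [gradient_const_smul' a (hφ.1.differentiable (by simp))]
    exact (Lp.coeFn_smul _ _).trans (h2.const_smul a)

/-- The space `𝒟^{1,2}(ℝ^N)`, `N > 2`: the completion of `C_0^∞(ℝ^N)` in the gradient norm.
By the Sobolev inequality a sequence in `C_0^∞` that is Cauchy in the gradient norm converges in
`L^{2*}`, so the completion is realized as the closure of the pairs `(φ, ∇φ)`, `φ ∈ C_0^∞`, in
`L^{2*} × L²`; an element is a function together with its weak gradient. The norm of the space,
given below, is the gradient norm. -/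
def D12 (N : ℕ) [Fact (2 < N)] : Type := (testPairs N).topologicalClosure

section

variable {N : ℕ} [Fact (2 < N)]

instance instAddCommGroupD12 : AddCommGroup (D12 N) :=
  inferInstanceAs (AddCommGroup (testPairs N).topologicalClosure)

instance instModuleD12 : Module ℝ (D12 N) :=
  inferInstanceAs (Module ℝ (testPairs N).topologicalClosure)

/-- The pair `(u, ∇u)` of an element of `𝒟^{1,2}`. -/
def D12.toPair : D12 N →ₗ[ℝ] LCrit N × LTwoVec N := (testPairs N).topologicalClosure.subtype

/-- An element of `𝒟^{1,2}` from its pair `(u, ∇u)`. -/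
def D12.ofPair (p : LCrit N × LTwoVec N) (hp : p ∈ (testPairs N).topologicalClosure) : D12 N :=
  Subtype.mk p hp

theorem D12.toPair_mem (u : D12 N) : u.toPair ∈ (testPairs N).topologicalClosure :=
  Subtype.property (p := fun p => p ∈ (testPairs N).topologicalClosure) u

@[simp]
theorem D12.toPair_ofPair (p : LCrit N × LTwoVec N)
    (hp : p ∈ (testPairs N).topologicalClosure) : (D12.ofPair p hp).toPair = p := rfl

theorem D12.toPair_injective : Function.Injective (D12.toPair (N := N)) :=
  (testPairs N).topologicalClosure.injective_subtype

/-- The element of `𝒟^{1,2}` as an element of `L^{2*}`. -/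
def D12.toLCrit (u : D12 N) : LCrit N := u.toPair.1

/-- The gradient of an element of `𝒟^{1,2}`, as a linear map to `L²`. -/
def D12.grad : D12 N →ₗ[ℝ] LTwoVec N :=
  (LinearMap.snd ℝ (LCrit N) (LTwoVec N)).comp D12.toPair

instance instCoeFunD12 : CoeFun (D12 N) (fun _ => RN N → ℝ) := ⟨fun u => u.toLCrit⟩

/-- The Sobolev inequality on `𝒟^{1,2}`. -/
theorem D12.sobolev (N : ℕ) [hN : Fact (2 < N)] :
    ∃ K : ℝ, ∀ u : D12 N, ‖u.toLCrit‖ ≤ K * ‖D12.grad u‖ := by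
  have h2 : (2 : ℝ) < N := by exact_mod_cast hN.out
  let K : ℝ≥0 := eLpNormLESNormFDerivOfEqInnerConst (volume : Measure (RN N)) 2
  refine ⟨K, fun u => ?_⟩
  have hcl : IsClosed {p : LCrit N × LTwoVec N | ‖p.1‖ ≤ K * ‖p.2‖} :=
    isClosed_le (by fun_prop) (by fun_prop)
  have hsub : ((testPairs N : Submodule ℝ (LCrit N × LTwoVec N)) : Set (LCrit N × LTwoVec N)) ⊆
      {p | ‖p.1‖ ≤ K * ‖p.2‖} := by
    rintro p ⟨φ, hφ, h1, h3⟩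
    have hs := eLpNorm_le_eLpNorm_fderiv_of_eq_inner (volume : Measure (RN N))
      (hφ.1.of_le (by simp)) hφ.2 (p := 2) (p' := (critExp N).toNNReal) (by norm_num)
      (by
        rw [finrank_euclideanSpace, Fintype.card_fin]; exact lt_trans two_pos hN.out) (by
        rw [Real.coe_toNNReal _ (zero_le_one.trans (one_le_critExp N)), critExp]
        simp only [finrank_euclideanSpace, Fintype.card_fin]
        have : (N : ℝ) - 2 ≠ 0 := by linarith
        have : (N : ℝ) ≠ 0 := by linarith
        push_cast
        field_simp)
    have hg : eLpNorm (fderiv ℝ φ) 2 volume = eLpNorm p.2 2 volume := by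
      rw [eLpNorm_congr_ae h3]
      apply eLpNorm_congr_norm_ae
      filter_upwards with x
      simp [gradient]
    have h4 : eLpNorm p.1 (critExpE N) volume ≤ K * eLpNorm p.2 2 volume := by
      rw [← hg, eLpNorm_congr_ae h1]
      exact hs
    change ‖p.1‖ ≤ K * ‖p.2‖
    rw [Lp.norm_def, Lp.norm_def, ← ENNReal.coe_toReal, ← ENNReal.toReal_mul]
    exact ENNReal.toReal_mono (ENNReal.mul_ne_top ENNReal.coe_ne_top (Lp.eLpNorm_ne_top _)) h4
  exact closure_minimal hsub hcl u.toPair_mem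

theorem D12.grad_injective : Function.Injective (D12.grad (N := N)) := by
  rw [← LinearMap.ker_eq_bot, LinearMap.ker_eq_bot']
  intro u hu
  obtain ⟨K, hK⟩ := D12.sobolev N
  have h := hK u
  rw [hu, norm_zero, mul_zero] at h
  exact D12.toPair_injective ((Prod.ext (norm_le_zero_iff.1 h) hu).trans (map_zero _).symm)

/-- `𝒟^{1,2}` carries the gradient norm `‖u‖ = (∫ |∇u|² dx)^{1/2}`. -/
instance instNormedAddCommGroupD12 : NormedAddCommGroup (D12 N) :=
  NormedAddCommGroup.induced (D12 N) (LTwoVec N) (D12.grad (N := N)) D12.grad_injective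

instance instNormedSpaceD12 : NormedSpace ℝ (D12 N) :=
  NormedSpace.induced ℝ (D12 N) (LTwoVec N) (D12.grad (N := N))

end

/-! ### Dilations `u ↦ u(·/t)` -/

section

variable {N : ℕ}

theorem map_dil {t : ℝ} (ht : 0 < t) :
    Measure.map (fun x : RN N => t⁻¹ • x) volume = ENNReal.ofReal (t ^ N) • volume := by
  rw [Measure.map_addHaar_smul volume (inv_ne_zero ht.ne')]
  simp [abs_of_pos ht]

theorem memLp_dil {V : Type*} [NormedAddCommGroup V] {t : ℝ} (ht : 0 < t) {p : ℝ≥0∞} {f : RN N → V} (hf : MemLp f p volume) :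
    MemLp (fun x => f (t⁻¹ • x)) p volume := by
  refine MemLp.comp_of_map (f := fun x : RN N => t⁻¹ • x) (g := f) ?_ (by fun_prop)
  rw [map_dil ht]
  exact hf.smul_measure ENNReal.ofReal_ne_top

theorem ae_dil {V : Type*} {t : ℝ} (ht : 0 < t) {f g : RN N → V} (h : f =ᵐ[volume] g) :
    (fun x => f (t⁻¹ • x)) =ᵐ[volume] fun x => g (t⁻¹ • x) :=
  (Measure.quasiMeasurePreserving_smul volume (inv_ne_zero ht.ne')).ae_eq h

/-- The map `f ↦ f(·/t)` on `L^p(ℝ^N; V)`, for `t > 0`. -/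
def dilLp {V : Type*} [NormedAddCommGroup V] [NormedSpace ℝ V] (t : ℝ) (ht : 0 < t) (p : ℝ≥0∞) [Fact (1 ≤ p)] :
    Lp V p (volume : Measure (RN N)) →L[ℝ] Lp V p (volume : Measure (RN N)) :=
  LinearMap.mkContinuous
    { toFun := fun f => (memLp_dil ht (Lp.memLp f)).toLp _
      map_add' := fun f g => by
        rw [← MemLp.toLp_add]
        exact MemLp.toLp_congr _ _ (ae_dil ht (Lp.coeFn_add f g))
      map_smul' := fun a f => by
        rw [RingHom.id_apply, ← MemLp.toLp_const_smul]
        exact MemLp.toLp_congr _ _ (ae_dil ht (Lp.coeFn_smul a f)) }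
    ((ENNReal.ofReal (t ^ N)) ^ (1 / p).toReal).toReal
    (fun f => by
      change ‖(memLp_dil ht (Lp.memLp f)).toLp _‖ ≤ _
      rw [Lp.norm_toLp, Lp.norm_def, ← ENNReal.toReal_mul]
      have h0 : ENNReal.ofReal (t ^ N) ≠ 0 := by
        rw [Ne, ENNReal.ofReal_eq_zero, not_le]; positivity
      have h1 := eLpNorm_map_measure (p := p) (μ := (volume : Measure (RN N))) (g := f)
        (f := fun x : RN N => t⁻¹ • x)
        (by rw [map_dil ht]; exact (Lp.aestronglyMeasurable f).smul_measure _) (by fun_prop)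
      rw [map_dil ht, eLpNorm_smul_measure_of_ne_zero h0, smul_eq_mul] at h1
      exact (congrArg ENNReal.toReal h1.symm).le)

theorem dilLp_ae {V : Type*} [NormedAddCommGroup V] [NormedSpace ℝ V] (t : ℝ) (ht : 0 < t) (p : ℝ≥0∞) [Fact (1 ≤ p)]
    (f : Lp V p (volume : Measure (RN N))) :
    dilLp t ht p f =ᵐ[volume] fun x => f (t⁻¹ • x) :=
  MemLp.coeFn_toLp (memLp_dil ht (Lp.memLp f))

theorem gradient_dil {t : ℝ} {φ : RN N → ℝ} (hφ : Differentiable ℝ φ) :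
    gradient (fun x => φ (t⁻¹ • x)) = fun x => t⁻¹ • gradient φ (t⁻¹ • x) := by
  funext x
  have h : fderiv ℝ (fun x => φ (t⁻¹ • x)) x = t⁻¹ • fderiv ℝ φ (t⁻¹ • x) := by
    have h1 : HasFDerivAt (fun x : RN N => t⁻¹ • x)
      (t⁻¹ • ContinuousLinearMap.id ℝ (RN N)) x := (hasFDerivAt_id x).const_smul t⁻¹
    have h2 : HasFDerivAt (fun x => φ (t⁻¹ • x)) ((fderiv ℝ φ (t⁻¹ • x)).comp
        (t⁻¹ • ContinuousLinearMap.id ℝ (RN N))) x :=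
      HasFDerivAt.comp (g := φ) x (hφ (t⁻¹ • x)).hasFDerivAt h1
    rw [h2.fderiv]
    ext y
    simp
  simp [gradient, h]

variable [Fact (2 < N)]

/-- The pair `(u(·/t), ∇(u(·/t))) = (u(·/t), t⁻¹ (∇u)(·/t))`. -/
def dilPair (t : ℝ) (ht : 0 < t) : LCrit N × LTwoVec N →L[ℝ] LCrit N × LTwoVec N :=
  (dilLp t ht (critExpE N)).prodMap (t⁻¹ • dilLp t ht 2)

theorem dilPair_mem (t : ℝ) (ht : 0 < t) (p : LCrit N × LTwoVec N)
    (hp : p ∈ (testPairs N).topologicalClosure) :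
    dilPair t ht p ∈ (testPairs N).topologicalClosure := by
  refine map_mem_closure (dilPair t ht).continuous hp ?_
  rintro q ⟨φ, hφ, h1, h2⟩
  refine ⟨fun x => φ (t⁻¹ • x), ⟨hφ.1.comp (by fun_prop), ?_⟩, ?_, ?_⟩
  · exact hφ.2.comp_smul (inv_ne_zero ht.ne')
  · exact (dilLp_ae t ht _ q.1).trans (ae_dil ht h1)
  · rw [gradient_dil (hφ.1.differentiable (by simp))]
    exact (Lp.coeFn_smul _ _).trans (((dilLp_ae t ht _ q.2).trans (ae_dil ht h2)).const_smul t⁻¹)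

open Classical in
/-- The element `u(·/t)` of `𝒟^{1,2}` for `t > 0`. At `t = 0` the path `t ↦ u(·/t)` is extended by
its limit `0`; the value `0` for `t < 0` is never used. -/
def D12.dilate (t : ℝ) (u : D12 N) : D12 N :=
  if ht : 0 < t then D12.ofPair (dilPair t ht u.toPair) (dilPair_mem t ht u.toPair u.toPair_mem)
  else 0

theorem D12.dilate_ae {t : ℝ} (ht : 0 < t) (u : D12 N) :
    D12.dilate t u =ᵐ[volume] fun x => u (t⁻¹ • x) := by
  have h : D12.dilate t u =
      D12.ofPair (dilPair t ht u.toPair) (dilPair_mem t ht u.toPair u.toPair_mem) := dif_pos ht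
  rw [h]
  exact dilLp_ae t ht _ u.toLCrit

end

/-! ### The functionals -/

/-- `F(s) = ∫_0^s f(σ) dσ`. -/
def primitive (f : ℝ → ℝ) (s : ℝ) : ℝ := ∫ σ in (0 : ℝ)..s, f σ

section

variable {N : ℕ} [Fact (2 < N)]

/-- `ψ(u) = ∫ F(u) dx`. -/
def psi (f : ℝ → ℝ) (u : D12 N) : ℝ := ∫ x, primitive f (u x)

/-- `G(u) = ½ ‖u‖² - ψ(u)`. -/
def energy (f : ℝ → ℝ) (u : D12 N) : ℝ := ‖u‖ ^ 2 / 2 - psi f u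

/-- A critical point of a functional `G` on `𝒟^{1,2}`: `G` is Fréchet differentiable at `u` and
`G'(u) = 0`. -/
def IsCriticalPoint (G : D12 N → ℝ) (u : D12 N) : Prop :=
  HasFDerivAt G (0 : D12 N →L[ℝ] ℝ) u

/-- The continuous paths `φ : [0,∞) → 𝒟^{1,2}` with `φ 0 = 0` and `G(φ t) → -∞` as `t → ∞`. -/
def pathsD12 (G : D12 N → ℝ) : Set (ℝ≥0 → D12 N) :=
  {φ | Continuous φ ∧ φ 0 = 0 ∧ Tendsto (fun t => G (φ t)) atTop atBot}

/-- The paths as above that are continuous as maps `[0,∞) → H¹(ℝ^N)`. For `N > 2`, `H¹` is the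
subspace of `𝒟^{1,2}` of the functions in `L²`, and convergence in `H¹` is convergence in both
`𝒟^{1,2}` and `L²`. -/
def pathsH1 (G : D12 N → ℝ) : Set (ℝ≥0 → D12 N) :=
  {φ | φ ∈ pathsD12 G ∧ ∃ h : ℝ≥0 → Lp ℝ 2 (volume : Measure (RN N)),
    Continuous h ∧ ∀ t, h t =ᵐ[volume] φ t}

/-- The mountain pass level `inf_{φ ∈ Φ} sup_{t ≥ 0} G(φ t)`, with value `+∞` if `Φ` is empty. -/
def mountainPassLevel (G : D12 N → ℝ) (Φ : Set (ℝ≥0 → D12 N)) : EReal :=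
  ⨅ φ ∈ Φ, ⨆ t : ℝ≥0, (G (φ t) : EReal)

end

/-- `κ(t) = sup { ψ(u) : u ∈ 𝒟^{1,2}(ℝ^N), ‖u‖² = t }`. -/
def kappa (N : ℕ) [Fact (2 < N)] (f : ℝ → ℝ) (t : ℝ) : ℝ :=
  sSup (psi f '' {u : D12 N | ‖u‖ ^ 2 = t})

/-- `w` is a maximizer for `κ(t)`. -/
def IsKappaMaximizer {N : ℕ} [Fact (2 < N)] (f : ℝ → ℝ) (t : ℝ) (w : D12 N) : Prop :=
  ‖w‖ ^ 2 = t ∧ ∀ u : D12 N, ‖u‖ ^ 2 = t → psi f u ≤ psi f w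

/-- `t₀ = (2* κ(1))^{-(N-2)/2}`. -/
def tZero (N : ℕ) [Fact (2 < N)] (f : ℝ → ℝ) : ℝ :=
  (critExp N * kappa N f 1) ^ (-(((N : ℝ) - 2) / 2))

end CriticalProblem

end

open CriticalProblem

/-!
# A mountain pass characterization of least energy solutions at critical growth

Everything rests on the behaviour under dilations: `‖u(·/t)‖² = t^{N-2} ‖u‖²` and
`ψ(u(·/t)) = t^N ψ(u)`. Call `(N - 2) ‖u‖² = 2N ψ(u)` the Pohozaev identity for `u`. If it holds and
`ψ(u) > 0`, then `t ↦ G(u(·/t))` is maximal at `t = 1`, with value `‖u‖² / N`, and the dilation path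
of `u` is admissible in `𝒟^{1,2}`. It need not be a path in `H¹`, but the dilation paths of test
functions close to `u` are, and their maximal energies are close to `G(u)`; hence `c(G) ≤ G(u)` for
both path classes (`mountainPassLevel_le_of_pohozaev`).

Let `w` be a maximizer for `κ(t₀)`. By scaling, `ψ(u) ≤ ψ(w) (‖u‖²/t₀)^{2*/2}` for every `u`, and
`t₀` is chosen so that `2* ψ(w) = t₀ = ‖w‖²`, which is the Pohozaev identity. The functional
`ψ(w) (‖u‖²/t₀)^{2*/2} - ψ(u)` is minimal at `w`, and its derivative there is `G'(w)`, so `w` is a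
critical point (`IsKappaMaximizer.isCriticalPoint`). The same inequality gives `G ≥ 0` on the ball
`‖u‖² ≤ t₀`. So every admissible path leaves this ball, and where it crosses the sphere
`‖u‖² = t₀` its energy is at least `t₀/2 - ψ(w) = G(w)` (`IsKappaMaximizer.le_mountainPassLevel`).

For the second part it remains to prove the Pohozaev identity for an arbitrary critical point `v`
(`pohozaev_identity`). As `f` is only continuous, `v` need not have enough regularity to multiply
the equation by `x · ∇v`, and difference quotients in the dilation parameter are used instead. The
equations of `v` and of `v(·/t)`, namely `-Δv = f(v)` and `-Δ(v(·/t)) = t⁻² f(v(·/t))`, are tested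
with `η (v(·/t) - v)` for a cutoff function `η` and added. The left-hand sides give
`∫ η (|∇v(·/t)|² - |∇v|²)`, the right-hand sides give `2 ∫ η (F(v(·/t)) - F(v))`, and the scaling
of these integrals as `t ↓ 1` produces the identity. On balls `v(·/t) - v` is only `O(t - 1)` in
`L²` (`D12.eLpNorm_indicator_dilate_sub_le`), so the errors of the nonlinear terms are `o(t - 1)`
provided `|v|^{2*-1} ∈ L²`. This is supplied by one step of the Brezis–Kato iteration
(`memLp_two_rpow_of_weak_solution`). The errors caused by `η` are controlled by the tails of
`∫ |∇v|²` and `∫ |F(v)|`, and vanish as `η` increases to `1`.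
-/

namespace CriticalProblem

/-! ### Dominated convergence in `L^q` -/

theorem tendsto_eLpNorm_zero_of_dominated {α ι E : Type*} [MeasurableSpace α] {μ : Measure α}
    [NormedAddCommGroup E] {l : Filter ι} [l.IsCountablyGenerated] {q : ℝ≥0∞} (hq0 : q ≠ 0)
    (hq : q ≠ ⊤) {F : ι → α → E} {g : α → ℝ} (hF : ∀ᶠ n in l, AEStronglyMeasurable (F n) μ)
    (hg : MemLp g q μ) (hb : ∀ᶠ n in l, ∀ᵐ x ∂μ, ‖F n x‖ ≤ g x)
    (hlim : ∀ᵐ x ∂μ, Tendsto (fun n => F n x) l (𝓝 0)) :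
    Tendsto (fun n => eLpNorm (F n) q μ) l (𝓝 0) := by
  have hq' : 0 < q.toReal := ENNReal.toReal_pos hq0 hq
  have h : Tendsto (fun n => ∫⁻ x, ‖F n x‖ₑ ^ q.toReal ∂μ) l (𝓝 (∫⁻ _, 0 ∂μ)) := by
    refine tendsto_lintegral_filter_of_dominated_convergence' (fun x => ‖g x‖ₑ ^ q.toReal)
      ?_ ?_ ?_ ?_
    · filter_upwards [hF] with n hn using hn.enorm.pow_const _
    · filter_upwards [hb] with n hn
      filter_upwards [hn] with x hx
      gcongr
      exact enorm_le_iff_norm_le.2 (hx.trans (le_abs_self _))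
    · exact (lintegral_rpow_enorm_lt_top_of_eLpNorm_lt_top hq0 hq hg.2).ne
    · filter_upwards [hlim] with x hx
      have := (ENNReal.continuous_rpow_const (y := q.toReal)).tendsto _ |>.comp hx.enorm
      simpa [ENNReal.zero_rpow_of_pos hq', Function.comp_def] using this
  simp only [eLpNorm_eq_lintegral_rpow_enorm_toReal hq0 hq]
  have h2 := (ENNReal.continuous_rpow_const (y := 1 / q.toReal)).tendsto _ |>.comp h
  simpa [ENNReal.zero_rpow_of_pos (inv_pos.2 hq'), Function.comp_def] using h2

/-! ### Pointwise estimates for the nonlinearity -/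

section Pointwise

variable {f : ℝ → ℝ} {C p : ℝ}

theorem hasDerivAt_primitive (hf : Continuous f) (s : ℝ) : HasDerivAt (primitive f) (f s) s :=
  intervalIntegral.integral_hasDerivAt_right (hf.intervalIntegrable _ _)
    (hf.stronglyMeasurableAtFilter _ _) hf.continuousAt

theorem continuous_primitive (hf : Continuous f) : Continuous (primitive f) :=
  continuous_iff_continuousAt.2 fun s => (hasDerivAt_primitive hf s).continuousAt

@[simp]
theorem primitive_zero : primitive f 0 = 0 := by simp [primitive]

theorem growth_const_nonneg (hC : ∀ s : ℝ, |f s| ≤ C * |s| ^ (p - 1)) : 0 ≤ C := by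
  simpa using (abs_nonneg _).trans (hC 1)

theorem abs_primitive_le (hp : 1 < p) (hC : ∀ s : ℝ, |f s| ≤ C * |s| ^ (p - 1)) (s : ℝ) :
    |primitive f s| ≤ C * |s| ^ p := by
  have hC0 := growth_const_nonneg hC
  have h : ‖∫ σ in (0 : ℝ)..s, f σ‖ ≤ (C * |s| ^ (p - 1)) * |s - 0| := by
    refine intervalIntegral.norm_integral_le_of_norm_le_const fun x hx => (hC x).trans ?_
    have : |x| ≤ |s| := by
      rcases le_total 0 s with h | h
      · rw [Set.uIoc_of_le h] at hx
        exact abs_le_abs_of_nonneg hx.1.le hx.2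
      · rw [Set.uIoc_of_ge h] at hx
        exact abs_le_abs_of_nonpos hx.2 hx.1.le
    gcongr
  refine h.trans (le_of_eq ?_)
  rw [sub_zero, mul_assoc, ← Real.rpow_add_one' (abs_nonneg s) (by linarith), sub_add_cancel]

theorem primitive_sub (hf : Continuous f) (a b : ℝ) :
    primitive f b - primitive f a = ∫ σ in a..b, f σ := by
  rw [primitive, primitive, intervalIntegral.integral_interval_sub_left] <;>
    exact hf.intervalIntegrable _ _

/-- The oscillation `max_{|θ| ≤ 1} |f(a + θδa) - f(a)|` of `f` over the interval of radius `δ|a|`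
around `a`. The radius is taken relative to `|a|` so that for `δ ≤ 1` the oscillation is bounded
by a multiple of `|a|^{p-1}` as soon as `f` is. -/
noncomputable def relOsc (f : ℝ → ℝ) (δ a : ℝ) : ℝ :=
  sSup ((fun θ => |f (a + θ * (δ * a)) - f a|) '' Set.Icc (-1) 1)

theorem continuous_relOsc (hf : Continuous f) :
    Continuous fun q : ℝ × ℝ => relOsc f q.1 q.2 :=
  isCompact_Icc.continuous_sSup (by
    change Continuous fun z : (ℝ × ℝ) × ℝ =>
      |f (z.1.2 + z.2 * (z.1.1 * z.1.2)) - f z.1.2|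
    fun_prop)

theorem le_relOsc (hf : Continuous f) {δ a s : ℝ} (hs : |s - a| ≤ δ * |a|) :
    |f s - f a| ≤ relOsc f δ a := by
  have hbdd : BddAbove ((fun θ => |f (a + θ * (δ * a)) - f a|) '' Set.Icc (-1) 1) :=
    (isCompact_Icc.image (by fun_prop)).bddAbove
  rcases eq_or_ne (δ * a) 0 with h0 | h0
  · have h1 : s = a := by
      have : |s - a| ≤ 0 := by
        rcases mul_eq_zero.1 h0 with h | h <;> simpa [h] using hs
      linarith [abs_nonpos_iff.1 this]
    refine le_csSup hbdd ⟨0, by norm_num, by simp [h1]⟩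
  · refine le_csSup hbdd ⟨(s - a) / (δ * a), ?_, ?_⟩
    · rw [Set.mem_Icc, ← abs_le, abs_div, div_le_one (abs_pos.2 h0), abs_mul]
      exact hs.trans (mul_le_mul_of_nonneg_right (le_abs_self _) (abs_nonneg _))
    · simp only
      rw [div_mul_cancel₀ _ h0]
      ring_nf

theorem relOsc_nonneg (δ a : ℝ) : 0 ≤ relOsc f δ a :=
  Real.sSup_nonneg (by rintro _ ⟨θ, -, rfl⟩; exact abs_nonneg _)

theorem relOsc_zero (a : ℝ) : relOsc f 0 a = 0 := by
  have h : (Set.Icc (-1 : ℝ) 1).Nonempty := ⟨0, by norm_num⟩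
  simp [relOsc, h.image_const]

theorem relOsc_le (hp : 1 < p) (hC : ∀ s : ℝ, |f s| ≤ C * |s| ^ (p - 1)) {δ : ℝ} (hδ : 0 ≤ δ)
    (hδ' : δ ≤ 1) (a : ℝ) : relOsc f δ a ≤ (C * (2 ^ (p - 1) + 1)) * |a| ^ (p - 1) := by
  have hC0 := growth_const_nonneg hC
  refine Real.sSup_le ?_ (by positivity)
  rintro _ ⟨θ, hθ, rfl⟩
  have h1 : |a + θ * (δ * a)| ≤ 2 * |a| := by
    have h2 : |θ * (δ * a)| ≤ |a| := by
      rw [abs_mul, abs_mul, ← mul_assoc]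
      refine mul_le_of_le_one_left (abs_nonneg _) ?_
      rw [abs_of_nonneg hδ]
      exact mul_le_one₀ (abs_le.2 hθ) hδ hδ'
    linarith [abs_add_le a (θ * (δ * a))]
  calc |f (a + θ * (δ * a)) - f a| ≤ |f (a + θ * (δ * a))| + |f a| := abs_sub _ _
    _ ≤ C * (2 * |a|) ^ (p - 1) + C * |a| ^ (p - 1) := by
        refine add_le_add ((hC _).trans ?_) (hC a)
        gcongr
    _ = _ := by rw [Real.mul_rpow (by norm_num) (abs_nonneg _)]; ring

/-- First-order Taylor remainder of the primitive. The increments `|b| ≤ δ|a|` are controlled by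
the oscillation of `f`, the remaining ones by the growth of `f`, since `|a| ≤ |b|/δ` there. -/
theorem abs_primitive_remainder_le (hf : Continuous f) (hp : 1 < p)
    (hC : ∀ s : ℝ, |f s| ≤ C * |s| ^ (p - 1)) {δ : ℝ} (hδ : 0 < δ) (a b : ℝ) :
    |primitive f (a + b) - primitive f a - f a * b| ≤
      relOsc f δ a * |b| + 3 * C * (1 / δ + 1) ^ p * |b| ^ p := by
  have hC0 := growth_const_nonneg hC
  have hm : 0 ≤ relOsc f δ a := relOsc_nonneg _ _
  rcases le_or_gt |b| (δ * |a|) with h | h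
  · have h1 : primitive f (a + b) - primitive f a - f a * b =
        ∫ σ in a..(a + b), (f σ - f a) := by
      rw [intervalIntegral.integral_sub (hf.intervalIntegrable _ _) (by simp),
        primitive_sub hf, intervalIntegral.integral_const]
      simp [mul_comm]
    rw [h1]
    have h2 : ‖∫ σ in a..(a + b), (f σ - f a)‖ ≤ relOsc f δ a * |a + b - a| := by
      refine intervalIntegral.norm_integral_le_of_norm_le_const fun x hx => ?_
      refine le_relOsc hf (le_trans ?_ h)
      have := Set.abs_sub_left_of_mem_uIcc (Set.uIoc_subset_uIcc hx)
      simpa using this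
    rw [add_sub_cancel_left] at h2
    refine h2.trans (le_add_of_nonneg_right (by positivity))
  · have hab : |a| + |b| ≤ (1 / δ + 1) * |b| := by
      have : |a| ≤ |b| / δ := by rw [le_div_iff₀ hδ]; linarith
      rw [add_mul, one_mul, one_div_mul_eq_div]
      linarith
    have hpow : (|a| + |b|) ^ p ≤ (1 / δ + 1) ^ p * |b| ^ p := by
      rw [← Real.mul_rpow (by positivity) (abs_nonneg _)]
      gcongr
    have e1 : |primitive f (a + b)| ≤ C * (|a| + |b|) ^ p := by
      refine (abs_primitive_le hp hC _).trans ?_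
      gcongr
      exact abs_add_le a b
    have e2 : |primitive f a| ≤ C * (|a| + |b|) ^ p := by
      refine (abs_primitive_le hp hC _).trans ?_
      gcongr
      linarith [abs_nonneg b]
    have e3 : |f a * b| ≤ C * (|a| + |b|) ^ p := by
      rw [abs_mul]
      calc |f a| * |b| ≤ (C * (|a| + |b|) ^ (p - 1)) * (|a| + |b|) := by
            gcongr
            · refine (hC a).trans ?_
              gcongr
              linarith [abs_nonneg b]
            · linarith [abs_nonneg a]
        _ = _ := by
            rw [mul_assoc, ← Real.rpow_add_one' (by positivity) (by linarith), sub_add_cancel]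
    have e4 : |primitive f (a + b) - primitive f a - f a * b| ≤ 3 * C * (|a| + |b|) ^ p := by
      have h1 := abs_sub (primitive f (a + b) - primitive f a) (f a * b)
      have h2 := abs_sub (primitive f (a + b)) (primitive f a)
      linarith
    calc _ ≤ 3 * C * ((1 / δ + 1) ^ p * |b| ^ p) := e4.trans (by gcongr)
      _ ≤ _ := by rw [← mul_assoc]; exact le_add_of_nonneg_left (by positivity)

end Pointwise

/-! ### The superposition operator on Lebesgue spaces -/

section Superposition

variable {α : Type*} [MeasurableSpace α] {μ : Measure α} {f : ℝ → ℝ} {C p : ℝ}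

theorem memLp_comp_of_growth (hf : Continuous f) (hC : ∀ s : ℝ, |f s| ≤ C * |s| ^ (p - 1))
    {q : ℝ≥0∞} {u : α → ℝ} (hu : AEStronglyMeasurable u μ)
    (huq : MemLp (fun x => |u x| ^ (p - 1)) q μ) : MemLp (fun x => f (u x)) q μ := by
  refine huq.of_le_mul (c := C) (hf.comp_aestronglyMeasurable hu) (ae_of_all _ fun x => ?_)
  rw [Real.norm_eq_abs, Real.norm_eq_abs, abs_of_nonneg (Real.rpow_nonneg (abs_nonneg _) _)]
  exact hC _

theorem integrable_primitive_comp (hf : Continuous f) (hp : 1 < p)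
    (hC : ∀ s : ℝ, |f s| ≤ C * |s| ^ (p - 1)) {u : α → ℝ} (hu : MemLp u (ENNReal.ofReal p) μ) :
    Integrable (fun x => primitive f (u x)) μ := by
  have h := hu.integrable_norm_rpow (by simp; linarith) (by simp)
  rw [ENNReal.toReal_ofReal (by linarith)] at h
  refine (h.const_mul C).mono' ((continuous_primitive hf).comp_aestronglyMeasurable hu.1)
    (ae_of_all _ fun x => ?_)
  exact abs_primitive_le hp hC _

theorem tendsto_eLpNorm_relOsc (hf : Continuous f) (hp : 1 < p)
    (hC : ∀ s : ℝ, |f s| ≤ C * |s| ^ (p - 1)) {q : ℝ≥0∞} (hq0 : q ≠ 0) (hq : q ≠ ⊤) {u : α → ℝ}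
    (hu : AEStronglyMeasurable u μ) (huq : MemLp (fun x => |u x| ^ (p - 1)) q μ) :
    Tendsto (fun δ => eLpNorm (fun x => relOsc f δ (u x)) q μ) (𝓝[>] 0) (𝓝 0) := by
  have hcont (δ : ℝ) : Continuous (relOsc f δ) :=
    (continuous_relOsc hf).comp (by fun_prop : Continuous fun a : ℝ => (δ, a))
  refine tendsto_eLpNorm_zero_of_dominated hq0 hq
    (Eventually.of_forall fun δ => (hcont δ).comp_aestronglyMeasurable hu)
    (huq.const_mul (C * (2 ^ (p - 1) + 1))) ?_ (ae_of_all _ fun x => ?_)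
  · filter_upwards [Ioc_mem_nhdsGT (zero_lt_one (α := ℝ))] with δ hδ
    refine ae_of_all _ fun x => ?_
    rw [Real.norm_of_nonneg (relOsc_nonneg _ _)]
    exact relOsc_le hp hC hδ.1.le hδ.2 _
  · have h : Continuous fun δ => relOsc f δ (u x) :=
      (continuous_relOsc hf).comp (by fun_prop : Continuous fun δ : ℝ => (δ, u x))
    have := h.tendsto 0
    rw [relOsc_zero] at this
    exact this.mono_left nhdsWithin_le_nhds

theorem memLp_relOsc (hf : Continuous f) (hp : 1 < p)
    (hC : ∀ s : ℝ, |f s| ≤ C * |s| ^ (p - 1)) {q : ℝ≥0∞} {u : α → ℝ}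
    (hu : AEStronglyMeasurable u μ) (huq : MemLp (fun x => |u x| ^ (p - 1)) q μ)
    {δ : ℝ} (hδ : 0 < δ) (hδ' : δ ≤ 1) : MemLp (fun x => relOsc f δ (u x)) q μ := by
  have hcont : Continuous (relOsc f δ) :=
    (continuous_relOsc hf).comp (by fun_prop : Continuous fun a : ℝ => (δ, a))
  refine (huq.const_mul (C * (2 ^ (p - 1) + 1))).mono' (hcont.comp_aestronglyMeasurable hu)
    (ae_of_all _ fun x => ?_)
  rw [Real.norm_of_nonneg (relOsc_nonneg _ _)]
  exact relOsc_le hp hC hδ.le hδ' _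

end Superposition

/-! ### Integral inequalities -/

section

variable {α : Type*} [MeasurableSpace α] {μ : Measure α}

theorem MemLp.integrable_mul_of_holder {q r : ℝ≥0∞} [ENNReal.HolderConjugate q r] {a b : α → ℝ}
    (ha : MemLp a q μ) (hb : MemLp b r μ) : Integrable (fun x => a x * b x) μ :=
  memLp_one_iff_integrable.1 (hb.mul ha)

theorem integral_abs_mul_le_of_holder {q r : ℝ≥0∞} [ENNReal.HolderConjugate q r] {a b : α → ℝ}
    (ha : MemLp a q μ) (hb : MemLp b r μ) :
    ∫ x, |a x| * |b x| ∂μ ≤ (eLpNorm a q μ).toReal * (eLpNorm b r μ).toReal := by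
  have h : eLpNorm (a • b) 1 μ ≤ eLpNorm a q μ * eLpNorm b r μ :=
    eLpNorm_smul_le_mul_eLpNorm hb.1 ha.1
  have h2 : (eLpNorm (a • b) 1 μ).toReal = ∫ x, |a x| * |b x| ∂μ := by
    have := integral_norm_eq_lintegral_enorm (μ := μ) (f := a • b) (ha.1.smul hb.1)
    rw [eLpNorm_one_eq_lintegral_enorm, ← this]
    simp
  rw [← h2, ← ENNReal.toReal_mul]
  exact ENNReal.toReal_mono (ENNReal.mul_ne_top ha.2.ne hb.2.ne) h

theorem integral_abs_rpow_eq {p : ℝ} (hp : 0 < p) {u : α → ℝ}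
    (hu : MemLp u (ENNReal.ofReal p) μ) :
    ∫ x, |u x| ^ p ∂μ = (eLpNorm u (ENNReal.ofReal p) μ).toReal ^ p := by
  rw [hu.eLpNorm_eq_integral_rpow_norm (by simpa using hp) (by simp),
    ENNReal.toReal_ofReal hp.le, ENNReal.toReal_ofReal (by positivity),
    ← Real.rpow_mul (by positivity), inv_mul_cancel₀ hp.ne', Real.rpow_one]
  rfl

end

/-! ### The critical exponent and the space `𝒟^{1,2}` -/

theorem memLp_gradient_test {N : ℕ} {φ : RN N → ℝ} (hφ : IsTest φ) {q : ℝ≥0∞} :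
    MemLp (gradient φ) q volume := by
  refine Continuous.memLp_of_hasCompactSupport ?_ ?_
  · exact (InnerProductSpace.toDual ℝ (RN N)).symm.continuous.comp
      (hφ.1.continuous_fderiv (by simp))
  · exact (hφ.2.fderiv ℝ).comp_left (map_zero _)

theorem critExpE_ne_top (N : ℕ) : critExpE N ≠ ⊤ := ENNReal.ofReal_ne_top

section

variable {N : ℕ} [hN : Fact (2 < N)]

variable (N) in
theorem two_lt_dim : (2 : ℝ) < N := by exact_mod_cast hN.out

variable (N) in
theorem two_lt_critExp : 2 < critExp N := by
  have h := two_lt_dim N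
  rw [critExp, lt_div_iff₀ (by linarith)]
  linarith

variable (N) in
theorem critExp_pos : 0 < critExp N := two_pos.trans (two_lt_critExp N)

variable (N) in
theorem critExpE_ne_zero : critExpE N ≠ 0 := by
  rw [critExpE, Ne, ENNReal.ofReal_eq_zero, not_le]
  exact critExp_pos N

variable (N) in
theorem toReal_critExpE : (critExpE N).toReal = critExp N :=
  ENNReal.toReal_ofReal (critExp_pos N).le

namespace D12

theorem norm_eq (u : D12 N) : ‖u‖ = ‖grad u‖ := rfl

theorem memLp (u : D12 N) : MemLp u (critExpE N) volume := Lp.memLp u.toLCrit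

theorem memLp_grad (u : D12 N) : MemLp (grad u) 2 volume := Lp.memLp (grad u)

theorem toLCrit_add (u v : D12 N) : (u + v).toLCrit = u.toLCrit + v.toLCrit := by
  simp [toLCrit]

theorem toLCrit_sub (u v : D12 N) : (u - v).toLCrit = u.toLCrit - v.toLCrit := by
  simp [toLCrit]

theorem toLCrit_smul (a : ℝ) (u : D12 N) : (a • u).toLCrit = a • u.toLCrit := by
  simp [toLCrit]

theorem coeFn_add (u v : D12 N) : (u + v : D12 N) =ᵐ[volume] fun x => u x + v x := by
  rw [toLCrit_add]
  exact Lp.coeFn_add _ _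

theorem coeFn_sub (u v : D12 N) : (u - v : D12 N) =ᵐ[volume] fun x => u x - v x := by
  rw [toLCrit_sub]
  exact Lp.coeFn_sub _ _

theorem coeFn_zero : (0 : D12 N) =ᵐ[volume] 0 := by
  have : (0 : D12 N).toLCrit = 0 := by simp [toLCrit]
  rw [this]
  exact Lp.coeFn_zero _ _ _

theorem grad_sub_ae (u v : D12 N) : grad (u - v) =ᵐ[volume] fun x => grad u x - grad v x := by
  rw [map_sub]
  exact Lp.coeFn_sub _ _

/-- The embedding `𝒟^{1,2} → L^{2*}`. -/
noncomputable def toLCritL : D12 N →L[ℝ] LCrit N :=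
  LinearMap.mkContinuousOfExistsBound
    { toFun := toLCrit, map_add' := toLCrit_add, map_smul' := toLCrit_smul } (sobolev N)

@[simp]
theorem toLCritL_apply (u : D12 N) : toLCritL u = u.toLCrit := rfl

/-- The gradient as an isometric embedding of `𝒟^{1,2}` into `L²`. -/
noncomputable def gradL : D12 N →ₗᵢ[ℝ] LTwoVec N where
  toLinearMap := grad
  norm_map' _ := rfl

@[simp]
theorem gradL_apply (u : D12 N) : gradL u = grad u := rfl

theorem sq_norm_eq_integral (u : D12 N) : ‖u‖ ^ 2 = ∫ x, ‖grad u x‖ ^ 2 := by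
  rw [norm_eq, ← real_inner_self_eq_norm_sq, L2.inner_def]
  simp

theorem exists_sobolev_nonneg (N : ℕ) [Fact (2 < N)] :
    ∃ K : ℝ, 0 ≤ K ∧ ∀ u : D12 N, ‖u.toLCrit‖ ≤ K * ‖u‖ := by
  obtain ⟨K, hK⟩ := sobolev N
  refine ⟨max K 0, le_max_right _ _, fun u => (hK u).trans ?_⟩
  rw [norm_eq]
  gcongr
  exact le_max_left _ _

/-- A pair `(u, V)` which is the limit of pairs `(φₙ, ∇φₙ)` of test functions comes from
`𝒟^{1,2}`. -/
theorem exists_of_tendsto {u : RN N → ℝ} {V : RN N → RN N} (hu : MemLp u (critExpE N) volume)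
    (hV : MemLp V 2 volume) {φ : ℕ → RN N → ℝ} (hφ : ∀ n, IsTest (φ n))
    (h1 : Tendsto (fun n => eLpNorm (fun x => φ n x - u x) (critExpE N) volume) atTop (𝓝 0))
    (h2 : Tendsto (fun n => eLpNorm (fun x => gradient (φ n) x - V x) 2 volume) atTop (𝓝 0)) :
    ∃ w : D12 N, w =ᵐ[volume] u ∧ grad w =ᵐ[volume] V := by
  have hm1 (n : ℕ) : MemLp (φ n) (critExpE N) volume :=
    (hφ n).1.continuous.memLp_of_hasCompactSupport (hφ n).2
  have hm2 (n : ℕ) : MemLp (gradient (φ n)) 2 volume := memLp_gradient_test (hφ n)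
  have hcl : (hu.toLp u, hV.toLp V) ∈ (testPairs N).topologicalClosure := by
    refine mem_closure_of_tendsto (f := fun n => ((hm1 n).toLp _, (hm2 n).toLp _)) (b := atTop)
      ?_ (Eventually.of_forall fun n => ⟨φ n, hφ n, (hm1 n).coeFn_toLp, (hm2 n).coeFn_toLp⟩)
    refine Tendsto.prodMk_nhds ?_ ?_
    · exact (Lp.tendsto_Lp_iff_tendsto_eLpNorm'' _ hm1 u hu).2 h1
    · exact (Lp.tendsto_Lp_iff_tendsto_eLpNorm'' _ hm2 V hV).2 h2
  exact ⟨ofPair _ hcl, hu.coeFn_toLp, hV.coeFn_toLp⟩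

theorem exists_of_test {φ : RN N → ℝ} (hφ : IsTest φ) :
    ∃ w : D12 N, w =ᵐ[volume] φ ∧ grad w =ᵐ[volume] gradient φ :=
  exists_of_tendsto (hφ.1.continuous.memLp_of_hasCompactSupport hφ.2) (memLp_gradient_test hφ)
    (fun _ => hφ) (by simp) (by simp)

/-- Test functions are dense in `𝒟^{1,2}`. -/
theorem exists_test_seq (u : D12 N) : ∃ (φ : ℕ → RN N → ℝ) (w : ℕ → D12 N),
    (∀ n, IsTest (φ n)) ∧ (∀ n, w n =ᵐ[volume] φ n) ∧ (∀ n, grad (w n) =ᵐ[volume] gradient (φ n)) ∧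
    Tendsto w atTop (𝓝 u) := by
  obtain ⟨q, hq, hlim⟩ := mem_closure_iff_seq_limit.1 u.toPair_mem
  choose φ hφ h1 h2 using hq
  choose w hw1 hw2 using fun n => exists_of_test (hφ n)
  refine ⟨φ, w, hφ, hw1, hw2, ?_⟩
  rw [gradL.isometry.isEmbedding.tendsto_nhds_iff]
  have h3 (n : ℕ) : gradL (w n) = (q n).2 := Lp.ext ((hw2 n).trans (h2 n).symm)
  simp only [Function.comp_def, h3]
  exact (continuous_snd.tendsto _).comp hlim

end D12

/-! ### Differentiability of the functionals -/

variable {f : ℝ → ℝ} {C : ℝ}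

variable (N) in
theorem holderConjugate_critExpE :
    ENNReal.HolderConjugate (ENNReal.ofReal (critExp N).conjExponent) (critExpE N) :=
  (Real.HolderConjugate.conjExponent (by linarith [two_lt_critExp N])).symm.ennrealOfReal

theorem D12.memLp_rpow (u : D12 N) : MemLp (fun x => |u x| ^ (critExp N - 1))
    (ENNReal.ofReal (critExp N).conjExponent) volume := by
  have hp := two_lt_critExp N
  have h := u.memLp.norm_rpow_div (q := ENNReal.ofReal (critExp N - 1))
  have h2 : critExpE N / ENNReal.ofReal (critExp N - 1) =
      ENNReal.ofReal (critExp N).conjExponent := by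
    rw [critExpE, ← ENNReal.ofReal_div_of_pos (by linarith)]
    rfl
  rw [ENNReal.toReal_ofReal (by linarith), h2] at h
  exact h

theorem hasFDerivAt_psi (hf : Continuous f) (hC : ∀ s : ℝ, |f s| ≤ C * |s| ^ (critExp N - 1))
    (u : D12 N) : ∃ L : D12 N →L[ℝ] ℝ, (∀ h : D12 N, L h = ∫ x, f (u x) * h x) ∧
      HasFDerivAt (psi f) L u := by
  have hp := two_lt_critExp N
  have hp1 : 1 < critExp N := by linarith
  have hC0 := growth_const_nonneg hC
  set q : ℝ≥0∞ := ENNReal.ofReal (critExp N).conjExponent with hq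
  have : ENNReal.HolderConjugate q (critExpE N) := holderConjugate_critExpE N
  have : Fact (1 ≤ q) := ⟨ENNReal.HolderConjugate.one_le q (critExpE N)⟩
  have hq0 : q ≠ 0 := (zero_lt_one.trans_le Fact.out).ne'
  have hqt : q ≠ ⊤ := ENNReal.ofReal_ne_top
  have hfu : MemLp (fun x => f (u x)) q volume :=
    memLp_comp_of_growth hf hC u.memLp.1 u.memLp_rpow
  let L : D12 N →L[ℝ] ℝ :=
    (((ContinuousLinearMap.mul ℝ ℝ).lpPairing volume q (critExpE N)) (hfu.toLp _)).comp D12.toLCritL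
  have hL (h : D12 N) : L h = ∫ x, f (u x) * h x := by
    change (ContinuousLinearMap.mul ℝ ℝ).lpPairing volume q (critExpE N) (hfu.toLp _) h.toLCrit = _
    rw [ContinuousLinearMap.lpPairing_eq_integral]
    refine integral_congr_ae ?_
    filter_upwards [hfu.coeFn_toLp] with x hx
    simp [hx]
  refine ⟨L, hL, ?_⟩
  obtain ⟨K, hK0, hK⟩ := D12.exists_sobolev_nonneg N
  rw [hasFDerivAt_iff_isLittleO_nhds_zero, Asymptotics.isLittleO_iff]
  intro c hc
  have hosc : Tendsto (fun δ => (eLpNorm (fun x => relOsc f δ (u x)) q volume).toReal * K)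
      (𝓝[>] 0) (𝓝 0) := by
    have h := tendsto_eLpNorm_relOsc hf hp1 hC hq0 hqt u.memLp.1 u.memLp_rpow
    simpa using ((ENNReal.tendsto_toReal ENNReal.zero_ne_top).comp h).mul_const K
  obtain ⟨δ, hδ1, hδ2⟩ := ((hosc.eventually (gt_mem_nhds (half_pos hc))).and
    (Ioc_mem_nhdsGT (zero_lt_one (α := ℝ)))).exists
  have hm := memLp_relOsc hf hp1 hC u.memLp.1 u.memLp_rpow hδ2.1 hδ2.2
  set A : ℝ := 3 * C * (1 / δ + 1) ^ critExp N with hA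
  have hA0 : 0 ≤ A := by have := hδ2.1; positivity
  have hsmall : Tendsto (fun h : D12 N => A * K ^ critExp N * ‖h‖ ^ (critExp N - 1)) (𝓝 0)
      (𝓝 0) := by
    have h1 : Continuous fun h : D12 N => A * K ^ critExp N * ‖h‖ ^ (critExp N - 1) :=
      continuous_const.mul (continuous_norm.rpow_const fun _ => Or.inr (by linarith))
    have := h1.tendsto 0
    rwa [norm_zero, Real.zero_rpow (by linarith), mul_zero] at this
  filter_upwards [hsmall.eventually (gt_mem_nhds (half_pos hc))] with h hh
  have hrem : psi f (u + h) - psi f u - L h =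
      ∫ x, (primitive f (u x + h x) - primitive f (u x) - f (u x) * h x) := by
    have hi1 : Integrable (fun x => primitive f (u x + h x)) volume :=
      integrable_primitive_comp hf hp1 hC (u.memLp.add h.memLp)
    have hi2 := integrable_primitive_comp hf hp1 hC u.memLp
    have e1 := integral_sub (hi1.sub hi2) (MemLp.integrable_mul_of_holder hfu h.memLp)
    simp only [Pi.sub_apply] at e1
    rw [e1, integral_sub hi1 hi2, hL, psi, psi]
    congr 2
    refine integral_congr_ae ?_
    filter_upwards [D12.coeFn_add u h] with x hx
    rw [hx]
  have hhp : Integrable (fun x => |h x| ^ critExp N) volume := by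
    have := h.memLp.integrable_norm_rpow (critExpE_ne_zero N) (critExpE_ne_top N)
    rwa [toReal_critExpE] at this
  have hmi : Integrable (fun x => |relOsc f δ (u x)| * |h x|) volume := by
    have := (MemLp.integrable_mul_of_holder hm h.memLp).abs
    simpa [abs_mul] using this
  rw [hrem]
  calc ‖∫ x, (primitive f (u x + h x) - primitive f (u x) - f (u x) * h x)‖
      ≤ ∫ x, (|relOsc f δ (u x)| * |h x| + A * |h x| ^ critExp N) := by
        refine norm_integral_le_of_norm_le (hmi.add (hhp.const_mul A)) (ae_of_all _ fun x => ?_)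
        rw [abs_of_nonneg (relOsc_nonneg _ _)]
        exact abs_primitive_remainder_le hf hp1 hC hδ2.1 _ _
    _ = (∫ x, |relOsc f δ (u x)| * |h x|) + A * ∫ x, |h x| ^ critExp N := by
        rw [integral_add hmi (hhp.const_mul A), integral_const_mul]
    _ ≤ (eLpNorm (fun x => relOsc f δ (u x)) q volume).toReal * (K * ‖h‖) +
          A * (K * ‖h‖) ^ critExp N := by
        have h1 := integral_abs_mul_le_of_holder hm h.memLp
        have h2 : ∫ x, |h x| ^ critExp N = ‖h.toLCrit‖ ^ critExp N := by
          rw [Lp.norm_def]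
          exact integral_abs_rpow_eq (critExp_pos N) h.memLp
        rw [h2]
        have h3 := critExp_pos N
        rw [← Lp.norm_def] at h1
        refine add_le_add (h1.trans ?_) ?_
        · gcongr
          exact hK h
        · gcongr
          exact hK h
    _ ≤ c / 2 * ‖h‖ + c / 2 * ‖h‖ := by
        refine add_le_add ?_ ?_
        · rw [← mul_assoc]
          gcongr
        · have h1 : A * (K * ‖h‖) ^ critExp N =
              (A * K ^ critExp N * ‖h‖ ^ (critExp N - 1)) * ‖h‖ := by
            rw [Real.mul_rpow hK0 (norm_nonneg _), mul_assoc (A * K ^ critExp N),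
              ← Real.rpow_add_one' (norm_nonneg _) (by linarith), sub_add_cancel, mul_assoc A]
          rw [h1]
          gcongr
    _ = c * ‖h‖ := by ring

theorem continuous_psi (hf : Continuous f) (hC : ∀ s : ℝ, |f s| ≤ C * |s| ^ (critExp N - 1)) :
    Continuous (psi (N := N) f) := continuous_iff_continuousAt.2 fun u => by
  obtain ⟨L, -, h⟩ := hasFDerivAt_psi hf hC u
  exact h.continuousAt

theorem D12.hasFDerivAt_sq_norm (u : D12 N) : ∃ L : D12 N →L[ℝ] ℝ,
    (∀ h : D12 N, L h = 2 * inner ℝ (grad u) (grad h)) ∧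
      HasFDerivAt (fun v : D12 N => ‖v‖ ^ 2) L u := by
  refine ⟨_, fun h => ?_, ((hasStrictFDerivAt_norm_sq (gradL u)).hasFDerivAt.comp u
    gradL.toContinuousLinearMap.hasFDerivAt)⟩
  simp

/-- Critical points of the energy are the weak solutions of `-Δu = f(u)`. -/
theorem isCriticalPoint_iff (hf : Continuous f)
    (hC : ∀ s : ℝ, |f s| ≤ C * |s| ^ (critExp N - 1)) (u : D12 N) :
    IsCriticalPoint (energy f) u ↔
      ∀ h : D12 N, inner ℝ (D12.grad u) (D12.grad h) = ∫ x, f (u x) * h x := by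
  obtain ⟨L, hL, hLd⟩ := hasFDerivAt_psi hf hC u
  obtain ⟨M, hM, hMd⟩ := D12.hasFDerivAt_sq_norm u
  have hE : HasFDerivAt (energy f) ((1 / 2 : ℝ) • M - L) u := by
    refine ((hMd.const_smul (1 / 2 : ℝ)).sub hLd).congr_of_eventuallyEq
      (Eventually.of_forall fun v => ?_)
    simp [energy, div_eq_inv_mul]
  have hval (h : D12 N) : ((1 / 2 : ℝ) • M - L) h =
      inner ℝ (D12.grad u) (D12.grad h) - ∫ x, f (u x) * h x := by
    simp [hM, hL]
  constructor
  · intro hcr h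
    have := hval h
    rw [hE.unique hcr] at this
    simp at this
    linarith
  · intro hw
    have : (1 / 2 : ℝ) • M - L = 0 := by
      ext h
      rw [hval h, hw h, sub_self]
      rfl
    rw [this] at hE
    exact hE

end

/-! ### Dilations on Lebesgue spaces -/

section

variable {N : ℕ}

theorem integral_dil {t : ℝ} (ht : 0 < t) (g : RN N → ℝ) :
    ∫ x, g (t⁻¹ • x) = t ^ N * ∫ x, g x := by
  rw [Measure.integral_comp_inv_smul_of_nonneg volume g ht.le]
  simp

variable {V : Type*} [NormedAddCommGroup V]

theorem eLpNorm_dil {t : ℝ} (ht : 0 < t) {p : ℝ≥0∞} {g : RN N → V}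
    (hg : AEStronglyMeasurable g volume) :
    eLpNorm (fun x => g (t⁻¹ • x)) p volume =
      ENNReal.ofReal (t ^ N) ^ (1 / p).toReal * eLpNorm g p volume := by
  have h0 : ENNReal.ofReal (t ^ N) ≠ 0 := by
    rw [Ne, ENNReal.ofReal_eq_zero, not_le]
    positivity
  have h1 := eLpNorm_map_measure (p := p) (μ := (volume : Measure (RN N))) (g := g)
    (f := fun x : RN N => t⁻¹ • x)
    (by rw [map_dil ht]; exact hg.smul_measure _) (by fun_prop)
  rw [map_dil ht, eLpNorm_smul_measure_of_ne_zero h0, smul_eq_mul] at h1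
  exact h1.symm

theorem tendsto_eLpNorm_dil_sub_of_hasCompactSupport {p : ℝ≥0∞} (hp0 : p ≠ 0) (hp : p ≠ ⊤)
    {G : RN N → V} (hG : Continuous G) (hGs : HasCompactSupport G) :
    Tendsto (fun t : ℝ => eLpNorm (fun x => G (t⁻¹ • x) - G x) p volume) (𝓝 1) (𝓝 0) := by
  obtain ⟨M, hM⟩ := hG.bounded_above_of_compact_support hGs
  obtain ⟨R, hR⟩ := hGs.isCompact.isBounded.subset_closedBall (0 : RN N)
  have hbd : MemLp ((Metric.closedBall (0 : RN N) (2 * R)).indicator fun _ => 2 * M) p volume :=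
    memLp_indicator_const _ measurableSet_closedBall _
      (Or.inr measure_closedBall_lt_top.ne)
  have hnhds : Set.Ioo (1 / 2 : ℝ) 2 ∈ 𝓝 (1 : ℝ) := Ioo_mem_nhds (by norm_num) (by norm_num)
  refine tendsto_eLpNorm_zero_of_dominated hp0 hp
    (Eventually.of_forall fun t => by fun_prop) hbd ?_ (ae_of_all _ fun x => ?_)
  · filter_upwards [hnhds] with t ht
    have ht0 : 0 < t := by linarith [ht.1]
    refine ae_of_all _ fun x => ?_
    by_cases hx : x ∈ Metric.closedBall (0 : RN N) (2 * R)
    · rw [Set.indicator_of_mem hx]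
      linarith [norm_sub_le (G (t⁻¹ • x)) (G x), hM (t⁻¹ • x), hM x]
    · have h0 {y : RN N} (hy : R < ‖y‖) : G y = 0 := by
        refine image_eq_zero_of_notMem_tsupport fun hmem => ?_
        have := hR hmem
        rw [mem_closedBall_zero_iff] at this
        linarith
      rw [mem_closedBall_zero_iff, not_le] at hx
      have h1 : R < ‖x‖ := by
        rcases le_or_gt 0 R with h | h
        · linarith
        · linarith [norm_nonneg x]
      have h2 : R < ‖t⁻¹ • x‖ := by
        rw [norm_smul, norm_inv, Real.norm_of_nonneg ht0.le, inv_mul_eq_div, lt_div_iff₀ ht0]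
        rcases le_or_gt 0 R with h | h
        · nlinarith [ht.2]
        · nlinarith [norm_nonneg x]
      rw [h0 h1, h0 h2, sub_zero, norm_zero]
      exact Set.indicator_nonneg (fun _ _ => by linarith [(norm_nonneg _).trans (hM 0)]) _
  · have h1 : ContinuousAt (fun t : ℝ => G (t⁻¹ • x) - G x) 1 := by
      have : ContinuousAt (fun t : ℝ => t⁻¹ • x) 1 :=
        (continuousAt_inv₀ one_ne_zero).smul continuousAt_const
      exact (ContinuousAt.comp (g := G) hG.continuousAt this).sub continuousAt_const
    simpa [ContinuousAt] using h1

variable [NormedSpace ℝ V]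

/-- Dilations act continuously on `L^p`, `p < ∞`. -/
theorem tendsto_eLpNorm_dil_sub {p : ℝ≥0∞} (hp1 : 1 ≤ p) (hp : p ≠ ⊤)
    {g : RN N → V} (hg : MemLp g p volume) :
    Tendsto (fun t : ℝ => eLpNorm (fun x => g (t⁻¹ • x) - g x) p volume) (𝓝 1) (𝓝 0) := by
  have hp0 : p ≠ 0 := (zero_lt_one.trans_le hp1).ne'
  rw [ENNReal.tendsto_nhds_zero]
  intro ε hε
  rcases eq_or_ne ε ⊤ with rfl | hεt
  · simp
  set c : ℝ≥0∞ := ENNReal.ofReal (2 ^ N) ^ (1 / p).toReal with hc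
  have hct : c ≠ ⊤ := ENNReal.rpow_ne_top_of_nonneg ENNReal.toReal_nonneg ENNReal.ofReal_ne_top
  have hden : c + 1 + 1 ≠ ⊤ := by simp [hct]
  set ε' : ℝ≥0∞ := ε / (c + 1 + 1) with hε'
  have hε'0 : ε' ≠ 0 := (ENNReal.div_pos hε.ne' hden).ne'
  obtain ⟨G, hGs, hGg, hGc, hGp⟩ := hg.exists_hasCompactSupport_eLpNorm_sub_le hp hε'0
  have h1 := (ENNReal.tendsto_nhds_zero.1
    (tendsto_eLpNorm_dil_sub_of_hasCompactSupport hp0 hp hGc hGs)) ε' (pos_iff_ne_zero.2 hε'0)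
  have hnhds : Set.Ioo (0 : ℝ) 2 ∈ 𝓝 (1 : ℝ) := Ioo_mem_nhds (by norm_num) (by norm_num)
  filter_upwards [h1, hnhds] with t ht1 ht
  have hd : AEStronglyMeasurable (fun x => (g - G) (t⁻¹ • x)) volume :=
    (memLp_dil ht.1 (hg.sub hGp)).1
  have hd2 : AEStronglyMeasurable (fun x => G (t⁻¹ • x) - G x) volume := by fun_prop
  have heq : (fun x => g (t⁻¹ • x) - g x) =
      ((fun x => (g - G) (t⁻¹ • x)) + fun x => G (t⁻¹ • x) - G x) - (g - G) := by
    funext x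
    simp
  calc eLpNorm (fun x => g (t⁻¹ • x) - g x) p volume
      ≤ eLpNorm (fun x => (g - G) (t⁻¹ • x)) p volume +
          eLpNorm (fun x => G (t⁻¹ • x) - G x) p volume + eLpNorm (g - G) p volume := by
        rw [heq]
        refine (eLpNorm_sub_le (hd.add hd2) (hg.sub hGp).1 hp1).trans ?_
        gcongr
        exact eLpNorm_add_le hd hd2 hp1
    _ ≤ c * ε' + ε' + ε' := by
        rw [eLpNorm_dil ht.1 (hg.sub hGp).1]
        gcongr
        rw [hc]
        gcongr
        · exact ht.1.le
        · exact ht.2.le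
    _ = (c + 1 + 1) * ε' := by ring
    _ = ε := ENNReal.mul_div_cancel (by simp) hden

open Classical in
/-- The dilation `g ↦ g(·/t)` on `L^p`, extended by `0` to `t ≤ 0`. For `p < ∞` this is the limit
of the dilates as `t ↓ 0`. -/
noncomputable def dilLpExt (t : ℝ) (p : ℝ≥0∞) [Fact (1 ≤ p)]
    (g : Lp V p (volume : Measure (RN N))) : Lp V p (volume : Measure (RN N)) :=
  if ht : 0 < t then dilLp t ht p g else 0

theorem dilLpExt_of_pos {t : ℝ} (ht : 0 < t) (p : ℝ≥0∞) [Fact (1 ≤ p)]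
    (g : Lp V p (volume : Measure (RN N))) : dilLpExt t p g = dilLp t ht p g := dif_pos ht

theorem dilLpExt_zero (p : ℝ≥0∞) [Fact (1 ≤ p)]
    (g : Lp V p (volume : Measure (RN N))) : dilLpExt 0 p g = 0 := dif_neg (lt_irrefl _)

theorem norm_dilLp {t : ℝ} (ht : 0 < t) (p : ℝ≥0∞) [Fact (1 ≤ p)]
    (g : Lp V p (volume : Measure (RN N))) :
    ‖dilLp t ht p g‖ = (t ^ N) ^ (1 / p).toReal * ‖g‖ := by
  rw [Lp.norm_def, eLpNorm_congr_ae (dilLp_ae t ht p g), eLpNorm_dil ht (Lp.memLp g).1,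
    ENNReal.toReal_mul, ← ENNReal.toReal_rpow, ENNReal.toReal_ofReal (by positivity), Lp.norm_def]

theorem continuousAt_dilLpExt {t₀ : ℝ} (ht₀ : 0 < t₀) {p : ℝ≥0∞} [Fact (1 ≤ p)] (hp : p ≠ ⊤)
    (g : Lp V p (volume : Measure (RN N))) : ContinuousAt (fun t => dilLpExt t p g) t₀ := by
  have h1 := tendsto_eLpNorm_dil_sub Fact.out hp (memLp_dil ht₀ (Lp.memLp g))
  have h2 : Tendsto (fun t : ℝ => t / t₀) (𝓝 t₀) (𝓝 1) := by
    have : Tendsto (fun t : ℝ => t / t₀) (𝓝 t₀) (𝓝 (t₀ / t₀)) := tendsto_id.div_const t₀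
    rwa [div_self ht₀.ne'] at this
  have h3 := h1.comp h2
  rw [ContinuousAt, Lp.tendsto_Lp_iff_tendsto_eLpNorm']
  refine h3.congr' ?_
  filter_upwards [lt_mem_nhds ht₀] with t ht
  refine eLpNorm_congr_ae ?_
  rw [dilLpExt_of_pos ht, dilLpExt_of_pos ht₀]
  filter_upwards [dilLp_ae t ht p g, dilLp_ae t₀ ht₀ p g] with x hx1 hx2
  simp only [Pi.sub_apply, hx1, hx2, smul_smul]
  congr 3
  field_simp

theorem continuous_dilLpExt (hN : N ≠ 0) {p : ℝ≥0∞} [Fact (1 ≤ p)] (hp : p ≠ ⊤)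
    (g : Lp V p (volume : Measure (RN N))) : Continuous fun t : ℝ≥0 => dilLpExt (t : ℝ) p g := by
  have hp0 : p ≠ 0 := (zero_lt_one.trans_le Fact.out).ne'
  have hq : 0 < (1 / p).toReal := by
    rw [one_div, ENNReal.toReal_inv]
    exact inv_pos.2 (ENNReal.toReal_pos hp0 hp)
  rw [continuous_iff_continuousAt]
  intro t₀
  rcases eq_or_ne t₀ 0 with rfl | h0
  · rw [ContinuousAt, NNReal.coe_zero, dilLpExt_zero]
    refine squeeze_zero_norm (a := fun t : ℝ≥0 => ((t : ℝ) ^ N) ^ (1 / p).toReal * ‖g‖)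
      (fun t => ?_) ?_
    · rcases eq_or_ne t 0 with rfl | ht
      · rw [NNReal.coe_zero, dilLpExt_zero, norm_zero]
        positivity
      · have ht' : 0 < (t : ℝ) := by positivity
        rw [dilLpExt_of_pos ht', norm_dilLp]
    · have : Continuous fun t : ℝ≥0 => ((t : ℝ) ^ N) ^ (1 / p).toReal * ‖g‖ :=
        ((NNReal.continuous_coe.pow N).rpow_const fun _ => Or.inr hq.le).mul continuous_const
      have h := this.tendsto 0
      rwa [NNReal.coe_zero, zero_pow hN, Real.zero_rpow hq.ne', zero_mul] at h
  · exact ContinuousAt.comp (g := fun t : ℝ => dilLpExt t p g)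
      (continuousAt_dilLpExt (by positivity) hp g) NNReal.continuous_coe.continuousAt

end

/-! ### Dilations on `𝒟^{1,2}` -/

section

variable {N : ℕ} [hN : Fact (2 < N)] {f : ℝ → ℝ}

namespace D12

theorem dilate_of_nonpos {t : ℝ} (ht : t ≤ 0) (u : D12 N) : dilate t u = 0 := dif_neg ht.not_gt

theorem grad_dilate {t : ℝ} (ht : 0 < t) (u : D12 N) :
    grad (dilate t u) = t⁻¹ • dilLp t ht 2 (grad u) := by
  have h : dilate t u = ofPair (dilPair t ht u.toPair) (dilPair_mem t ht u.toPair u.toPair_mem) :=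
    dif_pos ht
  rw [h]
  rfl

theorem grad_dilate_ae {t : ℝ} (ht : 0 < t) (u : D12 N) :
    grad (dilate t u) =ᵐ[volume] fun x => t⁻¹ • grad u (t⁻¹ • x) := by
  rw [grad_dilate ht]
  exact (Lp.coeFn_smul _ _).trans ((dilLp_ae t ht _ _).const_smul t⁻¹)

theorem sq_norm_dilate {t : ℝ} (ht : 0 < t) (u : D12 N) :
    ‖dilate t u‖ ^ 2 = t ^ (N - 2) * ‖u‖ ^ 2 := by
  rw [sq_norm_eq_integral, sq_norm_eq_integral]
  have h : (fun x => ‖grad (dilate t u) x‖ ^ 2) =ᵐ[volume]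
      fun x => (fun y => (t⁻¹) ^ 2 * ‖grad u y‖ ^ 2) (t⁻¹ • x) := by
    filter_upwards [grad_dilate_ae ht u] with x hx
    rw [hx, norm_smul, mul_pow, Real.norm_of_nonneg (by positivity)]
  rw [integral_congr_ae h, integral_dil ht fun y => (t⁻¹) ^ 2 * ‖grad u y‖ ^ 2,
    integral_const_mul, ← mul_assoc]
  congr 1
  have h2 : N = N - 2 + 2 := by have := hN.out; omega
  conv_lhs => rw [h2, pow_add]
  field_simp

theorem continuous_dilate (u : D12 N) : Continuous fun t : ℝ≥0 => dilate (t : ℝ) u := by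
  have h2 := hN.out
  rw [continuous_iff_continuousAt]
  intro t₀
  rcases eq_or_ne t₀ 0 with rfl | h0
  · rw [ContinuousAt, NNReal.coe_zero, dilate_of_nonpos le_rfl]
    refine squeeze_zero_norm (a := fun t : ℝ≥0 => √((t : ℝ) ^ (N - 2) * ‖u‖ ^ 2))
      (fun t => ?_) ?_
    · refine Real.le_sqrt_of_sq_le ?_
      rcases eq_or_ne t 0 with rfl | ht
      · rw [NNReal.coe_zero, dilate_of_nonpos le_rfl, norm_zero, zero_pow two_ne_zero]
        positivity
      · rw [sq_norm_dilate (by positivity)]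
    · have : Continuous fun t : ℝ≥0 => √((t : ℝ) ^ (N - 2) * ‖u‖ ^ 2) := by fun_prop
      have h := this.tendsto 0
      rwa [NNReal.coe_zero, zero_pow (by omega), zero_mul, Real.sqrt_zero] at h
  · rw [ContinuousAt, gradL.isometry.isEmbedding.tendsto_nhds_iff]
    have ht₀ : 0 < (t₀ : ℝ) := by positivity
    have h3 : ContinuousAt (fun t : ℝ => t⁻¹ • dilLpExt t 2 (grad u)) t₀ :=
      (continuousAt_inv₀ ht₀.ne').smul (continuousAt_dilLpExt ht₀ (by simp) _)
    have h4 := h3.comp (f := fun t : ℝ≥0 => (t : ℝ)) NNReal.continuous_coe.continuousAt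
    have h5 (t : ℝ) (ht : 0 < t) : gradL (dilate t u) = t⁻¹ • dilLpExt t 2 (grad u) := by
      rw [gradL_apply, grad_dilate ht, dilLpExt_of_pos ht]
    rw [h5 _ ht₀]
    refine h4.tendsto.congr' ?_
    filter_upwards [lt_mem_nhds (pos_iff_ne_zero.2 h0)] with t ht
    simp only [Function.comp]
    rw [h5 t (by exact_mod_cast ht)]

end D12

theorem psi_dilate {t : ℝ} (ht : 0 < t) (u : D12 N) :
    psi f (D12.dilate t u) = t ^ N * psi f u := by
  rw [psi, psi, ← integral_dil ht]
  refine integral_congr_ae ?_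
  filter_upwards [D12.dilate_ae ht u] with x hx
  rw [hx]

theorem psi_zero : psi f (0 : D12 N) = 0 := by
  rw [psi, integral_eq_zero_of_ae]
  filter_upwards [D12.coeFn_zero (N := N)] with x hx
  simp [hx]

theorem energy_zero : energy f (0 : D12 N) = 0 := by simp [energy, psi_zero]

theorem energy_dilate {t : ℝ} (ht : 0 ≤ t) (u : D12 N) :
    energy f (D12.dilate t u) = t ^ (N - 2) * ‖u‖ ^ 2 / 2 - t ^ N * psi f u := by
  have h2 := hN.out
  rcases ht.eq_or_lt with rfl | ht
  · rw [D12.dilate_of_nonpos le_rfl, energy_zero, zero_pow (by omega), zero_pow (by omega)]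
    simp
  · rw [energy, D12.sq_norm_dilate ht, psi_dilate ht]

end

section

variable {N : ℕ} [hN : Fact (2 < N)] {f : ℝ → ℝ} {C : ℝ}

/-! ### The energy along dilation paths -/

variable (N) in
theorem natCast_dim_sub_two : ((N - 2 : ℕ) : ℝ) = N - 2 := by
  rw [Nat.cast_sub hN.out.le]
  simp

variable (N) in
/-- The weighted arithmetic-geometric mean inequality for `1` and `s^N`. -/
theorem dim_mul_pow_le {s : ℝ} (hs : 0 ≤ s) : N * s ^ (N - 2) ≤ 2 + (N - 2) * s ^ N := by
  have h2 := two_lt_dim N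
  have h := Real.geom_mean_le_arith_mean2_weighted (w₁ := 2 / N) (w₂ := (N - 2) / N) (p₁ := 1)
    (p₂ := s ^ N) (by positivity) (div_nonneg (by linarith) (by linarith)) zero_le_one
    (by positivity) (by field_simp; ring)
  have e : (s ^ N) ^ (((N : ℝ) - 2) / N) = s ^ (N - 2) := by
    rw [← Real.rpow_natCast s N, ← Real.rpow_mul hs, mul_div_cancel₀ _ (by linarith),
      ← natCast_dim_sub_two, Real.rpow_natCast]
  rw [e, Real.one_rpow, one_mul, mul_one, div_add' _ _ _ (by linarith), le_div_iff₀ (by linarith)]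
    at h
  have : (N - 2) / N * s ^ N * N = (N - 2) * s ^ N := by field_simp
  linarith

/-- The function `t ↦ a t^{N-2}/2 - b t^N` is maximal at its critical point `τ`. -/
theorem scaled_energy_le {a b τ t : ℝ} (ha : 0 ≤ a) (hτ : 0 < τ) (ht : 0 ≤ t)
    (hab : (N - 2) * a = 2 * N * b * τ ^ 2) :
    t ^ (N - 2) * a / 2 - t ^ N * b ≤ a / N * τ ^ (N - 2) := by
  have h2 := two_lt_dim N
  have hN0 : (N : ℝ) ≠ 0 := by linarith
  have h := mul_le_mul_of_nonneg_left (dim_mul_pow_le N (div_nonneg ht hτ.le))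
    (show 0 ≤ a * τ ^ (N - 2) by positivity)
  have h3 : τ ^ N = τ ^ (N - 2) * τ ^ 2 := by
    rw [← pow_add]
    congr 1
    have := hN.out
    omega
  have hb : b = (N - 2) * a / (2 * N * τ ^ 2) := by
    rw [eq_div_iff (by positivity)]
    linarith
  have e1 : a * τ ^ (N - 2) * (N * (t / τ) ^ (N - 2)) = N * a * t ^ (N - 2) := by
    rw [div_pow]
    field_simp
  have e2 : a * τ ^ (N - 2) * (2 + (N - 2) * (t / τ) ^ N) =
      2 * a * τ ^ (N - 2) + 2 * N * (t ^ N * b) := by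
    rw [hb, div_pow, h3]
    field_simp
  rw [e1, e2] at h
  have : a / N * τ ^ (N - 2) = (2 * a * τ ^ (N - 2)) / (2 * N) := by
    field_simp
  rw [this, le_div_iff₀ (by linarith)]
  linarith

theorem energy_eq_of_pohozaev {u : D12 N} (hP : (N - 2) * ‖u‖ ^ 2 = 2 * N * psi f u) :
    energy f u = ‖u‖ ^ 2 / N := by
  have h2 := two_lt_dim N
  rw [energy, eq_div_iff (by linarith)]
  linarith

theorem energy_dilate_le_of_pohozaev {u : D12 N} (hP : (N - 2) * ‖u‖ ^ 2 = 2 * N * psi f u)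
    {t : ℝ} (ht : 0 ≤ t) : energy f (D12.dilate t u) ≤ energy f u := by
  rw [energy_eq_of_pohozaev hP, energy_dilate ht]
  have := scaled_energy_le (N := N) (b := psi f u) (sq_nonneg ‖u‖) one_pos ht (by rw [hP]; ring)
  simpa using this

theorem dilate_path_mem_pathsD12 {u : D12 N} (hu : 0 < psi f u) :
    (fun t : ℝ≥0 => D12.dilate (t : ℝ) u) ∈ pathsD12 (energy f) := by
  have h2 := hN.out
  refine ⟨D12.continuous_dilate u, D12.dilate_of_nonpos le_rfl u, ?_⟩
  have h : Tendsto (fun t : ℝ => t ^ (N - 2) * (‖u‖ ^ 2 / 2 - t ^ 2 * psi f u)) atTop atBot := by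
    refine (tendsto_pow_atTop (by omega)).atTop_mul_atBot₀ ?_
    refine tendsto_atBot_add_const_left _ _ (tendsto_neg_atTop_atBot.comp ?_)
    exact (tendsto_pow_atTop two_ne_zero).atTop_mul_const hu
  refine (h.comp (NNReal.tendsto_coe_atTop.2 tendsto_id)).congr fun t => ?_
  simp only [Function.comp, id]
  rw [energy_dilate t.coe_nonneg]
  have h3 : (t : ℝ) ^ N = t ^ (N - 2) * t ^ 2 := by
    rw [← pow_add]
    congr 1
    omega
  rw [h3]
  ring

theorem dilate_path_mem_pathsH1 {u : D12 N} (hu : 0 < psi f u) (hu2 : MemLp u 2 volume) :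
    (fun t : ℝ≥0 => D12.dilate (t : ℝ) u) ∈ pathsH1 (energy f) := by
  have h2 := hN.out
  refine ⟨dilate_path_mem_pathsD12 hu, fun t => dilLpExt (t : ℝ) 2 (hu2.toLp u),
    continuous_dilLpExt (by omega) (by simp) _, fun t => ?_⟩
  rcases eq_or_ne t 0 with rfl | ht
  · beta_reduce
    rw [NNReal.coe_zero, dilLpExt_zero, D12.dilate_of_nonpos le_rfl]
    exact (Lp.coeFn_zero _ _ _).trans D12.coeFn_zero.symm
  · have ht' : 0 < (t : ℝ) := by positivity
    beta_reduce
    rw [dilLpExt_of_pos ht']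
    exact (dilLp_ae _ ht' _ _).trans ((ae_dil ht' hu2.coeFn_toLp).trans (D12.dilate_ae ht' u).symm)

/-! ### Upper bound for the mountain pass level -/

/-- The bound is the maximum of the energy over the dilation path of `u`, which is a path in `H¹`
because `u ∈ L²`. -/
theorem mountainPassLevel_le_of_memLp_two {u : D12 N} (hu : 0 < psi f u)
    (hu2 : MemLp u 2 volume) :
    mountainPassLevel (energy (N := N) f) (pathsH1 (energy f)) ≤
      ((‖u‖ ^ 2 / N * √((N - 2) * ‖u‖ ^ 2 / (2 * N * psi f u)) ^ (N - 2) : ℝ) : EReal) := by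
  have h2 := two_lt_dim N
  have hne : u ≠ 0 := by
    rintro rfl
    rw [psi_zero] at hu
    exact lt_irrefl _ hu
  have hn : 0 < ‖u‖ := norm_pos_iff.2 hne
  have hq : 0 < (N - 2) * ‖u‖ ^ 2 / (2 * N * psi f u) :=
    div_pos (mul_pos (by linarith) (by positivity)) (mul_pos (by linarith) hu)
  refine (iInf₂_le _ (dilate_path_mem_pathsH1 hu hu2)).trans (iSup_le fun t => ?_)
  beta_reduce
  rw [EReal.coe_le_coe_iff, energy_dilate t.coe_nonneg]
  refine scaled_energy_le (sq_nonneg _) (Real.sqrt_pos.2 hq) t.coe_nonneg ?_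
  rw [Real.sq_sqrt hq.le]
  field_simp

/-- A function on which the Pohozaev identity holds bounds the mountain pass level: its dilation
path has maximal energy at the function itself. The dilation path of `u` need not lie in `H¹`,
so `u` is approximated by test functions. -/
theorem mountainPassLevel_le_of_pohozaev (hf : Continuous f)
    (hC : ∀ s : ℝ, |f s| ≤ C * |s| ^ (critExp N - 1)) {u : D12 N} (hu : 0 < psi f u)
    (hP : (N - 2) * ‖u‖ ^ 2 = 2 * N * psi f u) :
    mountainPassLevel (energy (N := N) f) (pathsH1 (energy f)) ≤ (energy f u : EReal) := by
  have h2 := two_lt_dim N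
  obtain ⟨φ, w, hφ, hw, -, hlim⟩ := D12.exists_test_seq u
  have hψ : Tendsto (fun n => psi f (w n)) atTop (𝓝 (psi f u)) :=
    ((continuous_psi hf hC).tendsto u).comp hlim
  have hn : Tendsto (fun n => ‖w n‖ ^ 2) atTop (𝓝 (‖u‖ ^ 2)) := (hlim.norm).pow 2
  have h := ((hn.div_const (N : ℝ))).mul
    ((((hn.const_mul ((N : ℝ) - 2)).div (hψ.const_mul (2 * (N : ℝ)))
      (mul_pos (by linarith) hu).ne').sqrt).pow (N - 2))
  rw [hP, div_self (mul_pos (by linarith) hu).ne', Real.sqrt_one, one_pow, mul_one,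
    ← energy_eq_of_pohozaev hP] at h
  refine ge_of_tendsto ((continuous_coe_real_ereal.tendsto _).comp h) ?_
  filter_upwards [hψ.eventually (lt_mem_nhds hu)] with n hn
  exact mountainPassLevel_le_of_memLp_two hn
    ((memLp_congr_ae (hw n)).2 ((hφ n).1.continuous.memLp_of_hasCompactSupport (hφ n).2))

theorem mountainPassLevel_pathsD12_le_pathsH1 (G : D12 N → ℝ) :
    mountainPassLevel G (pathsD12 G) ≤ mountainPassLevel G (pathsH1 G) :=
  biInf_mono fun _ h => h.1

/-! ### Positivity of `κ(1)` -/

/-- Bump functions of height `s` with plateau the unit ball and ever steeper flanks have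
`ψ`-values tending to `F(s)` times the volume of the ball. -/
theorem exists_psi_pos (hf : Continuous f) (hF : ∃ s : ℝ, 0 < primitive f s) :
    ∃ u : D12 N, 0 < psi f u := by
  obtain ⟨s, hs⟩ := hF
  let b (n : ℕ) : ContDiffBump (0 : RN N) :=
    { rIn := 1, rOut := 1 + 1 / ((n : ℝ) + 1), rIn_pos := one_pos,
      rIn_lt_rOut := lt_add_of_pos_right _ (by positivity) }
  have hFc := continuous_primitive hf
  obtain ⟨M, hM⟩ := (isCompact_Icc (a := (0 : ℝ)) (b := 1)).exists_bound_of_continuousOn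
    (f := fun θ => primitive f (s * θ)) (by fun_prop)
  have hM0 : 0 ≤ M := (norm_nonneg _).trans (hM 0 (by norm_num))
  have hlim : Tendsto (fun n => ∫ x, primitive f (s * b n x)) atTop
      (𝓝 (∫ x, (Metric.closedBall (0 : RN N) 1).indicator (fun _ => primitive f s) x)) := by
    refine tendsto_integral_of_dominated_convergence
      ((Metric.closedBall (0 : RN N) 2).indicator fun _ => M)
      (fun n => (hFc.comp (continuous_const.mul (b n).continuous)).aestronglyMeasurable) ?_
      (fun n => ae_of_all _ fun x => ?_) (ae_of_all _ fun x => ?_)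
    · exact (integrable_indicator_iff measurableSet_closedBall).2
        (integrableOn_const measure_closedBall_lt_top.ne)
    · by_cases hx : x ∈ Metric.closedBall (0 : RN N) 2
      · rw [Set.indicator_of_mem hx]
        exact hM _ ⟨(b n).nonneg, (b n).le_one⟩
      · have h0 : b n x = 0 := (b n).zero_of_le_dist (by
          rw [Metric.mem_closedBall, not_le] at hx
          refine le_trans ?_ hx.le
          change 1 + 1 / ((n : ℝ) + 1) ≤ 2
          have : 1 / ((n : ℝ) + 1) ≤ 1 := by
            rw [div_le_one (by positivity)]
            linarith [Nat.cast_nonneg (α := ℝ) n]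
          linarith)
        simp [h0, Set.indicator_of_notMem hx]
    · by_cases hx : x ∈ Metric.closedBall (0 : RN N) 1
      · rw [Set.indicator_of_mem hx]
        refine tendsto_const_nhds.congr fun n => ?_
        rw [(b n).one_of_mem_closedBall hx, mul_one]
      · rw [Set.indicator_of_notMem hx]
        rw [Metric.mem_closedBall, not_le] at hx
        have h1 : Tendsto (fun n : ℕ => 1 + 1 / ((n : ℝ) + 1)) atTop (𝓝 (1 + 0)) :=
          tendsto_one_div_add_atTop_nhds_zero_nat.const_add 1
        rw [add_zero] at h1
        refine tendsto_const_nhds.congr' ?_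
        filter_upwards [h1.eventually (gt_mem_nhds hx)] with n hn
        have h0 : b n x = 0 := (b n).zero_of_le_dist (le_of_lt hn)
        simp [h0]
  have hpos : 0 < ∫ x, (Metric.closedBall (0 : RN N) 1).indicator (fun _ => primitive f s) x := by
    rw [integral_indicator measurableSet_closedBall, setIntegral_const, smul_eq_mul]
    refine mul_pos ?_ hs
    exact ENNReal.toReal_pos (Metric.measure_closedBall_pos _ _ one_pos).ne'
      measure_closedBall_lt_top.ne
  obtain ⟨n, hn⟩ := (hlim.eventually (lt_mem_nhds hpos)).exists
  obtain ⟨u, hu, -⟩ := D12.exists_of_test (φ := fun x => s * b n x)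
    ⟨contDiff_const.mul (b n).contDiff, (b n).hasCompactSupport.mul_left⟩
  refine ⟨u, hn.trans_eq (integral_congr_ae ?_)⟩
  filter_upwards [hu] with x hx
  rw [hx]

theorem bddAbove_psi_sphere (hf : Continuous f)
    (hC : ∀ s : ℝ, |f s| ≤ C * |s| ^ (critExp N - 1)) (t : ℝ) :
    BddAbove (psi f '' {u : D12 N | ‖u‖ ^ 2 = t}) := by
  obtain ⟨K, hK0, hK⟩ := D12.exists_sobolev_nonneg N
  have hp := two_lt_critExp N
  have hC0 := growth_const_nonneg hC
  refine ⟨C * (K * √t) ^ critExp N, ?_⟩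
  rintro _ ⟨u, hu, rfl⟩
  have hn : ‖u‖ = √t := by rw [← show ‖u‖ ^ 2 = t from hu, Real.sqrt_sq (norm_nonneg _)]
  have hint : Integrable (fun x => |u x| ^ critExp N) volume := by
    have := u.memLp.integrable_norm_rpow (critExpE_ne_zero N) (critExpE_ne_top N)
    rwa [toReal_critExpE] at this
  calc psi f u ≤ ∫ x, C * |u x| ^ critExp N :=
        integral_mono (integrable_primitive_comp hf (by linarith) hC u.memLp) (hint.const_mul C)
          fun x => (le_abs_self _).trans (abs_primitive_le (by linarith) hC _)
    _ = C * ‖u.toLCrit‖ ^ critExp N := by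
        rw [integral_const_mul, Lp.norm_def]
        congr 1
        exact integral_abs_rpow_eq (critExp_pos N) u.memLp
    _ ≤ C * (K * √t) ^ critExp N := by
        have := critExp_pos N
        gcongr
        rw [← hn]
        exact hK u

/-- Every nonzero `u` has a dilate with prescribed norm. -/
theorem D12.exists_dilate_sq_norm {u : D12 N} (hu : u ≠ 0) {t : ℝ} (ht : 0 < t) :
    ∃ s : ℝ, 0 < s ∧ ‖dilate s u‖ ^ 2 = t ∧ s ^ N = (t / ‖u‖ ^ 2) ^ (critExp N / 2) := by
  have hn : 0 < ‖u‖ := norm_pos_iff.2 hu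
  have h2 := two_lt_dim N
  have hN2 : (N : ℝ) - 2 ≠ 0 := by linarith
  have hq : 0 < t / ‖u‖ ^ 2 := by positivity
  refine ⟨(t / ‖u‖ ^ 2) ^ (1 / ((N : ℝ) - 2)), by positivity, ?_, ?_⟩
  · rw [sq_norm_dilate (by positivity), ← Real.rpow_natCast (_ ^ (1 / ((N : ℝ) - 2))),
      natCast_dim_sub_two, ← Real.rpow_mul hq.le, one_div_mul_cancel hN2, Real.rpow_one,
      div_mul_cancel₀ _ (by positivity)]
  · rw [← Real.rpow_natCast, ← Real.rpow_mul hq.le, critExp]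
    congr 1
    field_simp

theorem kappa_one_pos (hf : Continuous f) (hC : ∀ s : ℝ, |f s| ≤ C * |s| ^ (critExp N - 1))
    (hF : ∃ s : ℝ, 0 < primitive f s) : 0 < kappa N f 1 := by
  obtain ⟨u, hu⟩ := exists_psi_pos (N := N) hf hF
  have hne : u ≠ 0 := by
    rintro rfl
    rw [psi_zero] at hu
    exact lt_irrefl _ hu
  obtain ⟨s, hs, hs1, -⟩ := D12.exists_dilate_sq_norm hne one_pos
  have h : 0 < psi f (D12.dilate s u) := by
    rw [psi_dilate hs]
    positivity
  exact h.trans_le (le_csSup (bddAbove_psi_sphere hf hC 1) ⟨_, hs1, rfl⟩)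

/-! ### Maximizers for `κ(t₀)` -/

theorem kappa_one_eq {τ : ℝ} (hτ : 0 < τ) {w : D12 N} (hw : IsKappaMaximizer f (τ ^ (N - 2)) w) :
    τ ^ N * kappa N f 1 = psi f w := by
  have hg : IsGreatest (psi f '' {u : D12 N | ‖u‖ ^ 2 = 1}) (psi f w / τ ^ N) := by
    refine ⟨⟨D12.dilate τ⁻¹ w, ?_, ?_⟩, ?_⟩
    · rw [Set.mem_ofPred_eq, D12.sq_norm_dilate (inv_pos.2 hτ), hw.1, ← mul_pow,
        inv_mul_cancel₀ hτ.ne', one_pow]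
    · rw [psi_dilate (inv_pos.2 hτ), inv_pow, inv_mul_eq_div]
    · rintro _ ⟨u, hu, rfl⟩
      rw [le_div_iff₀ (by positivity), mul_comm, ← psi_dilate hτ]
      refine hw.2 _ ?_
      rw [D12.sq_norm_dilate hτ, show ‖u‖ ^ 2 = 1 from hu, mul_one]
  rw [kappa, hg.csSup_eq, mul_div_cancel₀ _ (by positivity)]

/-- The choice of `t₀` makes the Pohozaev identity `2* ψ(w) = ‖w‖²` hold for maximizers. -/
theorem IsKappaMaximizer.critExp_mul_psi (hf : Continuous f)
    (hC : ∀ s : ℝ, |f s| ≤ C * |s| ^ (critExp N - 1)) (hF : ∃ s : ℝ, 0 < primitive f s)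
    {w : D12 N} (hw : IsKappaMaximizer f (tZero N f) w) :
    0 < tZero N f ∧ critExp N * psi f w = tZero N f := by
  have hk := kappa_one_pos hf hC hF
  have hp := critExp_pos N
  have hpk : 0 < critExp N * kappa N f 1 := by positivity
  set τ : ℝ := (critExp N * kappa N f 1) ^ (-(1 / 2) : ℝ) with hτ
  have hτ0 : 0 < τ := by positivity
  have ht : tZero N f = τ ^ (N - 2) := by
    rw [tZero, hτ, ← Real.rpow_natCast, ← Real.rpow_mul hpk.le, natCast_dim_sub_two]
    congr 1
    ring
  have hτ2 : τ ^ 2 * (critExp N * kappa N f 1) = 1 := by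
    rw [hτ, ← Real.rpow_natCast, ← Real.rpow_mul hpk.le, ← Real.rpow_add_one hpk.ne']
    norm_num
  refine ⟨by rw [ht]; positivity, ?_⟩
  have h3 : τ ^ N = τ ^ (N - 2) * τ ^ 2 := by
    rw [← pow_add]
    congr 1
    have := hN.out
    omega
  rw [ht] at hw ⊢
  rw [← kappa_one_eq hτ0 hw, h3]
  linear_combination τ ^ (N - 2) * hτ2

theorem IsKappaMaximizer.pohozaev {t : ℝ} {w : D12 N} (hw : IsKappaMaximizer f t w)
    (h : critExp N * psi f w = t) : (N - 2) * ‖w‖ ^ 2 = 2 * N * psi f w := by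
  have h2 := two_lt_dim N
  have : (N : ℝ) - 2 ≠ 0 := by linarith
  rw [hw.1, ← h, critExp]
  field_simp

/-- Dilating `u` to the norm of the maximizer `w` bounds `ψ(u)`. -/
theorem IsKappaMaximizer.psi_le {t : ℝ} (ht : 0 < t) {w : D12 N} (hw : IsKappaMaximizer f t w)
    (u : D12 N) : psi f u ≤ psi f w * (‖u‖ ^ 2 / t) ^ (critExp N / 2) := by
  have hp := critExp_pos N
  rcases eq_or_ne u 0 with rfl | hu
  · rw [psi_zero, norm_zero, zero_pow two_ne_zero, zero_div, Real.zero_rpow (by positivity),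
      mul_zero]
  · obtain ⟨s, hs, hs1, hs2⟩ := D12.exists_dilate_sq_norm hu ht
    have h := hw.2 _ hs1
    have hn : 0 < ‖u‖ := norm_pos_iff.2 hu
    rw [psi_dilate hs] at h
    have e : (‖u‖ ^ 2 / t) ^ (critExp N / 2) = (s ^ N)⁻¹ := by
      rw [hs2, ← Real.inv_rpow (by positivity), inv_div]
    rw [e, ← div_eq_mul_inv, le_div_iff₀ (by positivity)]
    linarith

/-- The functional `u ↦ ψ(w) (‖u‖²/t₀)^{2*/2} - ψ(u)` is minimal at the maximizer `w`. Its
derivative there is `⟨∇w, ∇·⟩ - ψ'(w)`, by the choice of `t₀`. -/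
theorem IsKappaMaximizer.isCriticalPoint (hf : Continuous f)
    (hC : ∀ s : ℝ, |f s| ≤ C * |s| ^ (critExp N - 1)) {t : ℝ} (ht : 0 < t) {w : D12 N}
    (hw : IsKappaMaximizer f t w) (h : critExp N * psi f w = t) :
    IsCriticalPoint (energy f) w := by
  rw [isCriticalPoint_iff hf hC]
  obtain ⟨L, hL, hLd⟩ := hasFDerivAt_psi hf hC w
  obtain ⟨M, hM, hMd⟩ := D12.hasFDerivAt_sq_norm w
  have hval : ‖w‖ ^ 2 / t = 1 := by rw [hw.1, div_self ht.ne']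
  have h1 : HasFDerivAt (fun u : D12 N => ‖u‖ ^ 2 / t) (t⁻¹ • M) w := by
    refine (hMd.const_smul t⁻¹).congr_of_eventuallyEq (Eventually.of_forall fun v => ?_)
    simp [div_eq_inv_mul]
  have h2 := ((h1.rpow_const (p := critExp N / 2)
    (Or.inl (by rw [hval]; exact one_ne_zero))).const_smul (psi f w)).sub hLd
  have hmin : IsLocalMin
      ((psi f w • fun u : D12 N => (‖u‖ ^ 2 / t) ^ (critExp N / 2)) - psi f) w := by
    refine Eventually.of_forall fun u => ?_
    simp only [Pi.sub_apply, Pi.smul_apply, smul_eq_mul]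
    rw [hval, Real.one_rpow, mul_one, sub_self, sub_nonneg]
    exact hw.psi_le ht u
  have h0 := hmin.hasFDerivAt_eq_zero h2
  intro v
  have h3 := congrArg (fun T : D12 N →L[ℝ] ℝ => T v) h0
  simp only [hval, Real.one_rpow, sub_apply, smul_apply,
    smul_eq_mul, hM, hL, zero_apply] at h3
  have h4 : psi f w * (critExp N / 2 * 1 * (t⁻¹ * (2 * inner ℝ (D12.grad w) (D12.grad v)))) =
      inner ℝ (D12.grad w) (D12.grad v) := by
    have : psi f w = t / critExp N := by
      rw [eq_div_iff (critExp_pos N).ne']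
      linarith
    have := critExp_pos N
    rw [‹psi f w = _›]
    field_simp
  linarith

/-- Every admissible path crosses the sphere `‖u‖² = t₀`, since the energy is nonnegative inside. -/
theorem IsKappaMaximizer.le_mountainPassLevel {t : ℝ} (ht : 0 < t) {w : D12 N}
    (hw : IsKappaMaximizer f t w) (h : critExp N * psi f w = t) :
    (energy f w : EReal) ≤ mountainPassLevel (energy (N := N) f) (pathsD12 (energy f)) := by
  have hp := two_lt_critExp N
  have hin (u : D12 N) (hu : ‖u‖ ^ 2 ≤ t) : 0 ≤ energy f u := by
    have h1 := hw.psi_le ht u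
    have h2 : (‖u‖ ^ 2 / t) ^ (critExp N / 2) ≤ ‖u‖ ^ 2 / t := by
      have := Real.rpow_le_rpow_of_exponent_ge' (by positivity) ((div_le_one ht).2 hu)
        zero_le_one (show (1 : ℝ) ≤ critExp N / 2 by linarith)
      rwa [Real.rpow_one] at this
    have hw' : psi f w = t / critExp N := by
      rw [eq_div_iff (critExp_pos N).ne']
      linarith
    have h3 : psi f w * (‖u‖ ^ 2 / t) ^ (critExp N / 2) ≤ ‖u‖ ^ 2 / 2 := by
      calc _ ≤ psi f w * (‖u‖ ^ 2 / t) := by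
            refine mul_le_mul_of_nonneg_left h2 ?_
            rw [hw']
            exact div_nonneg ht.le (critExp_pos N).le
        _ = ‖u‖ ^ 2 / critExp N := by rw [hw']; field_simp
        _ ≤ ‖u‖ ^ 2 / 2 := by gcongr
    rw [energy]
    linarith
  refine le_iInf₂ fun φ hφ => ?_
  obtain ⟨T, hT⟩ := (hφ.2.2.eventually (eventually_lt_atBot 0)).exists
  have hTt : t ≤ ‖φ T‖ ^ 2 := by
    by_contra! hlt
    exact absurd (hin _ hlt.le) (not_le.2 hT)
  obtain ⟨s, hs⟩ := mem_range_of_exists_le_of_exists_ge (c := t)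
    (f := fun s => ‖φ s‖ ^ 2) (hφ.1.norm.pow 2)
    ⟨0, by simp only [hφ.2.1, norm_zero]; rw [zero_pow two_ne_zero]; exact ht.le⟩ ⟨T, hTt⟩
  refine le_iSup_of_le s ?_
  rw [EReal.coe_le_coe_iff, energy, energy, hw.1, show ‖φ s‖ ^ 2 = t from hs]
  linarith [hw.2 _ hs]

theorem IsKappaMaximizer.isGreatest_energy_dilate {t : ℝ} {w : D12 N} (hw : IsKappaMaximizer f t w)
    (h : critExp N * psi f w = t) :
    IsGreatest ((fun t : ℝ => energy f (D12.dilate t w)) '' Set.Ici 0) (energy f w) := by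
  refine ⟨⟨1, Set.mem_Ici.2 zero_le_one, ?_⟩, ?_⟩
  · simp only
    rw [energy_dilate zero_le_one, energy]
    simp
  · rintro _ ⟨s, hs, rfl⟩
    exact energy_dilate_le_of_pohozaev (hw.pohozaev h) hs

end

/-! ### Composition with smooth functions in `𝒟^{1,2}` -/

theorem gradient_comp {N : ℕ} {g : ℝ → ℝ} {φ : RN N → ℝ} (hg : Differentiable ℝ g)
    (hφ : Differentiable ℝ φ) (x : RN N) :
    gradient (fun y => g (φ y)) x = deriv g (φ x) • gradient φ x := by
  have h : fderiv ℝ (fun y => g (φ y)) x = deriv g (φ x) • fderiv ℝ φ x :=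
    ((hg (φ x)).hasDerivAt.comp_hasFDerivAt x (hφ x).hasFDerivAt).fderiv
  simp [gradient, h]

section

variable {N : ℕ} [hN : Fact (2 < N)] {f : ℝ → ℝ} {C : ℝ}

/-- Test functions converging in `𝒟^{1,2}` and almost everywhere. -/
theorem D12.exists_test_seq_ae (u : D12 N) : ∃ φ : ℕ → RN N → ℝ, (∀ n, IsTest (φ n)) ∧
    Tendsto (fun n => eLpNorm (fun x => φ n x - u x) (critExpE N) volume) atTop (𝓝 0) ∧
    Tendsto (fun n => eLpNorm (fun x => gradient (φ n) x - grad u x) 2 volume) atTop (𝓝 0) ∧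
    ∀ᵐ x, Tendsto (fun n => φ n x) atTop (𝓝 (u x)) := by
  obtain ⟨φ, w, hφ, hw, hgw, hlim⟩ := exists_test_seq u
  have h1 := (Lp.tendsto_Lp_iff_tendsto_eLpNorm' _ _).1 ((toLCritL.continuous.tendsto u).comp hlim)
  have h2 := (Lp.tendsto_Lp_iff_tendsto_eLpNorm' _ _).1 ((gradL.continuous.tendsto u).comp hlim)
  obtain ⟨ns, hns, hae⟩ := (tendstoInMeasure_of_tendsto_Lp
    ((toLCritL.continuous.tendsto u).comp hlim)).exists_seq_tendsto_ae
  refine ⟨fun n => φ (ns n), fun n => hφ _, ?_, ?_, ?_⟩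
  · refine (h1.comp hns.tendsto_atTop).congr fun n => eLpNorm_congr_ae ?_
    filter_upwards [hw (ns n)] with x hx
    simp [← hx]
  · refine (h2.comp hns.tendsto_atTop).congr fun n => eLpNorm_congr_ae ?_
    filter_upwards [hgw (ns n)] with x hx
    simp [← hx]
  · filter_upwards [hae, ae_all_iff.2 hw] with x hx hwx
    refine hx.congr fun n => ?_
    simp [← hwx]

/-- The chain rule in `𝒟^{1,2}`. -/
theorem D12.exists_comp (u : D12 N) {g : ℝ → ℝ} (hg : ContDiff ℝ ∞ g) (hg0 : g 0 = 0) {M : ℝ}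
    (hM : ∀ s, |deriv g s| ≤ M) :
    ∃ w : D12 N, w =ᵐ[volume] (fun x => g (u x)) ∧
      grad w =ᵐ[volume] fun x => deriv g (u x) • grad u x := by
  obtain ⟨φ, hφ, h1, h2, hae⟩ := exists_test_seq_ae u
  have hgd : Differentiable ℝ g := hg.differentiable (by simp)
  have hgc : Continuous (deriv g) := hg.continuous_deriv (by simp)
  have hM0 : 0 ≤ M := (abs_nonneg _).trans (hM 0)
  have hlip (a b : ℝ) : ‖g a - g b‖ ≤ M * ‖a - b‖ :=
    convex_univ.norm_image_sub_le_of_norm_deriv_le (fun x _ => hgd x) (fun x _ => hM x)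
      (Set.mem_univ b) (Set.mem_univ a)
  have hgu : AEStronglyMeasurable (fun x => deriv g (u x)) volume :=
    hgc.comp_aestronglyMeasurable u.memLp.1
  have hmem1 : MemLp (fun x => g (u x)) (critExpE N) volume := by
    refine u.memLp.of_le_mul (c := M) (hg.continuous.comp_aestronglyMeasurable u.memLp.1)
      (ae_of_all _ fun x => ?_)
    simpa [hg0] using hlip (u x) 0
  have hmem2 : MemLp (fun x => deriv g (u x) • grad u x) 2 volume := by
    refine u.memLp_grad.of_le_mul (c := M) (hgu.smul u.memLp_grad.1) (ae_of_all _ fun x => ?_)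
    rw [norm_smul]
    gcongr
    exact hM _
  refine exists_of_tendsto hmem1 hmem2 (φ := fun n x => g (φ n x))
    (fun n => ⟨hg.comp (hφ n).1, (hφ n).2.comp_left hg0⟩) ?_ ?_
  · have hle (n : ℕ) : eLpNorm (fun x => g (φ n x) - g (u x)) (critExpE N) volume ≤
        ENNReal.ofReal M * eLpNorm (fun x => φ n x - u x) (critExpE N) volume :=
      eLpNorm_le_mul_eLpNorm_of_ae_le_mul (ae_of_all _ fun x => hlip _ _) _
    refine tendsto_of_tendsto_of_tendsto_of_le_of_le tendsto_const_nhds ?_ (fun _ => zero_le)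
      hle
    simpa using ENNReal.Tendsto.const_mul h1 (Or.inr ENNReal.ofReal_ne_top)
  · have hφd (n : ℕ) : Differentiable ℝ (φ n) := (hφ n).1.differentiable (by simp)
    have hm1 (n : ℕ) : AEStronglyMeasurable (fun x => deriv g (φ n x)) volume :=
      (hgc.comp (hφ n).1.continuous).aestronglyMeasurable
    have hm2 (n : ℕ) : AEStronglyMeasurable (fun x => gradient (φ n) x - grad u x) volume :=
      (memLp_gradient_test (hφ n) (q := 2)).1.sub u.memLp_grad.1
    have hdom : Tendsto (fun n => eLpNorm
        (fun x => (deriv g (φ n x) - deriv g (u x)) • grad u x) 2 volume) atTop (𝓝 0) := by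
      refine tendsto_eLpNorm_zero_of_dominated two_ne_zero (by simp)
        (Eventually.of_forall fun n => ((hm1 n).sub hgu).smul u.memLp_grad.1)
        (u.memLp_grad.norm.const_mul (2 * M))
        (Eventually.of_forall fun n => ae_of_all _ fun x => ?_) ?_
      · rw [norm_smul]
        gcongr
        have := norm_sub_le (deriv g (φ n x)) (deriv g (u x))
        have h3 := hM (φ n x)
        have h4 := hM (u x)
        rw [Real.norm_eq_abs, Real.norm_eq_abs, Real.norm_eq_abs] at this
        rw [Real.norm_eq_abs]
        linarith
      · filter_upwards [hae] with x hx
        have := (((hgc.tendsto _).comp hx).sub_const (deriv g (u x))).smul_const (grad u x)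
        simpa [Function.comp_def] using this
    have hle (n : ℕ) : eLpNorm (fun x => gradient (fun y => g (φ n y)) x -
          deriv g (u x) • grad u x) 2 volume ≤
        ENNReal.ofReal M * eLpNorm (fun x => gradient (φ n) x - grad u x) 2 volume +
          eLpNorm (fun x => (deriv g (φ n x) - deriv g (u x)) • grad u x) 2 volume := by
      have e : (fun x => gradient (fun y => g (φ n y)) x - deriv g (u x) • grad u x) =
          (fun x => deriv g (φ n x) • (gradient (φ n) x - grad u x)) +
            fun x => (deriv g (φ n x) - deriv g (u x)) • grad u x := by
        funext x
        rw [gradient_comp hgd (hφd n), Pi.add_apply, smul_sub, sub_smul]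
        abel
      rw [e]
      refine (eLpNorm_add_le ((hm1 n).smul (hm2 n)) (((hm1 n).sub hgu).smul u.memLp_grad.1)
        one_le_two).trans (add_le_add ?_ le_rfl)
      refine eLpNorm_le_mul_eLpNorm_of_ae_le_mul (ae_of_all _ fun x => ?_) _
      rw [Pi.smul_apply', norm_smul]
      gcongr
      exact hM _
    refine tendsto_of_tendsto_of_tendsto_of_le_of_le tendsto_const_nhds ?_ (fun _ => zero_le)
      hle
    simpa using (ENNReal.Tendsto.const_mul h2 (Or.inr ENNReal.ofReal_ne_top)).add hdom

end

/-! ### Truncated weights -/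

/-- The bounded weight `(1 + s²)/(1 + εs²)`, which increases to `1 + s²` as `ε ↓ 0`. It is smooth,
so that `s ↦ s θ(s)` and `s ↦ s θ(s)²` act on `𝒟^{1,2}`. -/
noncomputable def truncWeight (ε s : ℝ) : ℝ := (1 + s ^ 2) / (1 + ε * s ^ 2)

section

variable {ε : ℝ}

theorem truncWeight_pos (hε : 0 < ε) (s : ℝ) : 0 < truncWeight ε s := by
  rw [truncWeight]
  positivity

theorem truncWeight_le (hε : 0 < ε) (s : ℝ) : truncWeight ε s ≤ 1 + s ^ 2 :=
  div_le_self (by positivity) (le_add_of_nonneg_right (by positivity))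

theorem truncWeight_le_inv (hε : 0 < ε) (hε1 : ε ≤ 1) (s : ℝ) : truncWeight ε s ≤ ε⁻¹ := by
  rw [truncWeight, div_le_iff₀ (by positivity), mul_add, mul_one, ← mul_assoc,
    inv_mul_cancel₀ hε.ne', one_mul]
  gcongr
  exact (one_le_inv₀ hε).2 hε1

theorem contDiff_truncWeight (hε : 0 < ε) : ContDiff ℝ ∞ (truncWeight ε) := by
  refine ContDiff.div (by fun_prop) (by fun_prop) fun s => ?_
  positivity

theorem exists_hasDerivAt_truncWeight (hε : 0 < ε) (hε1 : ε ≤ 1) (s : ℝ) :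
    ∃ d, HasDerivAt (truncWeight ε) d s ∧ 0 ≤ s * d ∧ s * d ≤ 2 * truncWeight ε s := by
  have hpos : 0 < 1 + ε * s ^ 2 := by positivity
  have h : HasDerivAt (truncWeight ε)
      ((2 * s * (1 + ε * s ^ 2) - (1 + s ^ 2) * (ε * (2 * s))) / (1 + ε * s ^ 2) ^ 2) s := by
    have h1 : HasDerivAt (fun s : ℝ => 1 + s ^ 2) (2 * s) s := by
      simpa using (hasDerivAt_pow 2 s).const_add 1
    have h2 : HasDerivAt (fun s : ℝ => 1 + ε * s ^ 2) (ε * (2 * s)) s := by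
      simpa using ((hasDerivAt_pow 2 s).const_mul ε).const_add 1
    exact h1.div h2 hpos.ne'
  have e : s * ((2 * s * (1 + ε * s ^ 2) - (1 + s ^ 2) * (ε * (2 * s))) / (1 + ε * s ^ 2) ^ 2) =
      2 * s ^ 2 * (1 - ε) / (1 + ε * s ^ 2) ^ 2 := by
    field_simp
    ring
  refine ⟨_, h, ?_, ?_⟩
  · rw [e]
    have : 0 ≤ 1 - ε := by linarith
    positivity
  · rw [e, truncWeight, ← mul_div_assoc, div_le_div_iff₀ (by positivity) hpos]
    have h1 : 2 * s ^ 2 * (1 - ε) ≤ 2 * (1 + s ^ 2) * (1 + ε * s ^ 2) := by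
      have : 0 ≤ ε * s ^ 2 := by positivity
      have : 0 ≤ s ^ 2 * (ε * s ^ 2) := by positivity
      nlinarith
    calc _ ≤ 2 * (1 + s ^ 2) * (1 + ε * s ^ 2) * (1 + ε * s ^ 2) := by gcongr
      _ = _ := by ring

/-- For `g(s) = s θ(s)` and `h(s) = s θ(s)²` one has `s h(s) = g(s)²` and `(g')² ≤ 9 h'`. -/
theorem deriv_mul_truncWeight (hε : 0 < ε) (hε1 : ε ≤ 1) (s : ℝ) :
    |deriv (fun s => s * truncWeight ε s) s| ≤ 3 * ε⁻¹ ∧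
    |deriv (fun s => s * truncWeight ε s ^ 2) s| ≤ 5 * ε⁻¹ ^ 2 ∧
    deriv (fun s => s * truncWeight ε s) s ^ 2 ≤
      9 * deriv (fun s => s * truncWeight ε s ^ 2) s := by
  obtain ⟨d, hd, h0, h1⟩ := exists_hasDerivAt_truncWeight hε hε1 s
  have hpos := truncWeight_pos hε s
  have hle := truncWeight_le_inv hε hε1 s
  have hg : deriv (fun s => s * truncWeight ε s) s = truncWeight ε s + s * d := by
    have : HasDerivAt (fun s => s * truncWeight ε s) (1 * truncWeight ε s + s * d) s :=
      (hasDerivAt_id s).mul hd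
    rw [this.deriv, one_mul]
  have hh : deriv (fun s => s * truncWeight ε s ^ 2) s =
      truncWeight ε s ^ 2 + 2 * truncWeight ε s * (s * d) := by
    have : HasDerivAt (fun s => s * truncWeight ε s ^ 2)
        (1 * truncWeight ε s ^ 2 + s * ((2 : ℕ) * truncWeight ε s ^ (2 - 1) * d)) s :=
      (hasDerivAt_id s).mul (hd.pow 2)
    rw [this.deriv]
    norm_num
    ring
  rw [hg, hh]
  set θ := truncWeight ε s
  set r := s * d
  have h2 : θ * r ≤ θ * (2 * θ) := by gcongr
  have h3 : 0 ≤ θ * r := by positivity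
  have h4 : θ ^ 2 ≤ ε⁻¹ ^ 2 := by gcongr
  refine ⟨?_, ?_, ?_⟩
  · rw [abs_of_nonneg (by positivity)]
    linarith
  · rw [abs_of_nonneg (by positivity)]
    nlinarith
  · have h5 : r * r ≤ 2 * θ * r := by gcongr
    nlinarith

end

/-! ### Higher integrability of weak solutions -/

section

variable {N : ℕ} [hN : Fact (2 < N)] {f : ℝ → ℝ} {C : ℝ}

theorem integrable_abs_rpow_critExp (u : D12 N) :
    Integrable (fun x => |u x| ^ critExp N) volume := by
  have := u.memLp.integrable_norm_rpow (critExpE_ne_zero N) (critExpE_ne_top N)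
  rwa [toReal_critExpE] at this

variable (N) in
theorem holderConjugate_critExp_div_two :
    ENNReal.HolderConjugate (ENNReal.ofReal (critExp N / 2).conjExponent)
      (ENNReal.ofReal (critExp N / 2)) :=
  (Real.HolderConjugate.conjExponent (by linarith [two_lt_critExp N])).symm.ennrealOfReal

/-- The level sets `{|u| > Λ}` carry a small part of `|u|^{2*-2}` for large `Λ`. -/
theorem tendsto_eLpNorm_indicator_rpow (u : D12 N) :
    (∀ Λ : ℕ, MemLp ({x | (Λ : ℝ) < |u x|}.indicator fun x => |u x| ^ (critExp N - 2))
      (ENNReal.ofReal (critExp N / 2).conjExponent) volume) ∧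
    Tendsto (fun Λ : ℕ => eLpNorm
      ({x | (Λ : ℝ) < |u x|}.indicator fun x => |u x| ^ (critExp N - 2))
      (ENNReal.ofReal (critExp N / 2).conjExponent) volume) atTop (𝓝 0) := by
  have hp := two_lt_critExp N
  have hmem : MemLp (fun x => |u x| ^ (critExp N - 2))
      (ENNReal.ofReal (critExp N / 2).conjExponent) volume := by
    have h := u.memLp.norm_rpow_div (q := ENNReal.ofReal (critExp N - 2))
    have h2 : critExpE N / ENNReal.ofReal (critExp N - 2) =
        ENNReal.ofReal (critExp N / 2).conjExponent := by
      rw [critExpE, ← ENNReal.ofReal_div_of_pos (by linarith), Real.conjExponent]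
      congr 1
      have : critExp N - 2 ≠ 0 := by linarith
      have : critExp N / 2 - 1 ≠ 0 := by linarith
      field_simp
    rw [ENNReal.toReal_ofReal (by linarith), h2] at h
    exact h
  have hset (Λ : ℕ) : MeasurableSet {x | (Λ : ℝ) < |u x|} :=
    measurableSet_lt measurable_const (Lp.stronglyMeasurable u.toLCrit).measurable.abs
  refine ⟨fun Λ => hmem.indicator (hset Λ), ?_⟩
  have hc := (holderConjugate_critExp_div_two N).one_le
  refine tendsto_eLpNorm_zero_of_dominated (zero_lt_one.trans_le hc).ne' ENNReal.ofReal_ne_top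
    (Eventually.of_forall fun Λ => (hmem.indicator (hset Λ)).1) hmem
    (Eventually.of_forall fun Λ => ae_of_all _ fun x => ?_) (ae_of_all _ fun x => ?_)
  · refine (norm_indicator_le_norm_self _ _).trans_eq ?_
    exact Real.norm_of_nonneg (by positivity)
  · obtain ⟨n, hn⟩ := exists_nat_ge |u x|
    refine tendsto_const_nhds.congr' ?_
    filter_upwards [eventually_ge_atTop n] with m hm
    rw [Set.indicator_of_notMem]
    simp only [Set.mem_ofPred_eq, not_lt]
    exact hn.trans (by exact_mod_cast hm)

/-- The Brezis–Kato estimate: testing the equation with `v θ(v)²` bounds the `L^{2*}`-norm of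
`v θ(v)` uniformly in the truncation. -/
theorem exists_eLpNorm_mul_truncWeight_le (hf : Continuous f)
    (hC : ∀ s : ℝ, |f s| ≤ C * |s| ^ (critExp N - 1)) {v : D12 N}
    (hv : ∀ h : D12 N, inner ℝ (D12.grad v) (D12.grad h) = ∫ x, f (v x) * h x) :
    ∃ B : ℝ, ∀ ε : ℝ, 0 < ε → ε ≤ 1 →
      eLpNorm (fun x => v x * truncWeight ε (v x)) (critExpE N) volume ≤ ENNReal.ofReal B := by
  have hp := two_lt_critExp N
  have hC0 := growth_const_nonneg hC
  obtain ⟨K, hK0, hK⟩ := D12.exists_sobolev_nonneg N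
  obtain ⟨hmem, hlim⟩ := tendsto_eLpNorm_indicator_rpow v
  have hlim2 := ((ENNReal.tendsto_toReal ENNReal.zero_ne_top).comp hlim).const_mul (9 * C * K ^ 2)
  rw [ENNReal.toReal_zero, mul_zero] at hlim2
  obtain ⟨Λ, hΛ⟩ := (hlim2.eventually (gt_mem_nhds (show (0 : ℝ) < 1 / 2 by norm_num))).exists
  simp only [Function.comp] at hΛ
  set a : RN N → ℝ := {x | (Λ : ℝ) < |v x|}.indicator fun x => |v x| ^ (critExp N - 2) with ha
  set A : ℝ := (eLpNorm a (ENNReal.ofReal (critExp N / 2).conjExponent) volume).toReal with hA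
  set I : ℝ := ∫ x, |v x| ^ critExp N with hI
  refine ⟨K * √(2 * (9 * C * ((1 + (Λ : ℝ) ^ 2) ^ 2 * I))), fun ε hε hε1 => ?_⟩
  have hθ := contDiff_truncWeight hε
  obtain ⟨w, hw, hgw⟩ := v.exists_comp (g := fun s => s * truncWeight ε s)
    (contDiff_id.mul hθ) (by simp) fun s => (deriv_mul_truncWeight hε hε1 s).1
  obtain ⟨k, hk, hgk⟩ := v.exists_comp (g := fun s => s * truncWeight ε s ^ 2)
    (contDiff_id.mul (hθ.pow 2)) (by simp) fun s => (deriv_mul_truncWeight hε hε1 s).2.1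
  have hint := integrable_abs_rpow_critExp v
  -- the gradient of `v θ(v)` is controlled by the test with `v θ(v)²`
  have h1 : ‖w‖ ^ 2 ≤ 9 * ∫ x, f (v x) * k x := by
    rw [← hv k, L2.inner_def, ← integral_const_mul, D12.sq_norm_eq_integral]
    refine integral_mono_ae ((memLp_two_iff_integrable_sq_norm w.memLp_grad.1).1 w.memLp_grad)
      ((L2.integrable_inner _ _).const_mul 9) ?_
    filter_upwards [hgw, hgk] with x hx1 hx2
    rw [hx1, hx2, norm_smul, inner_smul_right, real_inner_self_eq_norm_sq, mul_pow,
      Real.norm_eq_abs, sq_abs, ← mul_assoc]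
    gcongr
    exact (deriv_mul_truncWeight hε hε1 _).2.2
  have hw2 : MemLp (fun x => w x ^ 2) (ENNReal.ofReal (critExp N / 2)) volume ∧
      (eLpNorm (fun x => w x ^ 2) (ENNReal.ofReal (critExp N / 2)) volume).toReal =
        ‖w.toLCrit‖ ^ 2 := by
    have e : critExpE N / 2 = ENNReal.ofReal (critExp N / 2) := by
      rw [critExpE, ENNReal.ofReal_div_of_pos two_pos, ENNReal.ofReal_ofNat]
    refine ⟨?_, ?_⟩
    · have := w.memLp.norm_rpow_div (q := 2)
      rw [e] at this
      simpa using this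
    · have h := eLpNorm_norm_rpow (p := ENNReal.ofReal (critExp N / 2)) (μ := volume)
        (fun x => w x) two_pos
      have e2 : ENNReal.ofReal (critExp N / 2) * ENNReal.ofReal 2 = critExpE N := by
        rw [← ENNReal.ofReal_mul (by linarith), critExpE]
        congr 1
        ring
      rw [e2] at h
      simp only [Real.norm_eq_abs, Real.rpow_two, sq_abs] at h
      rw [h, Lp.norm_def, ← ENNReal.toReal_rpow, Real.rpow_two]
  have := holderConjugate_critExp_div_two N
  have hhi : Integrable (fun x => |a x| * |w x ^ 2|) volume := by
    simpa [abs_mul] using (MemLp.integrable_mul_of_holder (hmem Λ) hw2.1).abs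
  have h2 : ∫ x, f (v x) * k x ≤ C * ((1 + (Λ : ℝ) ^ 2) ^ 2 * I + A * ‖w.toLCrit‖ ^ 2) := by
    calc ∫ x, f (v x) * k x
        ≤ ∫ x, C * ((1 + (Λ : ℝ) ^ 2) ^ 2 * |v x| ^ critExp N + |a x| * |w x ^ 2|) := by
          have := holderConjugate_critExpE N
          refine integral_mono_ae (MemLp.integrable_mul_of_holder
            (memLp_comp_of_growth hf hC v.memLp.1 v.memLp_rpow) k.memLp)
            (((hint.const_mul _).add hhi).const_mul _) ?_
          filter_upwards [hw, hk] with x hx1 hx2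
          have hθ0 := truncWeight_pos hε (v x)
          have hθ1 := truncWeight_le hε (v x)
          have hb : f (v x) * k x ≤ C * (|v x| ^ critExp N * truncWeight ε (v x) ^ 2) := by
            refine (le_abs_self _).trans ?_
            rw [abs_mul, hx2, abs_mul, abs_of_nonneg (sq_nonneg (truncWeight ε (v x)))]
            calc _ ≤ (C * |v x| ^ (critExp N - 1)) * (|v x| * truncWeight ε (v x) ^ 2) := by
                  gcongr
                  exact hC _
              _ = C * ((|v x| ^ (critExp N - 1) * |v x|) * truncWeight ε (v x) ^ 2) := by ring
              _ = _ := by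
                  rw [← Real.rpow_add_one' (abs_nonneg _) (by linarith), sub_add_cancel]
          refine hb.trans (mul_le_mul_of_nonneg_left ?_ hC0)
          rcases le_or_gt |v x| Λ with h | h
          · have h3 : truncWeight ε (v x) ^ 2 ≤ (1 + (Λ : ℝ) ^ 2) ^ 2 := by
              have : v x ^ 2 ≤ (Λ : ℝ) ^ 2 := by
                rw [← sq_abs]
                gcongr
              gcongr
              linarith
            calc _ ≤ |v x| ^ critExp N * (1 + (Λ : ℝ) ^ 2) ^ 2 := by gcongr
              _ = (1 + (Λ : ℝ) ^ 2) ^ 2 * |v x| ^ critExp N := mul_comm _ _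
              _ ≤ _ := le_add_of_nonneg_right (by positivity)
          · have h3 : a x = |v x| ^ (critExp N - 2) :=
              Set.indicator_of_mem (s := {x | (Λ : ℝ) < |v x|}) h _
            have h4 : |v x| ^ critExp N = |v x| ^ (critExp N - 2) * v x ^ 2 := by
              rw [← sq_abs, ← Real.rpow_natCast |v x| 2, ← Real.rpow_add' (abs_nonneg _)]
              · norm_num
              · norm_num
                linarith
            rw [h3, hx1, abs_of_nonneg (by positivity : 0 ≤ |v x| ^ (critExp N - 2)),
              abs_of_nonneg (sq_nonneg (v x * truncWeight ε (v x))), mul_pow]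
            nth_rw 1 [h4]
            rw [← mul_assoc]
            exact le_add_of_nonneg_left (by positivity)
      _ = C * ((1 + (Λ : ℝ) ^ 2) ^ 2 * I + ∫ x, |a x| * |w x ^ 2|) := by
          rw [integral_const_mul, integral_add (hint.const_mul _) hhi, integral_const_mul]
      _ ≤ _ := by
          gcongr
          have := integral_abs_mul_le_of_holder (hmem Λ) hw2.1
          rwa [hw2.2] at this
  have hA0 : 0 ≤ A := ENNReal.toReal_nonneg
  have hI0 : 0 ≤ I := integral_nonneg fun x => by positivity
  have h3 : ‖w‖ ^ 2 ≤ 2 * (9 * C * ((1 + (Λ : ℝ) ^ 2) ^ 2 * I)) := by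
    have h4 : 9 * C * (A * ‖w.toLCrit‖ ^ 2) ≤ 1 / 2 * ‖w‖ ^ 2 := by
      calc _ ≤ 9 * C * (A * (K * ‖w‖) ^ 2) := by
            gcongr
            exact hK w
        _ = (9 * C * K ^ 2 * A) * ‖w‖ ^ 2 := by ring
        _ ≤ _ := by gcongr
    linarith
  have h5 : eLpNorm (fun x => v x * truncWeight ε (v x)) (critExpE N) volume =
      ENNReal.ofReal ‖w.toLCrit‖ := by
    rw [Lp.norm_def, ENNReal.ofReal_toReal (Lp.eLpNorm_ne_top _)]
    exact (eLpNorm_congr_ae hw).symm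
  rw [h5]
  refine ENNReal.ofReal_le_ofReal ((hK w).trans ?_)
  gcongr
  exact Real.le_sqrt_of_sq_le h3

/-- For a weak solution `v ∈ 𝒟^{1,2}` the power `|v|^{2*-1}`, and hence `f(v)`, lies in `L²`: by
the Brezis–Kato estimate and Fatou's lemma `v (1 + v²) ∈ L^{2*}`, and
`|v|^{2(2*-1)} ≤ (|v| (1 + v²))^{2*}`. -/
theorem memLp_two_rpow_of_weak_solution (hf : Continuous f)
    (hC : ∀ s : ℝ, |f s| ≤ C * |s| ^ (critExp N - 1)) {v : D12 N}
    (hv : ∀ h : D12 N, inner ℝ (D12.grad v) (D12.grad h) = ∫ x, f (v x) * h x) :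
    MemLp (fun x => |v x| ^ (critExp N - 1)) 2 volume := by
  have hp := two_lt_critExp N
  obtain ⟨B, hB⟩ := exists_eLpNorm_mul_truncWeight_le hf hC hv
  have hmeas (ε : ℝ) (hε : 0 < ε) :
      AEStronglyMeasurable (fun x => v x * truncWeight ε (v x)) volume :=
    (continuous_id.mul (contDiff_truncWeight hε).continuous).comp_aestronglyMeasurable v.memLp.1
  have hmeas' : AEStronglyMeasurable (fun x => v x * (1 + v x ^ 2)) volume :=
    (by fun_prop : Continuous fun s : ℝ => s * (1 + s ^ 2)).comp_aestronglyMeasurable v.memLp.1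
  have hmem : MemLp (fun x => v x * (1 + v x ^ 2)) (critExpE N) volume := by
    refine ⟨hmeas', ?_⟩
    have h := Lp.eLpNorm_lim_le_liminf_eLpNorm (μ := (volume : Measure (RN N))) (p := critExpE N)
      (f := fun (n : ℕ) x => v x * truncWeight (1 / ((n : ℝ) + 1)) (v x))
      (fun n => hmeas _ (by positivity)) (fun x => v x * (1 + v x ^ 2)) (ae_of_all _ fun x => by
        have h1 : Tendsto (fun n : ℕ => 1 + 1 / ((n : ℝ) + 1) * v x ^ 2) atTop
            (𝓝 (1 + 0 * v x ^ 2)) :=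
          (tendsto_one_div_add_atTop_nhds_zero_nat.mul_const _).const_add 1
        rw [zero_mul, add_zero] at h1
        have h2 := ((tendsto_const_nhds (x := 1 + v x ^ 2)).div h1 one_ne_zero).const_mul (v x)
        rwa [div_one] at h2)
    refine h.trans_lt (lt_of_le_of_lt ?_ (ENNReal.ofReal_lt_top (r := B)))
    refine liminf_le_of_le (by isBoundedDefault) fun b hb => ?_
    obtain ⟨n, hn⟩ := hb.exists
    refine hn.trans (hB _ (by positivity) ?_)
    rw [div_le_one (by positivity)]
    linarith [Nat.cast_nonneg (α := ℝ) n]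
  have hint := hmem.integrable_norm_rpow (critExpE_ne_zero N) (critExpE_ne_top N)
  rw [toReal_critExpE] at hint
  have hm : AEStronglyMeasurable (fun x => |v x| ^ (critExp N - 1)) volume :=
    (continuous_abs.rpow_const fun _ => Or.inr (by linarith)).comp_aestronglyMeasurable v.memLp.1
  rw [memLp_two_iff_integrable_sq hm]
  refine hint.mono' (hm.pow 2) (ae_of_all _ fun x => ?_)
  have hb : |v x| ≤ 1 + v x ^ 2 := by nlinarith [sq_abs (v x), sq_nonneg (|v x| - 1)]
  have h1 : (1 : ℝ) ≤ 1 + v x ^ 2 := by nlinarith [sq_nonneg (v x)]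
  rw [Real.norm_of_nonneg (by positivity), Real.norm_eq_abs, abs_mul,
    abs_of_nonneg (by positivity : 0 ≤ 1 + v x ^ 2), Real.mul_rpow (abs_nonneg _) (by positivity)]
  have e : (|v x| ^ (critExp N - 1)) ^ 2 = |v x| ^ critExp N * |v x| ^ (critExp N - 2) := by
    rw [← Real.rpow_natCast, ← Real.rpow_mul (abs_nonneg _), ← Real.rpow_add' (abs_nonneg _)]
    · congr 1
      push_cast
      ring
    · linarith
  rw [e]
  gcongr
  calc |v x| ^ (critExp N - 2) ≤ (1 + v x ^ 2) ^ (critExp N - 2) := by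
        refine Real.rpow_le_rpow (abs_nonneg _) hb (by linarith)
    _ ≤ (1 + v x ^ 2) ^ critExp N := Real.rpow_le_rpow_of_exponent_le h1 (by linarith)

end

/-! ### Cutoff functions -/

/-- `η` is a cutoff function between the balls of radius `R` and `2R`, with Lipschitz constant
`L / R`. -/
structure IsCutoff {N : ℕ} (L R : ℝ) (η : RN N → ℝ) : Prop where
  isTest : IsTest η
  nonneg : ∀ x, 0 ≤ η x
  le_one : ∀ x, η x ≤ 1
  eq_one : ∀ x, ‖x‖ ≤ R → η x = 1
  eq_zero : ∀ x, 2 * R ≤ ‖x‖ → η x = 0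
  lipschitz : ∀ x y, |η x - η y| ≤ L / R * ‖x - y‖
  gradient_le : ∀ x, ‖gradient η x‖ ≤ L / R
  gradient_eq_zero_of_lt : ∀ x, ‖x‖ < R → gradient η x = 0
  gradient_eq_zero_of_gt : ∀ x, 2 * R < ‖x‖ → gradient η x = 0

theorem norm_gradient {N : ℕ} (φ : RN N → ℝ) (x : RN N) : ‖gradient φ x‖ = ‖fderiv ℝ φ x‖ := by
  simp [gradient]

theorem gradient_eq_zero_of_eventuallyEq_const {N : ℕ} {φ : RN N → ℝ} {x : RN N} {c : ℝ}
    (h : φ =ᶠ[𝓝 x] fun _ => c) : gradient φ x = 0 := by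
  rw [← norm_eq_zero, norm_gradient, h.fderiv_eq]
  simp

theorem exists_isCutoff (N : ℕ) :
    ∃ L : ℝ, 0 ≤ L ∧ ∀ R : ℝ, 0 < R → ∃ η : RN N → ℝ, IsCutoff L R η := by
  let b : ContDiffBump (0 : RN N) :=
    { rIn := 1, rOut := 2, rIn_pos := one_pos, rIn_lt_rOut := one_lt_two }
  obtain ⟨L, hL⟩ := (b.contDiff (n := 1)).lipschitzWith_of_hasCompactSupport b.hasCompactSupport
    one_ne_zero
  refine ⟨L, L.2, fun R hR => ?_⟩
  have hn (x : RN N) : ‖R⁻¹ • x‖ = ‖x‖ / R := by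
    rw [norm_smul, norm_inv, Real.norm_of_nonneg hR.le, inv_mul_eq_div]
  have hone (x : RN N) (hx : ‖x‖ ≤ R) : b (R⁻¹ • x) = 1 := by
    refine b.one_of_mem_closedBall ?_
    rw [mem_closedBall_zero_iff, hn]
    exact (div_le_one hR).2 hx
  have hzero (x : RN N) (hx : 2 * R ≤ ‖x‖) : b (R⁻¹ • x) = 0 := by
    refine b.zero_of_le_dist ?_
    rw [dist_zero_right, hn]
    exact (le_div_iff₀ hR).2 hx
  have hlip (x y : RN N) : |b (R⁻¹ • x) - b (R⁻¹ • y)| ≤ L / R * ‖x - y‖ := by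
    have := hL.norm_sub_le (R⁻¹ • x) (R⁻¹ • y)
    rw [← smul_sub, hn] at this
    calc _ ≤ L * (‖x - y‖ / R) := this
      _ = _ := by ring
  refine ⟨fun x => b (R⁻¹ • x), ⟨b.contDiff.comp (by fun_prop),
    b.hasCompactSupport.comp_smul (inv_ne_zero hR.ne')⟩, fun x => b.nonneg, fun x => b.le_one,
    hone, hzero, hlip, fun x => ?_, fun x hx => ?_, fun x hx => ?_⟩
  · rw [norm_gradient]
    have hl : LipschitzWith (L / ⟨R, hR.le⟩) fun x : RN N => b (R⁻¹ • x) :=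
      LipschitzWith.of_dist_le_mul fun x y => by
        rw [Real.dist_eq, dist_eq_norm]
        exact hlip x y
    exact norm_fderiv_le_of_lipschitz ℝ hl
  · refine gradient_eq_zero_of_eventuallyEq_const (c := 1) ?_
    filter_upwards [continuous_norm.continuousAt.eventually (gt_mem_nhds hx)] with y hy
    exact hone y hy.le
  · refine gradient_eq_zero_of_eventuallyEq_const (c := 0) ?_
    filter_upwards [continuous_norm.continuousAt.eventually (lt_mem_nhds hx)] with y hy
    exact hzero y hy.le

theorem lintegral_dil {N : ℕ} {t : ℝ} (ht : 0 < t) {g : RN N → ℝ≥0∞} (hg : Measurable g) :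
    ∫⁻ x, g (t⁻¹ • x) = ENNReal.ofReal (t ^ N) * ∫⁻ x, g x := by
  rw [← lintegral_map hg (by fun_prop : Measurable fun x : RN N => t⁻¹ • x), map_dil ht,
    lintegral_smul_measure, smul_eq_mul]

theorem measurableSet_le_norm {N : ℕ} (R : ℝ) : MeasurableSet {x : RN N | R ≤ ‖x‖} :=
  measurableSet_le measurable_const measurable_norm

/-- Under a dilation the integral against a cutoff function scales like the full integral, up to
an error produced by the region where the cutoff function is not constant. -/
theorem IsCutoff.abs_integral_dil_sub_le {N : ℕ} {L R : ℝ} {η : RN N → ℝ} (hη : IsCutoff L R η)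
    (hL : 0 ≤ L) (hR : 0 < R) {g : RN N → ℝ} (hg : Integrable g volume) {t : ℝ} (ht1 : 1 ≤ t)
    (ht2 : t ≤ 2) :
    |(∫ x, η x * g (t⁻¹ • x)) - t ^ N * ∫ x, η x * g x| ≤
      2 ^ N * (2 * L) * (∫ x in {x | R / 2 ≤ ‖x‖}, |g x|) * (t - 1) := by
  have ht0 : 0 < t := by linarith
  have hηc : Continuous η := hη.isTest.1.continuous
  have hcut {φ : RN N → ℝ} (hφ : Continuous φ) (hφ1 : ∀ x, ‖φ x‖ ≤ 1) :
      Integrable (fun x => φ x * g x) volume :=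
    hg.bdd_mul (c := 1) hφ.aestronglyMeasurable (ae_of_all _ hφ1)
  have hb (x : RN N) : ‖η x‖ ≤ 1 := by
    rw [Real.norm_of_nonneg (hη.nonneg x)]
    exact hη.le_one x
  have e1 : ∫ x, η x * g (t⁻¹ • x) = t ^ N * ∫ x, η (t • x) * g x := by
    rw [← integral_dil ht0 fun x => η (t • x) * g x]
    simp only [smul_inv_smul₀ ht0.ne']
  rw [e1, ← mul_sub, ← integral_sub (hcut (φ := fun x => η (t • x)) (by fun_prop) fun x => hb _)
    (hcut hηc hb)]
  have hpt (x : RN N) : ‖η (t • x) * g x - η x * g x‖ ≤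
      {x | R / 2 ≤ ‖x‖}.indicator (fun x => 2 * L * (t - 1) * |g x|) x := by
    rw [← sub_mul, norm_mul, Real.norm_eq_abs, Real.norm_eq_abs]
    have hnt : ‖t • x‖ = t * ‖x‖ := by rw [norm_smul, Real.norm_of_nonneg ht0.le]
    have hx0 := norm_nonneg x
    by_cases hx : R / 2 ≤ ‖x‖
    · rw [Set.indicator_of_mem (by exact hx)]
      refine mul_le_mul_of_nonneg_right ?_ (abs_nonneg _)
      rcases le_or_gt (2 * R) ‖x‖ with h | h
      · rw [hη.eq_zero x h, hη.eq_zero (t • x) (by rw [hnt]; nlinarith), sub_zero, abs_zero]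
        have : 0 ≤ t - 1 := by linarith
        positivity
      · refine (hη.lipschitz _ _).trans ?_
        have e : ‖t • x - x‖ = (t - 1) * ‖x‖ := by
          rw [show t • x - x = (t - 1) • x by rw [sub_smul, one_smul], norm_smul,
            Real.norm_of_nonneg (by linarith)]
        rw [e]
        have h1 : 0 ≤ t - 1 := by linarith
        calc L / R * ((t - 1) * ‖x‖) ≤ L / R * ((t - 1) * (2 * R)) := by gcongr
          _ = 2 * L * (t - 1) := by field_simp
    · rw [Set.indicator_of_notMem (by exact hx)]
      rw [not_le] at hx
      rw [hη.eq_one x (by linarith), hη.eq_one (t • x) (by rw [hnt]; nlinarith)]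
      simp
  have hmain : |∫ x, (η (t • x) * g x - η x * g x)| ≤
      2 * L * (t - 1) * ∫ x in {x | R / 2 ≤ ‖x‖}, |g x| := by
    have h := norm_integral_le_of_norm_le
      (((hg.abs.const_mul (2 * L * (t - 1))).indicator (measurableSet_le_norm (R / 2))))
      (ae_of_all _ hpt)
    rwa [integral_indicator (measurableSet_le_norm _), integral_const_mul] at h
  rw [abs_mul, abs_of_nonneg (by positivity)]
  have hI : 0 ≤ ∫ x in {x | R / 2 ≤ ‖x‖}, |g x| := integral_nonneg fun x => abs_nonneg _
  have h1 : 0 ≤ t - 1 := by linarith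
  calc t ^ N * _ ≤ 2 ^ N * (2 * L * (t - 1) * ∫ x in {x | R / 2 ≤ ‖x‖}, |g x|) := by gcongr
    _ = _ := by ring

/-! ### Dilation increments on balls -/

/-- The fundamental theorem of calculus along the ray through `x`, and the Cauchy–Schwarz
inequality. -/
theorem sq_sub_smul_le {N : ℕ} {φ : RN N → ℝ} (hφ : ContDiff ℝ ∞ φ) {a : ℝ} (ha : a < 1)
    (x : RN N) :
    (φ (a • x) - φ x) ^ 2 ≤
      ‖x‖ ^ 2 * (1 - a) * ∫ s in a..1, ‖gradient φ (s • x)‖ ^ 2 := by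
  have hgc : Continuous (gradient φ) :=
    (InnerProductSpace.toDual ℝ (RN N)).symm.continuous.comp (hφ.continuous_fderiv (by simp))
  set γ : ℝ → ℝ := fun s => ‖gradient φ (s • x)‖ with hγ
  have hγc : Continuous γ := by fun_prop
  set J : ℝ := ∫ s in a..1, γ s with hJ
  have h1 : |φ (a • x) - φ x| ≤ ‖x‖ * J := by
    have hd (s : ℝ) : HasDerivAt (fun s : ℝ => φ (s • x)) (fderiv ℝ φ (s • x) x) s := by
      have h := ((hφ.differentiable (by simp)) (s • x)).hasFDerivAt.comp_hasDerivAt s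
        ((hasDerivAt_id s).smul_const x)
      simp only [id, one_smul] at h
      exact h
    have hfc : Continuous fun s : ℝ => fderiv ℝ φ (s • x) x := by
      have := hφ.continuous_fderiv (n := ∞) (by simp)
      fun_prop
    have hint := intervalIntegral.integral_eq_sub_of_hasDerivAt (a := a) (b := 1)
      (fun s _ => hd s) (hfc.intervalIntegrable _ _)
    rw [one_smul] at hint
    rw [abs_sub_comm, ← hint, hJ, ← intervalIntegral.integral_const_mul]
    refine intervalIntegral.norm_integral_le_of_norm_le (μ := volume)
      (f := fun s => fderiv ℝ φ (s • x) x) (g := fun s => ‖x‖ * γ s) ha.le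
      (ae_of_all _ fun s _ => ?_) ((hγc.const_mul _).intervalIntegrable _ _)
    rw [mul_comm, hγ]
    simp only [norm_gradient]
    exact (fderiv ℝ φ (s • x)).le_opNorm x
  have h2 : J ^ 2 ≤ (1 - a) * ∫ s in a..1, γ s ^ 2 := by
    -- Cauchy–Schwarz, from the nonnegative variance of `γ` on `[a, 1]`
    have h0 : 0 ≤ ∫ s in a..1, ((1 - a) * γ s - J) ^ 2 :=
      intervalIntegral.integral_nonneg ha.le fun s _ => sq_nonneg _
    have e : ∫ s in a..1, ((1 - a) * γ s - J) ^ 2 =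
        (1 - a) ^ 2 * (∫ s in a..1, γ s ^ 2) - 2 * (1 - a) * J * J + (1 - a) * J ^ 2 := by
      have : (fun s => ((1 - a) * γ s - J) ^ 2) = fun s =>
          (1 - a) ^ 2 * γ s ^ 2 - 2 * (1 - a) * J * γ s + J ^ 2 := by
        funext s
        ring
      rw [this, intervalIntegral.integral_add, intervalIntegral.integral_sub,
        intervalIntegral.integral_const_mul, intervalIntegral.integral_const_mul,
        intervalIntegral.integral_const, smul_eq_mul]
      all_goals exact Continuous.intervalIntegrable (by fun_prop) _ _
    rw [e] at h0
    have h3 : 0 ≤ (1 - a) * ((1 - a) * (∫ s in a..1, γ s ^ 2) - J ^ 2) := by linarith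
    have h4 := nonneg_of_mul_nonneg_right h3 (by linarith)
    linarith
  calc (φ (a • x) - φ x) ^ 2 = |φ (a • x) - φ x| ^ 2 := (sq_abs _).symm
    _ ≤ (‖x‖ * J) ^ 2 := by gcongr
    _ = ‖x‖ ^ 2 * J ^ 2 := by ring
    _ ≤ ‖x‖ ^ 2 * ((1 - a) * ∫ s in a..1, γ s ^ 2) := by gcongr
    _ = _ := by ring

theorem eLpNorm_indicator_dil_sub_le_of_test {N : ℕ} {φ : RN N → ℝ} (hφ : IsTest φ) {R t : ℝ}
    (hR : 0 ≤ R) (ht1 : 1 < t) (ht2 : t ≤ 2) :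
    eLpNorm ((Metric.closedBall (0 : RN N) R).indicator fun x => φ (t⁻¹ • x) - φ x) 2 volume ≤
      ENNReal.ofReal (√(2 ^ N) * R * (t - 1)) * eLpNorm (gradient φ) 2 volume := by
  have ht0 : 0 < t := by linarith
  set a : ℝ := t⁻¹ with ha
  have ha1 : a < 1 := inv_lt_one_of_one_lt₀ ht1
  have ha2 : 1 / 2 ≤ a := by
    rw [ha, one_div]
    exact inv_anti₀ ht0 ht2
  have hat : 1 - a ≤ t - 1 := by
    have : t * a = 1 := mul_inv_cancel₀ ht0.ne'
    nlinarith
  have hgc : Continuous (gradient φ) :=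
    (InnerProductSpace.toDual ℝ (RN N)).symm.continuous.comp (hφ.1.continuous_fderiv (by simp))
  set G : ℝ≥0∞ := ∫⁻ x, ENNReal.ofReal (‖gradient φ x‖ ^ 2) with hG
  have hpt (x : RN N) (hx : x ∈ Metric.closedBall (0 : RN N) R) :
      ENNReal.ofReal ((φ (a • x) - φ x) ^ 2) ≤ ENNReal.ofReal (R ^ 2 * (1 - a)) *
        ∫⁻ s in Set.Ioc a 1, ENNReal.ofReal (‖gradient φ (s • x)‖ ^ 2) := by
    rw [mem_closedBall_zero_iff] at hx
    have hcont : Continuous fun s : ℝ => ‖gradient φ (s • x)‖ ^ 2 := by fun_prop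
    rw [← ofReal_integral_eq_lintegral_ofReal hcont.integrableOn_Ioc
      (ae_of_all _ fun s => by positivity), ← ENNReal.ofReal_mul
      (mul_nonneg (sq_nonneg _) (by linarith)), ← intervalIntegral.integral_of_le ha1.le]
    refine ENNReal.ofReal_le_ofReal ((sq_sub_smul_le hφ.1 ha1 x).trans ?_)
    have h0 : 0 ≤ ∫ s in a..1, ‖gradient φ (s • x)‖ ^ 2 :=
      intervalIntegral.integral_nonneg ha1.le fun s _ => by positivity
    have h1 : 0 ≤ 1 - a := by linarith
    gcongr
  have hslice (s : ℝ) (hs : s ∈ Set.Ioc a 1) :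
      ∫⁻ x, ENNReal.ofReal (‖gradient φ (s • x)‖ ^ 2) ≤ ENNReal.ofReal (2 ^ N) * G := by
    have hs0 : 0 < s := by linarith [hs.1]
    have h := lintegral_dil (N := N) (inv_pos.2 hs0)
      (g := fun x => ENNReal.ofReal (‖gradient φ x‖ ^ 2)) (by fun_prop)
    simp only [inv_inv] at h
    rw [h]
    gcongr
    rw [← inv_inv (2 : ℝ)]
    refine inv_anti₀ (by norm_num) ?_
    rw [← one_div]
    exact ha2.trans hs.1.le
  have hkey : ∫⁻ x in Metric.closedBall (0 : RN N) R, ENNReal.ofReal ((φ (a • x) - φ x) ^ 2) ≤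
      ENNReal.ofReal ((√(2 ^ N) * R * (t - 1)) ^ 2) * G := by
    calc _ ≤ ∫⁻ x in Metric.closedBall (0 : RN N) R, ENNReal.ofReal (R ^ 2 * (1 - a)) *
          ∫⁻ s in Set.Ioc a 1, ENNReal.ofReal (‖gradient φ (s • x)‖ ^ 2) :=
          setLIntegral_mono' measurableSet_closedBall hpt
      _ ≤ ∫⁻ x, ENNReal.ofReal (R ^ 2 * (1 - a)) *
          ∫⁻ s in Set.Ioc a 1, ENNReal.ofReal (‖gradient φ (s • x)‖ ^ 2) :=
          setLIntegral_le_lintegral _ _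
      _ = ENNReal.ofReal (R ^ 2 * (1 - a)) * ∫⁻ s in Set.Ioc a 1,
          ∫⁻ x, ENNReal.ofReal (‖gradient φ (s • x)‖ ^ 2) := by
          rw [lintegral_const_mul' _ _ ENNReal.ofReal_ne_top, lintegral_lintegral_swap]
          have : Continuous fun z : RN N × ℝ => ENNReal.ofReal (‖gradient φ (z.2 • z.1)‖ ^ 2) :=
            ENNReal.continuous_ofReal.comp (by fun_prop)
          exact this.aemeasurable
      _ ≤ ENNReal.ofReal (R ^ 2 * (1 - a)) * ∫⁻ s in Set.Ioc a 1, ENNReal.ofReal (2 ^ N) * G := by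
          gcongr 1
          exact setLIntegral_mono' measurableSet_Ioc hslice
      _ = ENNReal.ofReal (R ^ 2 * (1 - a) * 2 ^ N * (1 - a)) * G := by
          have h1 : 0 ≤ 1 - a := by linarith
          rw [setLIntegral_const, Real.volume_Ioc,
            ENNReal.ofReal_mul (p := R ^ 2 * (1 - a) * 2 ^ N) (by positivity),
            ENNReal.ofReal_mul (p := R ^ 2 * (1 - a)) (q := 2 ^ N) (by positivity)]
          ring
      _ ≤ _ := by
          gcongr
          rw [mul_pow, mul_pow, Real.sq_sqrt (by positivity)]
          have h1 : (1 - a) * (1 - a) ≤ (t - 1) ^ 2 := by nlinarith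
          calc R ^ 2 * (1 - a) * 2 ^ N * (1 - a) = 2 ^ N * R ^ 2 * ((1 - a) * (1 - a)) := by ring
            _ ≤ _ := by gcongr
  have e2 {E : Type} [NormedAddCommGroup E] (g : RN N → E) (μ : Measure (RN N)) :
      eLpNorm g 2 μ = (∫⁻ x, ENNReal.ofReal (‖g x‖ ^ 2) ∂μ) ^ (1 / 2 : ℝ) := by
    rw [eLpNorm_eq_lintegral_rpow_enorm_toReal two_ne_zero (by simp)]
    simp only [ENNReal.toReal_ofNat]
    congr 1
    refine lintegral_congr fun x => ?_
    rw [ENNReal.ofReal_pow (norm_nonneg _), ofReal_norm, ENNReal.rpow_ofNat]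
  rw [eLpNorm_indicator_eq_eLpNorm_restrict measurableSet_closedBall, e2, e2]
  simp only [Real.norm_eq_abs, sq_abs]
  have hc : 0 ≤ √(2 ^ N) * R * (t - 1) := by
    have : 0 ≤ t - 1 := by linarith
    positivity
  calc _ ≤ (ENNReal.ofReal ((√(2 ^ N) * R * (t - 1)) ^ 2) * G) ^ (1 / 2 : ℝ) := by gcongr
    _ = _ := by
      rw [ENNReal.mul_rpow_of_nonneg _ _ (by norm_num),
        ENNReal.ofReal_rpow_of_nonneg (by positivity) (by norm_num), ← Real.sqrt_eq_rpow,
        Real.sqrt_sq hc]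

/-! ### Estimates in `𝒟^{1,2}` -/

theorem gradient_mul {N : ℕ} {φ χ : RN N → ℝ} (hφ : Differentiable ℝ φ) (hχ : Differentiable ℝ χ)
    (x : RN N) : gradient (fun y => φ y * χ y) x = φ x • gradient χ x + χ x • gradient φ x := by
  have h : fderiv ℝ (fun y => φ y * χ y) x = φ x • fderiv ℝ χ x + χ x • fderiv ℝ φ x :=
    fderiv_fun_mul (hφ x) (hχ x)
  simp [gradient, h]

section

variable {N : ℕ} [hN : Fact (2 < N)] {f : ℝ → ℝ} {C : ℝ}

variable (N) in
theorem holderTriple_critExpE : ENNReal.HolderTriple (critExpE N) (ENNReal.ofReal N) 2 := by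
  have h2 := two_lt_dim N
  refine ⟨?_⟩
  rw [critExpE, ← ENNReal.ofReal_inv_of_pos (critExp_pos N),
    ← ENNReal.ofReal_inv_of_pos (by linarith),
    ← ENNReal.ofReal_add (inv_nonneg.2 (critExp_pos N).le) (by positivity),
    ← ENNReal.ofReal_ofNat 2, ← ENNReal.ofReal_inv_of_pos two_pos, critExp]
  congr 1
  have : (N : ℝ) - 2 ≠ 0 := by linarith
  field_simp
  ring

/-- The product rule in `𝒟^{1,2}` for multiplication by a test function. -/
theorem D12.exists_test_mul (u : D12 N) {η : RN N → ℝ} (hη : IsTest η) :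
    ∃ w : D12 N, w =ᵐ[volume] (fun x => η x * u x) ∧
      grad w =ᵐ[volume] fun x => η x • grad u x + u x • gradient η x := by
  obtain ⟨φ, hφ, h1, h2, -⟩ := exists_test_seq_ae u
  have hηd : Differentiable ℝ η := hη.1.differentiable (by simp)
  have hηm : AEStronglyMeasurable η volume := hη.1.continuous.aestronglyMeasurable
  obtain ⟨M, hM⟩ := hη.1.continuous.bounded_above_of_compact_support hη.2
  have hM0 : 0 ≤ M := (norm_nonneg _).trans (hM 0)
  have hGm : MemLp (gradient η) (ENNReal.ofReal N) volume := memLp_gradient_test hη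
  have htr := holderTriple_critExpE N
  have hmem1 : MemLp (fun x => η x * u x) (critExpE N) volume := by
    refine u.memLp.of_le_mul (c := M) (hηm.mul u.memLp.1) (ae_of_all _ fun x => ?_)
    rw [norm_mul]
    gcongr
    exact hM x
  have hsm {z : RN N → RN N} (hz : AEStronglyMeasurable z volume) :
      eLpNorm (fun x => η x • z x) 2 volume ≤ ENNReal.ofReal M * eLpNorm z 2 volume := by
    refine eLpNorm_le_mul_eLpNorm_of_ae_le_mul (ae_of_all _ fun x => ?_) _
    rw [norm_smul]
    gcongr
    exact hM x
  have hmem2 : MemLp (fun x => η x • grad u x + u x • gradient η x) 2 volume := by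
    refine MemLp.add ?_ (hGm.smul u.memLp)
    exact ⟨hηm.smul u.memLp_grad.1, (hsm u.memLp_grad.1).trans_lt
      (ENNReal.mul_lt_top ENNReal.ofReal_lt_top u.memLp_grad.2)⟩
  refine exists_of_tendsto hmem1 hmem2 (φ := fun n x => η x * φ n x)
    (fun n => ⟨hη.1.mul (hφ n).1, hη.2.mul_right⟩) ?_ ?_
  · have hle (n : ℕ) : eLpNorm (fun x => η x * φ n x - η x * u x) (critExpE N) volume ≤
        ENNReal.ofReal M * eLpNorm (fun x => φ n x - u x) (critExpE N) volume := by
      refine eLpNorm_le_mul_eLpNorm_of_ae_le_mul (ae_of_all _ fun x => ?_) _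
      rw [← mul_sub, norm_mul]
      gcongr
      exact hM x
    refine tendsto_of_tendsto_of_tendsto_of_le_of_le tendsto_const_nhds ?_ (fun _ => zero_le)
      hle
    simpa using ENNReal.Tendsto.const_mul h1 (Or.inr ENNReal.ofReal_ne_top)
  · have hm1 (n : ℕ) : AEStronglyMeasurable (fun x => φ n x - u x) volume :=
      (hφ n).1.continuous.aestronglyMeasurable.sub u.memLp.1
    have hm2 (n : ℕ) : AEStronglyMeasurable (fun x => gradient (φ n) x - grad u x) volume :=
      (memLp_gradient_test (hφ n) (q := 2)).1.sub u.memLp_grad.1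
    have hle (n : ℕ) : eLpNorm (fun x => gradient (fun y => η y * φ n y) x -
          (η x • grad u x + u x • gradient η x)) 2 volume ≤
        ENNReal.ofReal M * eLpNorm (fun x => gradient (φ n) x - grad u x) 2 volume +
          eLpNorm (fun x => φ n x - u x) (critExpE N) volume *
            eLpNorm (gradient η) (ENNReal.ofReal N) volume := by
      have e : (fun x => gradient (fun y => η y * φ n y) x -
            (η x • grad u x + u x • gradient η x)) =
          (fun x => η x • (gradient (φ n) x - grad u x)) +
            (fun x => φ n x - u x) • gradient η := by
        funext x
        rw [gradient_mul hηd ((hφ n).1.differentiable (by simp)), Pi.add_apply, Pi.smul_apply',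
          smul_sub, sub_smul]
        abel
      rw [e]
      refine (eLpNorm_add_le (hηm.smul (hm2 n)) ((hm1 n).smul hGm.1) one_le_two).trans ?_
      exact add_le_add (hsm (hm2 n)) (eLpNorm_smul_le_mul_eLpNorm hGm.1 (hm1 n))
    refine tendsto_of_tendsto_of_tendsto_of_le_of_le tendsto_const_nhds ?_ (fun _ => zero_le)
      hle
    simpa using (ENNReal.Tendsto.const_mul h2 (Or.inr ENNReal.ofReal_ne_top)).add
      (ENNReal.Tendsto.mul_const h1 (Or.inr hGm.2.ne))

/-- On a ball, the increments `u(·/t) - u` are `O(t - 1)` in `L²`. -/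
theorem D12.eLpNorm_indicator_dilate_sub_le (u : D12 N) {R t : ℝ} (hR : 0 ≤ R) (ht1 : 1 < t)
    (ht2 : t ≤ 2) :
    eLpNorm ((Metric.closedBall (0 : RN N) R).indicator (dilate t u - u : D12 N)) 2 volume ≤
      ENNReal.ofReal (√(2 ^ N) * R * (t - 1) * ‖u‖) := by
  have ht0 : 0 < t := by linarith
  obtain ⟨φ, hφ, -, h2, hae⟩ := exists_test_seq_ae u
  have hae' : ∀ᵐ x, Tendsto (fun n => φ n (t⁻¹ • x)) atTop (𝓝 (u (t⁻¹ • x))) :=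
    (Measure.quasiMeasurePreserving_smul volume (inv_ne_zero ht0.ne')).ae hae
  have hm2 (n : ℕ) : AEStronglyMeasurable (fun x => gradient (φ n) x - grad u x) volume :=
    (memLp_gradient_test (hφ n) (q := 2)).1.sub u.memLp_grad.1
  have hlim : Tendsto (fun n => ENNReal.ofReal (√(2 ^ N) * R * (t - 1)) *
      (eLpNorm (fun x => gradient (φ n) x - grad u x) 2 volume + eLpNorm (grad u) 2 volume)) atTop
      (𝓝 (ENNReal.ofReal (√(2 ^ N) * R * (t - 1) * ‖u‖))) := by
    have h := ENNReal.Tendsto.const_mul (a := ENNReal.ofReal (√(2 ^ N) * R * (t - 1)))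
      (h2.add_const (eLpNorm (grad u) 2 volume)) (Or.inr ENNReal.ofReal_ne_top)
    have hc : 0 ≤ √(2 ^ N) * R * (t - 1) := by
      have : 0 ≤ t - 1 := by linarith
      positivity
    have e : eLpNorm (grad u) 2 volume = ENNReal.ofReal ‖u‖ := by
      rw [norm_eq, Lp.norm_def, ENNReal.ofReal_toReal u.memLp_grad.2.ne]
    rw [zero_add] at h
    rwa [ENNReal.ofReal_mul hc, ← e]
  refine (Lp.eLpNorm_lim_le_liminf_eLpNorm
    (f := fun n => (Metric.closedBall (0 : RN N) R).indicator fun x => φ n (t⁻¹ • x) - φ n x)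
    (fun n => ?_) _ ?_).trans ?_
  · have := (hφ n).1.continuous
    exact (by fun_prop : Continuous fun x => φ n (t⁻¹ • x) - φ n x).aestronglyMeasurable.indicator
      measurableSet_closedBall
  · filter_upwards [hae, hae', coeFn_sub (dilate t u) u, dilate_ae ht0 u] with x h1 h2 h3 h4
    by_cases hx : x ∈ Metric.closedBall (0 : RN N) R
    · simp only [Set.indicator_of_mem hx, h3, h4]
      exact h2.sub h1
    · simp only [Set.indicator_of_notMem hx]
      exact tendsto_const_nhds
  · rw [← hlim.liminf_eq]
    refine liminf_le_liminf (Eventually.of_forall fun n => ?_)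
    refine (eLpNorm_indicator_dil_sub_le_of_test (hφ n) hR ht1 ht2).trans ?_
    gcongr
    have e : gradient (φ n) = (fun x => gradient (φ n) x - grad u x) + grad u := by
      funext x
      simp
    conv_lhs => rw [e]
    exact eLpNorm_add_le (hm2 n) u.memLp_grad.1 one_le_two

/-! ### Dilates of weak solutions -/

/-- If `-Δv = f(v)` then `-Δ(v(·/t)) = t⁻² f(v(·/t))`. -/
theorem weak_solution_dilate {v : D12 N}
    (hv : ∀ h : D12 N, inner ℝ (D12.grad v) (D12.grad h) = ∫ x, f (v x) * h x) {t : ℝ}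
    (ht : 0 < t) (h : D12 N) :
    inner ℝ (D12.grad (D12.dilate t v)) (D12.grad h) =
      (t ^ 2)⁻¹ * ∫ x, f (D12.dilate t v x) * h x := by
  have hti : 0 < t⁻¹ := inv_pos.2 ht
  have h0 := hv (D12.dilate t⁻¹ h)
  rw [L2.inner_def] at h0 ⊢
  have e1 : ∫ x, inner ℝ (D12.grad v x) (D12.grad (D12.dilate t⁻¹ h) x) =
      ∫ x, t * inner ℝ (D12.grad v x) (D12.grad h (t • x)) := by
    refine integral_congr_ae ?_
    filter_upwards [D12.grad_dilate_ae hti h] with x hx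
    rw [hx, inv_inv, inner_smul_right]
  have e2 : ∫ x, f (v x) * D12.dilate t⁻¹ h x = ∫ x, f (v x) * h (t • x) := by
    refine integral_congr_ae ?_
    filter_upwards [D12.dilate_ae hti h] with x hx
    rw [hx, inv_inv]
  rw [e1, e2] at h0
  have h1 := integral_dil ht fun x => t * inner ℝ (D12.grad v x) (D12.grad h (t • x))
  have h2 := integral_dil ht fun x => f (v x) * h (t • x)
  simp only [smul_inv_smul₀ ht.ne'] at h1 h2
  have e3 : ∫ x, inner ℝ (D12.grad (D12.dilate t v) x) (D12.grad h x) =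
      (t ^ 2)⁻¹ * ∫ x, t * inner ℝ (D12.grad v (t⁻¹ • x)) (D12.grad h x) := by
    rw [← integral_const_mul]
    refine integral_congr_ae ?_
    filter_upwards [D12.grad_dilate_ae ht v] with x hx
    rw [hx, real_inner_smul_left]
    field_simp
  have e4 : ∫ x, f (D12.dilate t v x) * h x = ∫ x, f (v (t⁻¹ • x)) * h x := by
    refine integral_congr_ae ?_
    filter_upwards [D12.dilate_ae ht v] with x hx
    rw [hx]
  rw [e3, e4, h1, h2, h0]

end

section

variable {N : ℕ} [hN : Fact (2 < N)] {f : ℝ → ℝ} {C : ℝ}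

/-! ### The Pohozaev identity -/

theorem integral_abs_mul_indicator_le (v : D12 N) {a : RN N → ℝ} (ha : MemLp a 2 volume)
    {R t : ℝ} (hR : 0 ≤ R) (ht1 : 1 < t) (ht2 : t ≤ 2) :
    Integrable (fun x => |a x| *
      |(Metric.closedBall (0 : RN N) R).indicator (D12.dilate t v - v : D12 N) x|) volume ∧
    ∫ x, |a x| * |(Metric.closedBall (0 : RN N) R).indicator (D12.dilate t v - v : D12 N) x| ≤
      (eLpNorm a 2 volume).toReal * (√(2 ^ N) * R * ‖v‖) * (t - 1) := by
  have hle := v.eLpNorm_indicator_dilate_sub_le hR ht1 ht2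
  have hm : MemLp ((Metric.closedBall (0 : RN N) R).indicator (D12.dilate t v - v : D12 N)) 2
      volume :=
    ⟨(D12.memLp _).1.indicator measurableSet_closedBall, hle.trans_lt ENNReal.ofReal_lt_top⟩
  refine ⟨by simpa [abs_mul] using (MemLp.integrable_mul_of_holder ha hm).abs, ?_⟩
  refine (integral_abs_mul_le_of_holder ha hm).trans ?_
  have h0 : 0 ≤ t - 1 := by linarith
  rw [mul_assoc]
  gcongr
  refine (ENNReal.toReal_mono ENNReal.ofReal_ne_top hle).trans_eq ?_
  rw [ENNReal.toReal_ofReal (by positivity)]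
  ring

theorem tendsto_norm_dilate_sub (v : D12 N) :
    Tendsto (fun t : ℝ => ‖D12.dilate t v - v‖) (𝓝[>] 1) (𝓝 0) := by
  have h1 : D12.dilate ((1 : ℝ≥0) : ℝ) v = v := by
    rw [NNReal.coe_one]
    refine D12.grad_injective (Lp.ext ((D12.grad_dilate_ae one_pos v).trans ?_))
    refine Eventually.of_forall fun x => ?_
    simp only
    rw [inv_one, one_smul, one_smul]
  have h := ((D12.continuous_dilate v).sub (continuous_const (y := v))).norm.tendsto 1
  simp only [Pi.sub_apply] at h
  rw [h1, sub_self, norm_zero] at h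
  have h2 : Tendsto Real.toNNReal (𝓝[>] 1) (𝓝 1) := by
    have := (continuous_real_toNNReal.tendsto 1).mono_left (nhdsWithin_le_nhds (s := Set.Ioi 1))
    rwa [Real.toNNReal_one] at this
  refine (h.comp h2).congr' ?_
  filter_upwards [self_mem_nhdsWithin] with t ht
  simp only [Function.comp]
  rw [Real.coe_toNNReal t (zero_le_one.trans (le_of_lt ht))]

theorem eventually_nhdsGT_one : ∀ᶠ t : ℝ in 𝓝[>] 1, 1 < t ∧ t ≤ 2 :=
  Ioc_mem_nhdsGT one_lt_two

/-- The nonlinear remainder of a dilation increment is `o(t - 1)` on balls. This uses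
`f(v) ∈ L²`: the increment itself is only `O(t - 1)` in `L²`. -/
theorem eventually_integral_remainder_le (hf : Continuous f)
    (hC : ∀ s : ℝ, |f s| ≤ C * |s| ^ (critExp N - 1)) {v : D12 N}
    (hq : MemLp (fun x => |v x| ^ (critExp N - 1)) 2 volume) {L R : ℝ} (hR : 0 < R)
    {η : RN N → ℝ} (hη : IsCutoff L R η) {ε : ℝ} (hε : 0 < ε) :
    ∀ᶠ t : ℝ in 𝓝[>] 1, |∫ x, η x * (primitive f (D12.dilate t v x) - primitive f (v x) -
      f (v x) * (D12.dilate t v - v : D12 N) x)| ≤ ε * (t - 1) := by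
  have hp := two_lt_critExp N
  have hp1 : 1 < critExp N := by linarith
  have hC0 := growth_const_nonneg hC
  set D : ℝ := √(2 ^ N) * (2 * R) * ‖v‖ with hD
  have hD0 : 0 ≤ D := by positivity
  have hosc : Tendsto (fun δ => (eLpNorm (fun x => relOsc f δ (v x)) 2 volume).toReal * D)
      (𝓝[>] 0) (𝓝 0) := by
    have h := tendsto_eLpNorm_relOsc hf hp1 hC two_ne_zero (by simp) v.memLp.1 hq
    simpa using ((ENNReal.tendsto_toReal ENNReal.zero_ne_top).comp h).mul_const D
  obtain ⟨δ, hδ1, hδ2⟩ := ((hosc.eventually (gt_mem_nhds (half_pos hε))).and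
    (Ioc_mem_nhdsGT (zero_lt_one (α := ℝ)))).exists
  have hm := memLp_relOsc hf hp1 hC v.memLp.1 hq hδ2.1 hδ2.2
  set A : ℝ := 3 * C * (1 / δ + 1) ^ critExp N with hA
  have hA0 : 0 ≤ A := by have := hδ2.1; positivity
  -- the increments tend to zero in `L^{2(2* - 1)}`
  set r : ℝ≥0∞ := 2 * ENNReal.ofReal (critExp N - 1) with hr
  have hr1 : 1 ≤ r := by
    have h1 : (1 : ℝ≥0∞) ≤ ENNReal.ofReal (critExp N - 1) := by
      rw [← ENNReal.ofReal_one]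
      exact ENNReal.ofReal_le_ofReal (by linarith)
    calc (1 : ℝ≥0∞) ≤ 2 * 1 := by norm_num
      _ ≤ r := by rw [hr]; gcongr
  have hrt : r ≠ ⊤ := ENNReal.mul_ne_top (by simp) ENNReal.ofReal_ne_top
  have hpow {u : RN N → ℝ} : eLpNorm (fun x => |u x| ^ (critExp N - 1)) 2 volume =
      eLpNorm u r volume ^ (critExp N - 1) :=
    eLpNorm_norm_rpow u (by linarith)
  have hvr : MemLp v r volume := by
    refine ⟨v.memLp.1, ?_⟩
    have h := hq.2
    rw [hpow] at h
    by_contra hcon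
    rw [not_lt, top_le_iff] at hcon
    rw [hcon, ENNReal.top_rpow_of_pos (by linarith)] at h
    exact lt_irrefl _ h
  have hinc (t : ℝ) (ht : 0 < t) : (D12.dilate t v - v : D12 N) =ᵐ[volume]
      fun x => v (t⁻¹ • x) - v x := by
    filter_upwards [D12.coeFn_sub (D12.dilate t v) v, D12.dilate_ae ht v] with x h1 h2
    rw [h1, h2]
  have hHr (t : ℝ) (ht : 0 < t) : MemLp (D12.dilate t v - v : D12 N) r volume :=
    (memLp_congr_ae (hinc t ht)).2 ((memLp_dil ht hvr).sub hvr)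
  have hHq (t : ℝ) (ht : 0 < t) :
      MemLp (fun x => |(D12.dilate t v - v : D12 N) x| ^ (critExp N - 1)) 2 volume := by
    refine ⟨(continuous_abs.rpow_const fun _ => Or.inr (by linarith)).comp_aestronglyMeasurable
      (D12.memLp _).1, ?_⟩
    rw [hpow]
    exact ENNReal.rpow_lt_top_of_nonneg (by linarith) (hHr t ht).2.ne
  have hsmall : Tendsto (fun t : ℝ => A * (eLpNorm
      (fun x => |(D12.dilate t v - v : D12 N) x| ^ (critExp N - 1)) 2 volume).toReal * D)
      (𝓝[>] 1) (𝓝 0) := by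
    have h1 : Tendsto (fun t : ℝ => eLpNorm (fun x => v (t⁻¹ • x) - v x) r volume ^
        (critExp N - 1)) (𝓝[>] 1) (𝓝 0) := by
      have h := (ENNReal.continuous_rpow_const (y := critExp N - 1)).tendsto _ |>.comp
        ((tendsto_eLpNorm_dil_sub hr1 hrt hvr).mono_left
          (nhdsWithin_le_nhds (s := Set.Ioi 1)))
      rwa [ENNReal.zero_rpow_of_pos (by linarith)] at h
    have h2 := (((ENNReal.tendsto_toReal ENNReal.zero_ne_top).comp h1).const_mul A).mul_const D
    rw [ENNReal.toReal_zero, mul_zero, zero_mul] at h2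
    refine h2.congr' ?_
    filter_upwards [eventually_nhdsGT_one] with t ht
    simp only [Function.comp]
    rw [hpow, eLpNorm_congr_ae (hinc t (by linarith))]
  filter_upwards [eventually_nhdsGT_one, hsmall.eventually (gt_mem_nhds (half_pos hε))]
    with t ⟨ht1, ht2⟩ hts
  have ht0 : 0 < t := by linarith
  set H : D12 N := D12.dilate t v - v with hH
  set a : RN N → ℝ := fun x => relOsc f δ (v x) + A * |H x| ^ (critExp N - 1) with ha
  have hap : MemLp a 2 volume := hm.add ((hHq t ht0).const_mul A)
  have hB0 : 0 ≤ 2 * R := by linarith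
  obtain ⟨hint, hle⟩ := integral_abs_mul_indicator_le v hap hB0 ht1 ht2
  have hnorm : (eLpNorm a 2 volume).toReal ≤ (eLpNorm (fun x => relOsc f δ (v x)) 2 volume).toReal +
      A * (eLpNorm (fun x => |H x| ^ (critExp N - 1)) 2 volume).toReal := by
    have h1 : eLpNorm a 2 volume ≤ eLpNorm (fun x => relOsc f δ (v x)) 2 volume +
        ENNReal.ofReal A * eLpNorm (fun x => |H x| ^ (critExp N - 1)) 2 volume := by
      refine (eLpNorm_add_le hm.1 ((hHq t ht0).const_mul A).1 one_le_two).trans ?_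
      gcongr
      refine eLpNorm_le_mul_eLpNorm_of_ae_le_mul (ae_of_all _ fun x => ?_) _
      rw [norm_mul, Real.norm_of_nonneg hA0]
    have h2 := ENNReal.toReal_mono (ENNReal.add_ne_top.2 ⟨hm.2.ne,
      ENNReal.mul_ne_top ENNReal.ofReal_ne_top (hHq t ht0).2.ne⟩) h1
    rwa [ENNReal.toReal_add hm.2.ne (ENNReal.mul_ne_top ENNReal.ofReal_ne_top (hHq t ht0).2.ne),
      ENNReal.toReal_mul, ENNReal.toReal_ofReal hA0] at h2
  have hpt : ∀ᵐ x, ‖η x * (primitive f (D12.dilate t v x) - primitive f (v x) -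
      f (v x) * H x)‖ ≤ |a x| * |(Metric.closedBall (0 : RN N) (2 * R)).indicator H x| := by
    filter_upwards [D12.coeFn_sub (D12.dilate t v) v] with x hx
    by_cases hxB : x ∈ Metric.closedBall (0 : RN N) (2 * R)
    · rw [Set.indicator_of_mem hxB, norm_mul, Real.norm_of_nonneg (hη.nonneg x)]
      have h1 : D12.dilate t v x = v x + H x := by
        rw [hH, hx]
        ring
      have h2 := abs_primitive_remainder_le hf hp1 hC hδ2.1 (v x) (H x)
      have h3 : 0 ≤ a x := by
        have := relOsc_nonneg (f := f) δ (v x)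
        positivity
      rw [h1, abs_of_nonneg h3]
      refine (mul_le_of_le_one_left (norm_nonneg _) (hη.le_one x)).trans (h2.trans_eq ?_)
      rw [ha]
      simp only
      rw [add_mul, mul_assoc A, ← Real.rpow_add_one' (abs_nonneg _) (by linarith),
        sub_add_cancel]
    · rw [hη.eq_zero x (by rw [mem_closedBall_zero_iff] at hxB; linarith), zero_mul, norm_zero]
      positivity
  have h0 : 0 ≤ t - 1 := by linarith
  calc _ ≤ (eLpNorm a 2 volume).toReal * D * (t - 1) :=
        (norm_integral_le_of_norm_le hint hpt).trans hle
    _ ≤ ((eLpNorm (fun x => relOsc f δ (v x)) 2 volume).toReal +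
          A * (eLpNorm (fun x => |H x| ^ (critExp N - 1)) 2 volume).toReal) * D * (t - 1) := by
        gcongr
    _ ≤ ε * (t - 1) := by
        gcongr
        rw [add_mul]
        linarith

/-- The two right-hand sides differ by `o(1)` in `L²`, as dilations act continuously there, so
that pairing the difference with the increment gives `o(t - 1)`. -/
theorem eventually_integral_source_le (hf : Continuous f)
    (hC : ∀ s : ℝ, |f s| ≤ C * |s| ^ (critExp N - 1)) {v : D12 N}
    (hq : MemLp (fun x => |v x| ^ (critExp N - 1)) 2 volume) {L R : ℝ} (hR : 0 < R)
    {η : RN N → ℝ} (hη : IsCutoff L R η) {ε : ℝ} (hε : 0 < ε) :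
    ∀ᶠ t : ℝ in 𝓝[>] 1, |∫ x, ((t ^ 2)⁻¹ * f (D12.dilate t v x) - f (v x)) *
      (η x * (D12.dilate t v - v : D12 N) x)| ≤ ε * (t - 1) := by
  set D : ℝ := √(2 ^ N) * (2 * R) * ‖v‖ with hD
  have hD0 : 0 ≤ D := by positivity
  have hk : MemLp (fun x => f (v x)) 2 volume := memLp_comp_of_growth hf hC v.memLp.1 hq
  set k := hk.toLp _
  have hone : dilLpExt 1 2 k = k := by
    rw [dilLpExt_of_pos one_pos]
    refine Lp.ext ((dilLp_ae 1 one_pos 2 k).trans (Eventually.of_forall fun x => ?_))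
    simp only
    rw [inv_one, one_smul]
  have hlim : Tendsto (fun t : ℝ => ‖(t ^ 2)⁻¹ • dilLpExt t 2 k - k‖ * D) (𝓝[>] 1) (𝓝 0) := by
    have h1 : ContinuousAt (fun t : ℝ => (t ^ 2)⁻¹) 1 :=
      (continuousAt_id.pow 2).inv₀ (by norm_num)
    have h2 := ((h1.smul (continuousAt_dilLpExt one_pos (by simp) k)).tendsto.sub_const k).norm
    simp only [Pi.smul_apply'] at h2
    rw [hone, one_pow, inv_one, one_smul, sub_self, norm_zero] at h2
    simpa using (h2.mul_const D).mono_left (nhdsWithin_le_nhds (s := Set.Ioi 1))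
  filter_upwards [eventually_nhdsGT_one, hlim.eventually (gt_mem_nhds hε)] with t ⟨ht1, ht2⟩ hts
  have ht0 : 0 < t := by linarith
  set a : Lp ℝ 2 (volume : Measure (RN N)) := (t ^ 2)⁻¹ • dilLpExt t 2 k - k with ha
  have hae : a =ᵐ[volume] fun x => (t ^ 2)⁻¹ * f (D12.dilate t v x) - f (v x) := by
    have h1 := Lp.coeFn_sub ((t ^ 2)⁻¹ • dilLpExt t 2 k) k
    have h2 := Lp.coeFn_smul ((t ^ 2)⁻¹) (dilLpExt t 2 k)
    rw [dilLpExt_of_pos ht0] at h1 h2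
    rw [ha, dilLpExt_of_pos ht0]
    filter_upwards [h1, h2, dilLp_ae t ht0 2 k, ae_dil ht0 hk.coeFn_toLp, hk.coeFn_toLp,
      D12.dilate_ae ht0 v] with x h1 h2 h3 h4 h5 h6
    rw [h1, Pi.sub_apply, h2, Pi.smul_apply, h3, h4, h5, h6, smul_eq_mul]
  obtain ⟨hint, hle⟩ := integral_abs_mul_indicator_le v (Lp.memLp a)
    (R := 2 * R) (by linarith) ht1 ht2
  rw [← Real.norm_eq_abs]
  refine (norm_integral_le_of_norm_le hint ?_).trans (hle.trans ?_)
  · filter_upwards [hae] with x hx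
    rw [← hx, norm_mul, Real.norm_eq_abs]
    gcongr
    by_cases hxB : x ∈ Metric.closedBall (0 : RN N) (2 * R)
    · rw [Set.indicator_of_mem hxB, norm_mul, Real.norm_of_nonneg (hη.nonneg x)]
      exact mul_le_of_le_one_left (norm_nonneg _) (hη.le_one x)
    · rw [hη.eq_zero x (by rw [mem_closedBall_zero_iff] at hxB; linarith), zero_mul, norm_zero]
      positivity
  · rw [← Lp.norm_def]
    have h0 : 0 ≤ t - 1 := by linarith
    gcongr

/-- The error produced by the gradient of the cutoff function is controlled by the gradient of
`v` away from the ball of radius `R`. -/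
theorem eventually_integral_gradient_cutoff_le (v : D12 N) {L R : ℝ} (hL : 0 ≤ L) (hR : 0 < R)
    {η : RN N → ℝ} (hη : IsCutoff L R η) {ε : ℝ} (hε : 0 < ε) :
    ∀ᶠ t : ℝ in 𝓝[>] 1, |∫ x, (D12.dilate t v - v : D12 N) x *
      inner ℝ (D12.grad v x + D12.grad (D12.dilate t v) x) (gradient η x)| ≤
      (4 * L * √(2 ^ N) * ‖v‖ * (eLpNorm ({x | R ≤ ‖x‖}.indicator fun x => ‖D12.grad v x‖) 2
        volume).toReal + ε) * (t - 1) := by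
  set T : ℝ := (eLpNorm ({x | R ≤ ‖x‖}.indicator fun x => ‖D12.grad v x‖) 2 volume).toReal with hT
  have hTm : MemLp ({x : RN N | R ≤ ‖x‖}.indicator fun x => ‖D12.grad v x‖) 2 volume :=
    v.memLp_grad.norm.indicator (measurableSet_le_norm R)
  have hlim := (tendsto_norm_dilate_sub v).const_mul (2 * L * √(2 ^ N) * ‖v‖)
  rw [mul_zero] at hlim
  filter_upwards [eventually_nhdsGT_one, hlim.eventually (gt_mem_nhds hε)] with t ⟨ht1, ht2⟩ hts
  set H : D12 N := D12.dilate t v - v with hH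
  set a : RN N → ℝ := fun x => L / R * (2 * {x : RN N | R ≤ ‖x‖}.indicator
    (fun x => ‖D12.grad v x‖) x + ‖D12.grad H x‖) with ha
  have hap : MemLp a 2 volume := ((hTm.const_mul 2).add H.memLp_grad.norm).const_mul (L / R)
  obtain ⟨hint, hle⟩ := integral_abs_mul_indicator_le v hap (R := 2 * R) (by linarith) ht1 ht2
  have hnorm : (eLpNorm a 2 volume).toReal ≤ L / R * (2 * T + ‖H‖) := by
    have h1 : eLpNorm a 2 volume ≤ ENNReal.ofReal (L / R) * (ENNReal.ofReal 2 *
        eLpNorm ({x : RN N | R ≤ ‖x‖}.indicator fun x => ‖D12.grad v x‖) 2 volume +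
          eLpNorm (D12.grad H) 2 volume) := by
      calc eLpNorm a 2 volume ≤ ENNReal.ofReal (L / R) *
            eLpNorm ((fun x => 2 * {x : RN N | R ≤ ‖x‖}.indicator (fun x => ‖D12.grad v x‖) x) +
              fun x => ‖D12.grad H x‖) 2 volume := by
            refine eLpNorm_le_mul_eLpNorm_of_ae_le_mul (ae_of_all _ fun x => ?_) _
            rw [norm_mul, Real.norm_of_nonneg (by positivity : 0 ≤ L / R)]
            rfl
        _ ≤ _ := by
            gcongr
            refine (eLpNorm_add_le (hTm.const_mul 2).1 H.memLp_grad.norm.1 one_le_two).trans ?_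
            rw [eLpNorm_norm]
            gcongr
            refine eLpNorm_le_mul_eLpNorm_of_ae_le_mul (ae_of_all _ fun x => ?_) _
            rw [norm_mul, Real.norm_of_nonneg two_pos.le]
    have hne : ENNReal.ofReal 2 * eLpNorm ({x : RN N | R ≤ ‖x‖}.indicator
        fun x => ‖D12.grad v x‖) 2 volume ≠ ⊤ := ENNReal.mul_ne_top (by simp) hTm.2.ne
    have h2 := ENNReal.toReal_mono (ENNReal.mul_ne_top ENNReal.ofReal_ne_top
      (ENNReal.add_ne_top.2 ⟨hne, H.memLp_grad.2.ne⟩)) h1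
    rwa [ENNReal.toReal_mul, ENNReal.toReal_add hne H.memLp_grad.2.ne, ENNReal.toReal_mul,
      ENNReal.toReal_ofReal two_pos.le, ENNReal.toReal_ofReal (by positivity), ← hT,
      ← Lp.norm_def, ← D12.norm_eq] at h2
  rw [← Real.norm_eq_abs]
  refine (norm_integral_le_of_norm_le hint ?_).trans (hle.trans ?_)
  · filter_upwards [D12.grad_sub_ae (D12.dilate t v) v] with x hx
    by_cases hxB : x ∈ Metric.closedBall (0 : RN N) (2 * R)
    · rw [Set.indicator_of_mem hxB, norm_mul, mul_comm, Real.norm_eq_abs (H x)]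
      gcongr
      have hGH : D12.grad v x + D12.grad (D12.dilate t v) x =
          (2 : ℝ) • D12.grad v x + D12.grad H x := by
        rw [hH, hx, two_smul]
        abel
      rw [hGH]
      by_cases hxR : R ≤ ‖x‖
      · refine (norm_inner_le_norm _ _).trans (le_trans ?_ (le_abs_self _))
        rw [ha]
        simp only
        rw [Set.indicator_of_mem (by exact hxR), mul_comm]
        gcongr
        · exact hη.gradient_le x
        · refine (norm_add_le _ _).trans_eq ?_
          rw [norm_smul, Real.norm_of_nonneg two_pos.le]
      · rw [hη.gradient_eq_zero_of_lt x (not_le.1 hxR), inner_zero_right, norm_zero]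
        exact abs_nonneg _
    · rw [hη.gradient_eq_zero_of_gt x (by rw [mem_closedBall_zero_iff] at hxB; linarith),
        inner_zero_right, mul_zero, norm_zero]
      positivity
  · have h0 : 0 ≤ t - 1 := by linarith
    gcongr
    calc _ ≤ L / R * (2 * T + ‖H‖) * (√(2 ^ N) * (2 * R) * ‖v‖) := by gcongr
      _ = 4 * L * √(2 ^ N) * ‖v‖ * T + 2 * L * √(2 ^ N) * ‖v‖ * ‖H‖ := by
          field_simp
          ring
      _ ≤ _ := by gcongr

/-- The equations of `v` and of its dilate, both tested with `η (v(·/t) - v)`, and added. Twice the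
difference of `F` appears in place of `2 f(v) (v(·/t) - v)`, up to the Taylor remainder. -/
theorem integral_cutoff_identity (hf : Continuous f)
    (hC : ∀ s : ℝ, |f s| ≤ C * |s| ^ (critExp N - 1)) {v : D12 N}
    (hv : ∀ h : D12 N, inner ℝ (D12.grad v) (D12.grad h) = ∫ x, f (v x) * h x)
    {L R : ℝ} {η : RN N → ℝ} (hη : IsCutoff L R η) {t : ℝ} (ht : 0 < t) :
    (∫ x, η x * ‖D12.grad (D12.dilate t v) x‖ ^ 2) - (∫ x, η x * ‖D12.grad v x‖ ^ 2) +
      ∫ x, (D12.dilate t v - v : D12 N) x *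
        inner ℝ (D12.grad v x + D12.grad (D12.dilate t v) x) (gradient η x) =
    2 * ((∫ x, η x * primitive f (D12.dilate t v x)) - ∫ x, η x * primitive f (v x)) -
      2 * (∫ x, η x * (primitive f (D12.dilate t v x) - primitive f (v x) -
        f (v x) * (D12.dilate t v - v : D12 N) x)) +
      ∫ x, ((t ^ 2)⁻¹ * f (D12.dilate t v x) - f (v x)) *
        (η x * (D12.dilate t v - v : D12 N) x) := by
  have hp := two_lt_critExp N
  have hp1 : 1 < critExp N := by linarith
  set V : D12 N := D12.dilate t v with hV
  set H : D12 N := V - v with hH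
  obtain ⟨w, hw, hgw⟩ := H.exists_test_mul hη.isTest
  have hb (x : RN N) : ‖η x‖ ≤ 1 := by
    rw [Real.norm_of_nonneg (hη.nonneg x)]
    exact hη.le_one x
  have hcut {g : RN N → ℝ} (hg : Integrable g volume) : Integrable (fun x => η x * g x) volume :=
    hg.bdd_mul (c := 1) hη.isTest.1.continuous.aestronglyMeasurable (ae_of_all _ hb)
  have := holderConjugate_critExpE N
  have hprod (u : D12 N) (h : D12 N) : Integrable (fun x => f (u x) * h x) volume :=
    MemLp.integrable_mul_of_holder (memLp_comp_of_growth hf hC u.memLp.1 u.memLp_rpow) h.memLp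
  have hF (u : D12 N) : Integrable (fun x => η x * primitive f (u x)) volume :=
    hcut (integrable_primitive_comp hf hp1 hC u.memLp)
  have hE (u : D12 N) : Integrable (fun x => η x * ‖D12.grad u x‖ ^ 2) volume :=
    hcut ((memLp_two_iff_integrable_sq_norm u.memLp_grad.1).1 u.memLp_grad)
  have hsum : inner ℝ (D12.grad v) (D12.grad w) + inner ℝ (D12.grad V) (D12.grad w) =
      (∫ x, f (v x) * w x) + (t ^ 2)⁻¹ * ∫ x, f (V x) * w x := by
    rw [hv w, weak_solution_dilate hv ht w]
  have hXi : Integrable (fun x => η x * (primitive f (V x) - primitive f (v x) -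
      f (v x) * H x)) volume :=
    hcut (((integrable_primitive_comp hf hp1 hC V.memLp).sub
      (integrable_primitive_comp hf hp1 hC v.memLp)).sub (hprod v H))
  have hYi : Integrable (fun x => ((t ^ 2)⁻¹ * f (V x) - f (v x)) * (η x * H x)) volume := by
    refine ((hcut (((hprod V H).const_mul ((t ^ 2)⁻¹)).sub (hprod v H)))).congr
      (ae_of_all _ fun x => ?_)
    simp only [Pi.sub_apply]
    ring
  -- the left-hand side
  have hZ : (fun x => inner ℝ (D12.grad v x) (D12.grad w x) +
      inner ℝ (D12.grad V x) (D12.grad w x)) =ᵐ[volume] fun x =>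
      (η x * ‖D12.grad V x‖ ^ 2 - η x * ‖D12.grad v x‖ ^ 2) +
        H x * inner ℝ (D12.grad v x + D12.grad V x) (gradient η x) := by
    filter_upwards [hgw, D12.grad_sub_ae V v] with x h1 h2
    rw [h1, ← inner_add_left, inner_add_right, inner_smul_right, inner_smul_right, hH, h2,
      inner_sub_right, inner_add_left, inner_add_left, real_inner_self_eq_norm_sq,
      real_inner_self_eq_norm_sq, real_inner_comm (D12.grad V x) (D12.grad v x)]
    ring
  have hi1 := L2.integrable_inner (𝕜 := ℝ) (D12.grad v) (D12.grad w)
  have hi2 := L2.integrable_inner (𝕜 := ℝ) (D12.grad V) (D12.grad w)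
  have hZi : Integrable (fun x => H x *
      inner ℝ (D12.grad v x + D12.grad V x) (gradient η x)) volume := by
    refine (((hi1.add hi2).congr hZ).sub ((hE V).sub (hE v))).congr (ae_of_all _ fun x => ?_)
    simp
  have hleft : inner ℝ (D12.grad v) (D12.grad w) + inner ℝ (D12.grad V) (D12.grad w) =
      (∫ x, η x * ‖D12.grad V x‖ ^ 2) - (∫ x, η x * ‖D12.grad v x‖ ^ 2) +
        ∫ x, H x * inner ℝ (D12.grad v x + D12.grad V x) (gradient η x) := by
    have e1 := integral_add ((hE V).sub (hE v)) hZi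
    simp only [Pi.sub_apply] at e1
    rw [L2.inner_def, L2.inner_def, ← integral_add hi1 hi2, integral_congr_ae hZ, e1,
      integral_sub (hE V) (hE v)]
  -- the right-hand side
  have hR1 : (fun x => f (v x) * w x + (t ^ 2)⁻¹ * (f (V x) * w x)) =ᵐ[volume] fun x =>
      (2 * (η x * primitive f (V x) - η x * primitive f (v x)) -
        2 * (η x * (primitive f (V x) - primitive f (v x) - f (v x) * H x))) +
        ((t ^ 2)⁻¹ * f (V x) - f (v x)) * (η x * H x) := by
    filter_upwards [hw] with x hx
    rw [hx]
    ring
  have hright : (∫ x, f (v x) * w x) + (t ^ 2)⁻¹ * ∫ x, f (V x) * w x =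
      2 * ((∫ x, η x * primitive f (V x)) - ∫ x, η x * primitive f (v x)) -
      2 * (∫ x, η x * (primitive f (V x) - primitive f (v x) - f (v x) * H x)) +
      ∫ x, ((t ^ 2)⁻¹ * f (V x) - f (v x)) * (η x * H x) := by
    have i1 := ((hF V).sub (hF v)).const_mul 2
    have e1 := integral_add (i1.sub (hXi.const_mul 2)) hYi
    have e2 := integral_sub i1 (hXi.const_mul 2)
    simp only [Pi.sub_apply] at e1 e2
    rw [← integral_const_mul, ← integral_add (hprod v w) ((hprod V w).const_mul _),
      integral_congr_ae hR1, e1, e2, integral_const_mul, integral_const_mul,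
      integral_sub (hF V) (hF v)]
  rw [← hleft, ← hright, hsum]

/-- The Pohozaev identity with a cutoff function: the error comes from the region where the
cutoff function is not constant. -/
theorem abs_cutoff_pohozaev_le (hf : Continuous f)
    (hC : ∀ s : ℝ, |f s| ≤ C * |s| ^ (critExp N - 1)) {v : D12 N}
    (hv : ∀ h : D12 N, inner ℝ (D12.grad v) (D12.grad h) = ∫ x, f (v x) * h x)
    {L R : ℝ} (hL : 0 ≤ L) (hR : 0 < R) {η : RN N → ℝ} (hη : IsCutoff L R η) :
    |(N - 2) * (∫ x, η x * ‖D12.grad v x‖ ^ 2) - 2 * N * ∫ x, η x * primitive f (v x)| ≤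
      4 * L * √(2 ^ N) * ‖v‖ * (eLpNorm ({x | R ≤ ‖x‖}.indicator fun x => ‖D12.grad v x‖) 2
        volume).toReal +
      2 ^ N * (2 * L) * (∫ x in {x | R / 2 ≤ ‖x‖}, |‖D12.grad v x‖ ^ 2|) +
      2 * (2 ^ N * (2 * L) * ∫ x in {x | R / 2 ≤ ‖x‖}, |primitive f (v x)|) := by
  have hp := two_lt_critExp N
  have hq := memLp_two_rpow_of_weak_solution hf hC hv
  set E : ℝ := ∫ x, η x * ‖D12.grad v x‖ ^ 2 with hE
  set Φ : ℝ := ∫ x, η x * primitive f (v x) with hΦ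
  set S₁ : ℝ := 4 * L * √(2 ^ N) * ‖v‖ * (eLpNorm ({x | R ≤ ‖x‖}.indicator
    fun x => ‖D12.grad v x‖) 2 volume).toReal
  set S₂ : ℝ := 2 ^ N * (2 * L) * (∫ x in {x | R / 2 ≤ ‖x‖}, |‖D12.grad v x‖ ^ 2|) with hS₂
  set S₃ : ℝ := 2 ^ N * (2 * L) * ∫ x in {x | R / 2 ≤ ‖x‖}, |primitive f (v x)| with hS₃
  have hS₂0 : 0 ≤ S₂ := mul_nonneg (by positivity) (integral_nonneg fun x => abs_nonneg _)
  refine le_of_forall_pos_le_add fun ε hε => ?_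
  have hε4 : 0 < ε / 4 := by linarith
  have hderiv : HasDerivAt (fun t : ℝ => t ^ (N - 2) * E - t ^ N * (2 * Φ))
      ((N - 2) * E - 2 * N * Φ) 1 := by
    have h := ((hasDerivAt_pow (N - 2) (1 : ℝ)).mul_const E).sub
      ((hasDerivAt_pow N (1 : ℝ)).mul_const (2 * Φ))
    simp only [one_pow, mul_one, natCast_dim_sub_two] at h
    exact h.congr_deriv (by ring)
  -- the difference quotients at `t = 1` are estimated through the tested equations
  have hslope := (hderiv.tendsto_slope.mono_left
    (nhdsWithin_mono (1 : ℝ) (s := Set.Ioi 1) (t := {1}ᶜ) fun t ht => ne_of_gt ht)).abs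
  refine le_of_tendsto hslope ?_
  filter_upwards [eventually_nhdsGT_one, eventually_integral_remainder_le hf hC hq hR hη hε4,
    eventually_integral_source_le hf hC hq hR hη hε4,
    eventually_integral_gradient_cutoff_le v hL hR hη hε4] with t ⟨ht1, ht2⟩ hX hY hZ
  have ht0 : 0 < t := by linarith
  have hid := integral_cutoff_identity hf hC hv hη ht0
  have hEi := (memLp_two_iff_integrable_sq_norm v.memLp_grad.1).1 v.memLp_grad
  have hFi := integrable_primitive_comp hf (by linarith) hC v.memLp
  have h2 := hη.abs_integral_dil_sub_le hL hR hEi ht1.le ht2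
  have h3 := hη.abs_integral_dil_sub_le hL hR hFi ht1.le ht2
  have e2 : ∫ x, η x * ‖D12.grad (D12.dilate t v) x‖ ^ 2 =
      (t ^ 2)⁻¹ * ∫ x, η x * ‖D12.grad v (t⁻¹ • x)‖ ^ 2 := by
    rw [← integral_const_mul]
    refine integral_congr_ae ?_
    filter_upwards [D12.grad_dilate_ae ht0 v] with x hx
    rw [hx, norm_smul, mul_pow, norm_inv, inv_pow, Real.norm_of_nonneg ht0.le]
    ring
  have e3 : ∫ x, η x * primitive f (D12.dilate t v x) =
      ∫ x, η x * primitive f (v (t⁻¹ • x)) := by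
    refine integral_congr_ae ?_
    filter_upwards [D12.dilate_ae ht0 v] with x hx
    rw [hx]
  rw [e2, e3] at hid
  set I₂ := ∫ x, η x * ‖D12.grad v (t⁻¹ • x)‖ ^ 2
  set I₃ := ∫ x, η x * primitive f (v (t⁻¹ • x))
  set X := ∫ x, η x * (primitive f (D12.dilate t v x) - primitive f (v x) -
        f (v x) * (D12.dilate t v - v : D12 N) x)
  set Y := ∫ x, ((t ^ 2)⁻¹ * f (D12.dilate t v x) - f (v x)) *
        (η x * (D12.dilate t v - v : D12 N) x)
  set Z := ∫ x, (D12.dilate t v - v : D12 N) x *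
        inner ℝ (D12.grad v x + D12.grad (D12.dilate t v) x) (gradient η x)
  replace hid : ((t ^ 2)⁻¹ * I₂ - E) + Z = 2 * (I₃ - Φ) - 2 * X + Y := hid
  replace h2 : |I₂ - t ^ N * E| ≤ S₂ * (t - 1) := h2
  replace h3 : |I₃ - t ^ N * Φ| ≤ S₃ * (t - 1) := h3
  replace hZ : |Z| ≤ (S₁ + ε / 4) * (t - 1) := hZ
  clear_value E Φ S₁ S₂ S₃ I₂ I₃ X Y Z
  have hpow : (t ^ 2)⁻¹ * t ^ N = t ^ (N - 2) := by
    have : t ^ N = t ^ (N - 2) * t ^ 2 := by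
      rw [← pow_add]
      congr 1
      have := hN.out
      omega
    rw [this]
    field_simp
  have hnum : (t ^ (N - 2) * E - t ^ N * (2 * Φ)) - (E - 2 * Φ) =
      -((t ^ 2)⁻¹ * (I₂ - t ^ N * E)) - Z + 2 * (I₃ - t ^ N * Φ) - 2 * X + Y := by
    rw [← hpow]
    linear_combination hid
  have hti : (t ^ 2)⁻¹ ≤ 1 := inv_le_one_of_one_le₀ (one_le_pow₀ ht1.le)
  have h2' : |(t ^ 2)⁻¹ * (I₂ - t ^ N * E)| ≤ S₂ * (t - 1) := by
    rw [abs_mul, abs_of_nonneg (by positivity)]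
    exact (mul_le_of_le_one_left (abs_nonneg _) hti).trans h2
  have hbound : |(t ^ (N - 2) * E - t ^ N * (2 * Φ)) - (E - 2 * Φ)| ≤
      (S₁ + S₂ + 2 * S₃ + ε) * (t - 1) := by
    rw [hnum]
    have a1 := abs_le.1 h2'
    have a2 := abs_le.1 h3
    have a3 := abs_le.1 hX
    have a4 := abs_le.1 hY
    have a5 := abs_le.1 hZ
    rw [abs_le]
    have hsplit : (S₁ + S₂ + 2 * S₃ + ε) * (t - 1) = (S₁ + ε / 4) * (t - 1) + S₂ * (t - 1) +
        2 * (S₃ * (t - 1)) + 2 * (ε / 4 * (t - 1)) + ε / 4 * (t - 1) := by ring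
    rw [hsplit]
    constructor <;> linarith
  rw [slope_def_field]
  simp only [one_pow, one_mul]
  rw [abs_div, abs_of_pos (by linarith : 0 < t - 1), div_le_iff₀ (by linarith)]
  exact hbound

/-- The Pohozaev identity for weak solutions in `𝒟^{1,2}`. -/
theorem pohozaev_identity (hf : Continuous f)
    (hC : ∀ s : ℝ, |f s| ≤ C * |s| ^ (critExp N - 1)) {v : D12 N}
    (hv : ∀ h : D12 N, inner ℝ (D12.grad v) (D12.grad h) = ∫ x, f (v x) * h x) :
    (N - 2) * ‖v‖ ^ 2 = 2 * N * psi f v := by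
  have hp := two_lt_critExp N
  obtain ⟨L, hL, hcut⟩ := exists_isCutoff N
  have hR (n : ℕ) : (0 : ℝ) < n + 1 := by positivity
  choose η hη using fun n : ℕ => hcut _ (hR n)
  have hEi := (memLp_two_iff_integrable_sq_norm v.memLp_grad.1).1 v.memLp_grad
  have hFi := integrable_primitive_comp hf (by linarith) hC v.memLp
  have hRlim : Tendsto (fun n : ℕ => (n : ℝ) + 1) atTop atTop :=
    tendsto_atTop_add_const_right _ _ tendsto_natCast_atTop_atTop
  have hmain {g : RN N → ℝ} (hg : Integrable g volume) :
      Tendsto (fun n => ∫ x, η n x * g x) atTop (𝓝 (∫ x, g x)) := by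
    refine tendsto_integral_of_dominated_convergence (fun x => |g x|)
      (fun n => (hη n).isTest.1.continuous.aestronglyMeasurable.mul hg.1) hg.abs
      (fun n => ae_of_all _ fun x => ?_) (ae_of_all _ fun x => ?_)
    · rw [norm_mul, Real.norm_of_nonneg ((hη n).nonneg x)]
      exact mul_le_of_le_one_left (norm_nonneg _) ((hη n).le_one x)
    · refine tendsto_const_nhds.congr' ?_
      filter_upwards [hRlim.eventually_ge_atTop ‖x‖] with n hn
      rw [(hη n).eq_one x hn, one_mul]
  have htail {g : RN N → ℝ} (hg : Integrable g volume) :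
      Tendsto (fun n : ℕ => ∫ x in {x | ((n : ℝ) + 1) / 2 ≤ ‖x‖}, |g x|) atTop (𝓝 0) := by
    have h : Tendsto (fun n : ℕ => ∫ x, {x : RN N | ((n : ℝ) + 1) / 2 ≤ ‖x‖}.indicator
        (fun x => |g x|) x) atTop (𝓝 (∫ _ : RN N, 0)) := by
      refine tendsto_integral_of_dominated_convergence (fun x => |g x|)
        (fun n => (hg.abs.indicator (measurableSet_le_norm _)).1) hg.abs
        (fun n => ae_of_all _ fun x => ?_) (ae_of_all _ fun x => ?_)
      · exact (norm_indicator_le_norm_self _ _).trans_eq (by simp)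
      · refine tendsto_const_nhds.congr' ?_
        filter_upwards [hRlim.eventually_gt_atTop (2 * ‖x‖)] with n hn
        rw [Set.indicator_of_notMem]
        simp only [Set.mem_ofPred_eq, not_le]
        linarith
    rw [integral_zero] at h
    exact h.congr fun n => integral_indicator (measurableSet_le_norm _)
  have hgrad : Tendsto (fun n : ℕ => (eLpNorm ({x : RN N | (n : ℝ) + 1 ≤ ‖x‖}.indicator
      fun x => ‖D12.grad v x‖) 2 volume).toReal) atTop (𝓝 0) := by
    have h := tendsto_eLpNorm_zero_of_dominated (l := atTop) (μ := (volume : Measure (RN N)))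
      (F := fun n : ℕ => {x : RN N | (n : ℝ) + 1 ≤ ‖x‖}.indicator fun x => ‖D12.grad v x‖)
      two_ne_zero (by simp)
      (Eventually.of_forall fun n => (v.memLp_grad.norm.indicator (measurableSet_le_norm _)).1)
      v.memLp_grad.norm
      (Eventually.of_forall fun n => ae_of_all _ fun x =>
        (norm_indicator_le_norm_self _ _).trans_eq (by simp))
      (ae_of_all _ fun x => by
        refine tendsto_const_nhds.congr' ?_
        filter_upwards [hRlim.eventually_gt_atTop ‖x‖] with n hn
        rw [Set.indicator_of_notMem]
        simpa using hn)
    have h2 := (ENNReal.tendsto_toReal ENNReal.zero_ne_top).comp h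
    rw [ENNReal.toReal_zero] at h2
    exact h2
  have hlhs := (((hmain hEi).const_mul ((N : ℝ) - 2)).sub
    ((hmain hFi).const_mul (2 * (N : ℝ)))).abs
  have hrhs := ((hgrad.const_mul (4 * L * √(2 ^ N) * ‖v‖)).add
    ((htail hEi).const_mul (2 ^ N * (2 * L)))).add
    (((htail hFi).const_mul (2 ^ N * (2 * L))).const_mul 2)
  have h0 := le_of_tendsto_of_tendsto' hlhs hrhs fun n =>
    abs_cutoff_pohozaev_le hf hC hv hL (hR n) (hη n)
  simp only [mul_zero, add_zero] at h0
  have h1 := abs_nonpos_iff.1 h0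
  rw [← D12.sq_norm_eq_integral] at h1
  have h2 : ∫ x, primitive f (v x) = psi f v := rfl
  rw [h2] at h1
  linarith

end

end CriticalProblem

theorem proposition2p4 (N : ℕ) [Fact (2 < N)] (f : ℝ → ℝ) (hf : Continuous f)
    (hF : ∃ s : ℝ, 0 < primitive f s)
    (C : ℝ) (hC : ∀ s : ℝ, |f s| ≤ C * |s| ^ (critExp N - 1)) :
    (∀ w : D12 N, IsKappaMaximizer f (tZero N f) w →
      IsCriticalPoint (energy f) w ∧
      0 < energy f w ∧
      (energy f w : EReal) =
        mountainPassLevel (energy (N := N) f) (pathsH1 (energy (N := N) f)) ∧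
      (energy f w : EReal) =
        mountainPassLevel (energy (N := N) f) (pathsD12 (energy (N := N) f)) ∧
      IsGreatest ((fun t : ℝ => energy f (D12.dilate t w)) '' Set.Ici 0) (energy f w)) ∧
    (∀ v : D12 N, IsCriticalPoint (energy f) v → 0 < psi f v →
      mountainPassLevel (energy (N := N) f) (pathsH1 (energy (N := N) f)) ≤
        (energy f v : EReal) ∧
      mountainPassLevel (energy (N := N) f) (pathsD12 (energy (N := N) f)) ≤
        (energy f v : EReal)) := by
  have hle := mountainPassLevel_pathsD12_le_pathsH1 (energy (N := N) f)
  refine ⟨fun w hw => ?_, fun v hv hψ => ?_⟩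
  · obtain ⟨ht, hψ⟩ := hw.critExp_mul_psi hf hC hF
    have hN := two_lt_dim N
    have hpos : 0 < psi f w := by
      refine pos_of_mul_pos_right ?_ (critExp_pos N).le
      rw [hψ]
      exact ht
    have hup := mountainPassLevel_le_of_pohozaev hf hC hpos (hw.pohozaev hψ)
    have hlow := hw.le_mountainPassLevel ht hψ
    refine ⟨hw.isCriticalPoint hf hC ht hψ, ?_, le_antisymm (hlow.trans hle) hup,
      le_antisymm hlow (hle.trans hup), hw.isGreatest_energy_dilate hψ⟩
    rw [energy_eq_of_pohozaev (hw.pohozaev hψ), hw.1]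
    exact div_pos ht (by linarith)
  · have hup := mountainPassLevel_le_of_pohozaev hf hC hψ
      (pohozaev_identity hf hC ((isCriticalPoint_iff hf hC v).1 hv))
    exact ⟨hup, hle.trans hup⟩
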